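/- **Setting.** Let $W\subset\mathbb R$ be open and consider $$\dot\alpha=\omega(A)+\varepsilon F(\alpha,A,t),\qquad \dot A=\varepsilon G(\alpha,A,t),\qquad \alpha\in\mathbb T,\ A\in W,$$ with $\omega,F,G$ real analytic and $F,G$ $2\pi$-periodic in $\alpha$ and $t$. Let $A_0\in W$ with $\omega(A_0)=p/q$, $q\ge1$, $\gcd(p,q)=1$, and $T=2\pi q$. Denote by $\langle\cdot\rangle$ the mean over $[0,T]$. A *subharmonic solution of order $q/p$* is a solution $(\alpha(t),A(t))$, $t\in\mathbb R$, with $\alpha(t+T)=\alpha(t)+2\pi p$, $A(t+T)=A(t)$, which continues the unperturbed solution $(\omega(A_0)(t-t_0),A_0)$. **Hypotheses.** 1. $\omega'(A_0)\ne0$. 2. $t_0$ is a zero of finite order $n\ge1$ (odd or even) of the Melnikov function $M(t_0)=\frac1T\int_0^T G(\omega(A_0)t,A_0,t+t_0)\,dt$. 3. Let $\bar\beta(t;\varepsilon,\beta_0)$, $\bar B(t;\varepsilon,\beta_0)$ be the $T$-periodic formal power series in $(\varepsilon,\beta_0)$, with $\langle\bar\beta\rangle=\beta_0$ and $\bar\beta=\beta_0$,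 $\bar B=0$ at $\varepsilon=0$, that solve $$\dot{\bar\beta}=\Phi+\omega'(A_0)\bar B,\qquad \dot{\bar B}=\Gamma-\langle\Gamma\rangle,\qquad \langle \bar B\rangle=-\langle\Phi\rangle/\omega'(A_0),$$ where $\Gamma=\varepsilon G$, $\Phi=\varepsilon F+\omega(A_0+\bar B)-\omega(A_0)-\omega'(A_0)\bar B$ and $F,G$ are evaluated at $(\omega(A_0)t+\bar\beta,\,A_0+\bar B,\,t+t_0)$. Let $\mathcal F(\varepsilon,\beta_0)$ be defined by $\varepsilon\mathcal F=\langle\Gamma\rangle$. Fix a sign $\sigma=\pm1$ and apply to $\mathcal F$ the Newton–Puiseux process for $\varepsilon=\sigma|\varepsilon|$: put $\mathcal F^{(0)}=\mathcal F$; given $\mathcal F^{(i)}=\sum f^{(i)}_{k,j}\,\epsilon_i^k y_i^j$, choose a segment of its Newton polygon, on the line $\mathfrak p^{(i)}k+\mathfrak h^{(i)}j=\mathfrak s^{(i)}$ with $\mathfrak p^{(i)},\mathfrak h^{(i)}\ge1$ coprime, and a real root $c_i$ of $$P^{(i)}(c)=\sum_{\mathfrak p^{(i)}k+\mathfrak h^{(i)}j=\mathfrak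 s^{(i)}}\sigma_i^k f^{(i)}_{k,j}\,c^j,\qquad \sigma_0=\sigma,\quad \sigma_i=1\ (i\ge1),$$ and define $\mathcal F^{(i+1)}$ by $\mathcal F^{(i)}\bigl(\sigma_i\eta^{\mathfrak p^{(i)}},\eta^{\mathfrak h^{(i)}}(c_i+y)\bigr)=\eta^{\mathfrak s^{(i)}}\mathcal F^{(i+1)}(\eta,y)$. Assume that for some $i_0\ge0$ the process can be carried out for the steps $i=0,\dots,i_0$ with $c_{i_0}$ a *simple* root of $P^{(i_0)}$. **Conclusion.** There is an explicitly computable $\varepsilon_0>0$ such that for all $\varepsilon$ of sign $\sigma$ with $|\varepsilon|<\varepsilon_0$ (hence for all $|\varepsilon|<\varepsilon_0$, if Hypothesis 3 holds for both signs) the system has a subharmonic solution of order $q/p$, given by a convergent power series in $|\varepsilon|^{1/n!}$. Precisely: * $\mathfrak p=\mathfrak p^{(0)}\cdots\mathfrak p^{(i_0)}$ divides $n!$. * With $\eta=|\varepsilon|^{1/\mathfrak p}$ and $H_i=\sum_{l\le i}\mathfrak h^{(l)}\mathfrak p^{(l+1)}\cdots\mathfrak p^{(i_0)}$, let $$\beta_0(\eta)=\sum_{i=0}^{i_0}c_i\eta^{H_i}+\eta^{H_{i_0}}y(\eta),$$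 where the coefficients of $y(\eta)=\sum_{k\ge1}y_k\eta^k$ are given recursively by $$y_{k+1}=-\frac1C\,[\eta^{k+1}]\,\mathcal F^{(i_0+1)}\bigl(\eta,y_1\eta+\dots+y_k\eta^k\bigr),\qquad C=\frac{dP^{(i_0)}}{dc}(c_{i_0}).$$ Let $b_m(t),B_m(t)$ be the coefficients of $\eta^m$ in the series $\bar\beta(t;\sigma\eta^{\mathfrak p},\beta_0(\eta))$, $\bar B(t;\sigma\eta^{\mathfrak p},\beta_0(\eta))$. Then $b_0=B_0=0$, and the solution is $$\alpha(t+t_0)=\omega(A_0)t+\sum_{m\ge0}b_m(t)\,|\varepsilon|^{m/\mathfrak p},\qquad A(t+t_0)=A_0+\sum_{m\ge0}B_m(t)\,|\varepsilon|^{m/\mathfrak p}.$$ * $|b_m(t)|\,\varepsilon_0^{m/\mathfrak p}\le1$ and $|B_m(t)|\,\varepsilon_0^{m/\mathfrak p}\le1$ for all $m$ and $t$, so the radius of convergence in $|\varepsilon|^{1/\mathfrak p}$ is at least $\varepsilon_0^{1/\mathfrak p}$. * "Explicitly computable" means that $\varepsilon_0=1/E(N)$ with one computable function $E:\mathbb N\to\mathbb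 N_{>0}$, the same for all systems. Here $N$ is any natural number with: $q\le N$; $(A_0-\frac1N,A_0+\frac1N)\subset W$; $|\omega'(A_0)|\ge\frac1N$; $|\omega^{(s)}(A_0)|/s!\le N^{s+1}$; $|\partial_\alpha^r\partial_A^sF(\alpha,A_0,t)|/(r!s!)\le N^{r+s+1}$ and the same for $G$, for all $r,s,\alpha,t$; $i_0,\mathfrak p^{(i)},\mathfrak h^{(i)},\mathfrak s^{(i)},|c_i|\le N$ for $i\le i_0$; $|C|\ge\frac1N$. Such an $N$ always exists. -/

import Mathlib

open scoped BigOperators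

/-! ## The perturbed system -/

/-- The system `α' = ω(A) + ε F(α, A, t)`, `A' = ε G(α, A, t)` on `𝕋 × W`, with real analytic
data that are `2π`-periodic in `α` and in `t` (functions on `𝕋` are written as `2π`-periodic
functions on `ℝ`). -/
structure PerturbedSystem where
  /-- the domain of the action variable -/
  W : Set ℝ
  /-- the unperturbed frequency -/
  ω : ℝ → ℝ
  /-- the perturbation of the angle equation -/
  F : ℝ → ℝ → ℝ → ℝ
  /-- the perturbation of the action equation -/
  G : ℝ → ℝ → ℝ → ℝ
  isOpen_W : IsOpen W
  analytic_ω : AnalyticOnNhd ℝ ω W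
  analytic_F : AnalyticOnNhd ℝ (fun x : ℝ × ℝ × ℝ => F x.1 x.2.1 x.2.2)
    (Set.univ ×ˢ W ×ˢ Set.univ)
  analytic_G : AnalyticOnNhd ℝ (fun x : ℝ × ℝ × ℝ => G x.1 x.2.1 x.2.2)
    (Set.univ ×ˢ W ×ˢ Set.univ)
  periodic_F_α : ∀ α t, ∀ A ∈ W, F (α + 2 * Real.pi) A t = F α A t
  periodic_F_t : ∀ α t, ∀ A ∈ W, F α A (t + 2 * Real.pi) = F α A t
  periodic_G_α : ∀ α t, ∀ A ∈ W, G (α + 2 * Real.pi) A t = G α A t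
  periodic_G_t : ∀ α t, ∀ A ∈ W, G α A (t + 2 * Real.pi) = G α A t

namespace PerturbedSystem

/-- `(x, y)` is a solution of the system with parameter `ε`, defined for all times, that closes
up after the time `2πq`, during which the angle `x` has made `p` turns. -/
structure IsSubharmonicSolution (S : PerturbedSystem) (p : ℤ) (q : ℕ) (ε : ℝ)
    (x y : ℝ → ℝ) : Prop where
  mem_W : ∀ t, y t ∈ S.W
  hasDerivAt_angle : ∀ t, HasDerivAt x (S.ω (y t) + ε * S.F (x t) (y t) t) t
  hasDerivAt_action : ∀ t, HasDerivAt y (ε * S.G (x t) (y t) t) t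
  angle_add_period : ∀ t, x (t + 2 * Real.pi * q) = x t + 2 * Real.pi * p
  action_add_period : ∀ t, y (t + 2 * Real.pi * q) = y t

end PerturbedSystem

/-- The mean over `[0, T]`. -/
noncomputable def meanOver (T : ℝ) (f : ℝ → ℝ) : ℝ := T⁻¹ * ∫ t in (0 : ℝ)..T, f t

/-- The primitive with mean zero over `[0, T]` of `f - ⟨f⟩`. For a `T`-periodic `f` it is
`T`-periodic, and its Fourier coefficients are `f_ν / (2πiν/T)` for `ν ≠ 0`, and `0` for
`ν = 0`. -/
noncomputable def meanZeroPrimitive (T : ℝ) (f : ℝ → ℝ) (t : ℝ) : ℝ :=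
  (∫ τ in (0 : ℝ)..t, (f τ - meanOver T f)) -
    meanOver T (fun t' => ∫ τ in (0 : ℝ)..t', (f τ - meanOver T f))

/-- The subharmonic Melnikov function
`M(t₀) = (1/T) ∫₀ᵀ G(ω(A₀) t, A₀, t + t₀) dt`, with `T = 2πq`. -/
noncomputable def PerturbedSystem.melnikov (S : PerturbedSystem) (A₀ : ℝ) (q : ℕ) (t₀ : ℝ) : ℝ :=
  meanOver (2 * Real.pi * q) (fun t => S.G (S.ω A₀ * t) A₀ (t + t₀))

/-- `t₀` is a zero of order `n ≥ 1` of the function `M`. -/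
def IsZeroOfOrder (M : ℝ → ℝ) (t₀ : ℝ) (n : ℕ) : Prop :=
  1 ≤ n ∧ (∀ k < n, iteratedDeriv k M t₀ = 0) ∧ iteratedDeriv n M t₀ ≠ 0

/-! ## The formal solution of the auxiliary system -/

/-- Formal power series in `ε` (outer variable) and `β₀` (inner variable). -/
abbrev Series2 : Type := PowerSeries (PowerSeries ℝ)

namespace Series2

/-- The coefficient of `ε ^ k * β₀ ^ j`. -/
noncomputable def co (k j : ℕ) (u : Series2) : ℝ :=
  PowerSeries.coeff j (PowerSeries.coeff k u)

/-- The series with given coefficients. -/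
noncomputable def ofCoeffs (f : ℕ → ℕ → ℝ) : Series2 :=
  PowerSeries.mk fun k => PowerSeries.mk fun j => f k j

/-- The series `ε`. -/
noncomputable def eps : Series2 := PowerSeries.X

/-- The series `β₀`. -/
noncomputable def beta0 : Series2 := PowerSeries.C PowerSeries.X

/-- `∑_{r,s} g_{r,s} u ^ r v ^ s` for series `u`, `v` without constant term: then
`u ^ r v ^ s` has no term of total degree `k + j < r + s`. -/
noncomputable def compTaylor (g : ℕ → ℕ → ℝ) (u v : Series2) : Series2 :=
  ofCoeffs fun k j => ∑ r ∈ Finset.range (k + j + 1), ∑ s ∈ Finset.range (k + j + 1),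
    g r s * co k j (u ^ r * v ^ s)

/-- The mean over `[0, T]`, coefficient by coefficient, of a series depending on time. -/
noncomputable def mean (T : ℝ) (u : ℝ → Series2) : Series2 :=
  ofCoeffs fun k j => meanOver T (fun t => co k j (u t))

/-- The mean zero primitive, coefficient by coefficient, of a series depending on time. -/
noncomputable def prim (T : ℝ) (u : ℝ → Series2) (t : ℝ) : Series2 :=
  ofCoeffs fun k j => meanZeroPrimitive T (fun t => co k j (u t)) t

/-- Multiplication by a real number. -/
noncomputable def scale (a : ℝ) (u : Series2) : Series2 :=
  ofCoeffs fun k j => a * co k j u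

end Series2

/-- The Taylor coefficient `∂_α ^ r ∂_A ^ s H (α, A, t) / (r! s!)`. -/
noncomputable def taylorCoeff (H : ℝ → ℝ → ℝ → ℝ) (α A t : ℝ) (r s : ℕ) : ℝ :=
  iteratedDeriv r (fun a => iteratedDeriv s (fun A' => H a A' t) A) α /
    ((r.factorial : ℝ) * (s.factorial : ℝ))

namespace PerturbedSystem

/-- `Γ(t) = ε G(ω(A₀)t + β, A₀ + B, t + t₀)` as a formal series, for formal series `β`, `B`. -/
noncomputable def formalGamma (S : PerturbedSystem) (A₀ t₀ : ℝ) (β B : ℝ → Series2) (t : ℝ) :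
    Series2 :=
  Series2.eps * Series2.compTaylor (taylorCoeff S.G (S.ω A₀ * t) A₀ (t + t₀)) (β t) (B t)

/-- `Φ(t) = ε F(ω(A₀)t + β, A₀ + B, t + t₀) + ω(A₀ + B) - ω(A₀) - ω'(A₀) B` as a formal
series. -/
noncomputable def formalPhi (S : PerturbedSystem) (A₀ t₀ : ℝ) (β B : ℝ → Series2) (t : ℝ) :
    Series2 :=
  Series2.eps * Series2.compTaylor (taylorCoeff S.F (S.ω A₀ * t) A₀ (t + t₀)) (β t) (B t) +
    Series2.compTaylor
      (fun r s => if r = 0 ∧ 2 ≤ s then iteratedDeriv s S.ω A₀ / (s.factorial : ℝ) else 0)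
      (β t) (B t)

/-- The right-hand side of the auxiliary system
`β = β₀ + 𝓘 Φ + ω'(A₀) 𝓘 (𝓘 Γ)`, `B = 𝓘 Γ - ⟨Φ⟩ / ω'(A₀)`, where `𝓘` is the mean zero
primitive. In Fourier coefficients (with `ω = 1/q`) this says
`β_ν = Φ_ν / (iων) + ω'(A₀) Γ_ν / (iων)²`, `B_ν = Γ_ν / (iων)` for `ν ≠ 0`, and
`B_0 = -Φ_0 / ω'(A₀)`, while the mean of `β` is the free parameter `β₀`. -/
noncomputable def auxStep (S : PerturbedSystem) (A₀ t₀ : ℝ) (q : ℕ)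
    (u : (ℝ → Series2) × (ℝ → Series2)) : (ℝ → Series2) × (ℝ → Series2) :=
  let T : ℝ := 2 * Real.pi * q
  let Γ := S.formalGamma A₀ t₀ u.1 u.2
  let Φ := S.formalPhi A₀ t₀ u.1 u.2
  (fun t => Series2.beta0 + Series2.prim T Φ t +
      Series2.scale (deriv S.ω A₀) (Series2.prim T (Series2.prim T Γ) t),
    fun t => Series2.prim T Γ t - Series2.scale (deriv S.ω A₀)⁻¹ (Series2.mean T Φ))

/-- Successive approximations, starting from the solution `β = β₀`, `B = 0` for `ε = 0`. -/
noncomputable def auxIter (S : PerturbedSystem) (A₀ t₀ : ℝ) (q : ℕ) :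
    ℕ → (ℝ → Series2) × (ℝ → Series2)
  | 0 => (fun _ => Series2.beta0, fun _ => 0)
  | n + 1 => S.auxStep A₀ t₀ q (auxIter S A₀ t₀ q n)

/-- The angle component `β` of the formal solution of the auxiliary system. On the right-hand
side of that system a coefficient of order `k` in `ε` involves only coefficients of `β`, `B` of
order less than `k`, so the terms of order `k` are final from the `k`-th approximation on. -/
noncomputable def auxBeta (S : PerturbedSystem) (A₀ t₀ : ℝ) (q : ℕ) (t : ℝ) : Series2 :=
  Series2.ofCoeffs fun k j => Series2.co k j ((S.auxIter A₀ t₀ q k).1 t)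

/-- The action component `B` of the formal solution of the auxiliary system. -/
noncomputable def auxB (S : PerturbedSystem) (A₀ t₀ : ℝ) (q : ℕ) (t : ℝ) : Series2 :=
  Series2.ofCoeffs fun k j => Series2.co k j ((S.auxIter A₀ t₀ q k).2 t)

/-- The coefficients `f_{k,j}` of the bifurcation series `𝓕(ε, β₀) = ∑ f_{k,j} ε ^ k β₀ ^ j`
defined by `ε 𝓕(ε, β₀) = ⟨Γ⟩`, where `Γ` is computed along the formal solution of the
auxiliary system. The formal solution solves the full problem when `𝓕(ε, β₀) = 0`. -/
noncomputable def bifCoeff (S : PerturbedSystem) (A₀ t₀ : ℝ) (q : ℕ) (k j : ℕ) : ℝ :=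
  Series2.co (k + 1) j (Series2.mean (2 * Real.pi * q)
    (S.formalGamma A₀ t₀ (S.auxBeta A₀ t₀ q) (S.auxB A₀ t₀ q)))

end PerturbedSystem

/-! ## The Newton-Puiseux process -/

/-- The convex hull of the union of the quadrants `(k, j) + [0, ∞)²` over all `(k, j)` with
`f k j ≠ 0`. The compact part of its boundary is the Newton polygon of `∑ f k j ε ^ k y ^ j`. -/
def newtonRegion (f : ℕ → ℕ → ℝ) : Set (ℝ × ℝ) :=
  convexHull ℝ {x : ℝ × ℝ | ∃ k j : ℕ, f k j ≠ 0 ∧ (k : ℝ) ≤ x.1 ∧ (j : ℝ) ≤ x.2}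

/-- The choices made at one step of the Newton-Puiseux process: a segment of the Newton polygon,
given by its line `p * k + h * j = s`, and a number `c`. -/
structure NPChoice where
  /-- coefficient of `k` -/
  p : ℕ
  /-- coefficient of `j` -/
  h : ℕ
  /-- right-hand side of the equation of the line -/
  s : ℕ
  /-- the chosen root -/
  c : ℝ

namespace NPChoice

/-- The line `p * k + h * j = s`, with `p`, `h` positive and coprime, supports the Newton region
of `f` along a segment (that is, not only in a point). As `p`, `h` are positive, these are exactly
the segments of the Newton polygon; in the usual notation `μ = h / p` and the intercept on the
`k`-axis is `s / p`. -/
def IsSegment (d : NPChoice) (f : ℕ → ℕ → ℝ) : Prop :=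
  0 < d.p ∧ 0 < d.h ∧ Nat.Coprime d.p d.h ∧
    (∀ x ∈ newtonRegion f, (d.s : ℝ) ≤ d.p * x.1 + d.h * x.2) ∧
    {x ∈ newtonRegion f | (d.p : ℝ) * x.1 + d.h * x.2 = d.s}.Nontrivial

/-- The polynomial `P(c) = ∑_{p k + h j = s} σ ^ k f_{k,j} c ^ j` of the segment. -/
noncomputable def poly (d : NPChoice) (σ : ℝ) (f : ℕ → ℕ → ℝ) : Polynomial ℝ :=
  ∑ x ∈ (Finset.range (d.s + 1) ×ˢ Finset.range (d.s + 1)).filter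
      (fun x => d.p * x.1 + d.h * x.2 = d.s),
    Polynomial.C (σ ^ x.1 * f x.1 x.2) * Polynomial.X ^ x.2

/-- The coefficients of the series `f₁` defined by
`f(σ η ^ p, η ^ h (c + y)) = η ^ s f₁(η, y)`: the coefficient of `η ^ m y ^ l` is
`∑_{p k + h j = s + m} σ ^ k f_{k,j} (j choose l) c ^ (j - l)`. -/
noncomputable def next (d : NPChoice) (σ : ℝ) (f : ℕ → ℕ → ℝ) (m l : ℕ) : ℝ :=
  ∑ x ∈ (Finset.range (d.s + m + 1) ×ˢ Finset.range (d.s + m + 1)).filter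
      (fun x => d.p * x.1 + d.h * x.2 = d.s + m),
    σ ^ x.1 * f x.1 x.2 * (x.2.choose l : ℝ) * d.c ^ (x.2 - l)

end NPChoice

/-- The sign enters only at the first step, through `ε = σ |ε|`. -/
def npSign (σ : ℝ) (i : ℕ) : ℝ := if i = 0 then σ else 1

/-- The coefficients of the series `𝓕^(i)(ε_i, y_i)` obtained after `i` steps of the
Newton-Puiseux process with the choices `d`. -/
noncomputable def npSeries (σ : ℝ) (f : ℕ → ℕ → ℝ) (d : ℕ → NPChoice) : ℕ → ℕ → ℕ → ℝ
  | 0 => f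
  | i + 1 => (d i).next (npSign σ i) (npSeries σ f d i)

/-- The polynomial `P^(i)` of the segment chosen at the `i`-th step. -/
noncomputable def npPoly (σ : ℝ) (f : ℕ → ℕ → ℝ) (d : ℕ → NPChoice) (i : ℕ) : Polynomial ℝ :=
  (d i).poly (npSign σ i) (npSeries σ f d i)

/-- The choices `d 0, …, d i₀` are those of a run of the Newton-Puiseux process for `f`, for `ε`
of sign `σ`, and at the step `i₀` the chosen real root is simple. -/
def IsSimpleNPRun (σ : ℝ) (f : ℕ → ℕ → ℝ) (d : ℕ → NPChoice) (i₀ : ℕ) : Prop :=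
  (∀ i ≤ i₀, (d i).IsSegment (npSeries σ f d i) ∧ (npPoly σ f d i).IsRoot (d i).c) ∧
    (npPoly σ f d i₀).rootMultiplicity (d i₀).c = 1

/-- The derivative `P^(i₀)'(c_{i₀})`. -/
noncomputable def npSlope (σ : ℝ) (f : ℕ → ℕ → ℝ) (d : ℕ → NPChoice) (i₀ : ℕ) : ℝ :=
  (npPoly σ f d i₀).derivative.eval (d i₀).c

/-- `p = p^(0) ⋯ p^(i₀)`. -/
def npRamification (d : ℕ → NPChoice) (i₀ : ℕ) : ℕ := ∏ i ∈ Finset.range (i₀ + 1), (d i).p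

/-- The exponent of `|ε| ^ (1/p)` in the term of the Puiseux series with coefficient `c_i`:
`∑_{l ≤ i} h^(l) p^(l+1) ⋯ p^(i₀)`. -/
def npExponent (d : ℕ → NPChoice) (i₀ i : ℕ) : ℕ :=
  ∑ l ∈ Finset.range (i + 1), (d l).h * ∏ m ∈ Finset.Ioc l i₀, (d m).p

/-! ## The recursive construction of the Puiseux series -/

/-- The series `∑ f_{k,j} (σ η ^ P) ^ k b(η) ^ j` in `η`, for `P ≥ 1` and a series `b` without
constant term. -/
noncomputable def substPuiseux (σ : ℝ) (P : ℕ) (f : ℕ → ℕ → ℝ) (b : PowerSeries ℝ) :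
    PowerSeries ℝ :=
  PowerSeries.mk fun m => ∑ k ∈ Finset.range (m + 1), ∑ j ∈ Finset.range (m + 1),
    if P * k ≤ m then σ ^ k * f k j * PowerSeries.coeff (m - P * k) (b ^ j) else 0

/-- Successive approximations of the series `y(η)`, without constant term, solving
`f(η, y(η)) = 0`, where `C = ∂_y f(0, 0)`: the coefficient of order `n + 1` is
`-1/C` times that of `f(η, y_n(η))`, where `y_n` collects the terms of order at most `n`. -/
noncomputable def implicitTrunc (C : ℝ) (f : ℕ → ℕ → ℝ) : ℕ → PowerSeries ℝ
  | 0 => 0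
  | n + 1 => implicitTrunc C f n + PowerSeries.monomial (n + 1)
      (-(1 / C) * PowerSeries.coeff (n + 1) (substPuiseux 1 1 f (implicitTrunc C f n)))

/-- The Puiseux series `β₀(η) = ∑_{i ≤ i₀} c_i η ^ H_i + η ^ H_{i₀} y(η)`, `η = |ε| ^ (1/p)`,
where `y` is determined recursively by `𝓕^(i₀+1)(η, y(η)) = 0`. -/
noncomputable def puiseuxBeta0 (σ : ℝ) (f : ℕ → ℕ → ℝ) (d : ℕ → NPChoice) (i₀ : ℕ) :
    PowerSeries ℝ :=
  ∑ i ∈ Finset.range (i₀ + 1), PowerSeries.monomial (npExponent d i₀ i) (d i).c +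
    PowerSeries.X ^ npExponent d i₀ i₀ * PowerSeries.mk fun n =>
      PowerSeries.coeff n (implicitTrunc (npSlope σ f d i₀) (npSeries σ f d (i₀ + 1)) n)

namespace PerturbedSystem

/-- The coefficient of `η ^ m`, `η = |ε| ^ (1/p)`, in the angle component
`β(t; σ η ^ p, β₀(η))`. -/
noncomputable def solBeta (S : PerturbedSystem) (A₀ t₀ : ℝ) (q : ℕ) (σ : ℝ)
    (d : ℕ → NPChoice) (i₀ : ℕ) (m : ℕ) (t : ℝ) : ℝ :=
  PowerSeries.coeff m (substPuiseux σ (npRamification d i₀)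
    (fun k j => Series2.co k j (S.auxBeta A₀ t₀ q t))
    (puiseuxBeta0 σ (S.bifCoeff A₀ t₀ q) d i₀))

/-- The coefficient of `η ^ m`, `η = |ε| ^ (1/p)`, in the action component
`B(t; σ η ^ p, β₀(η))`. -/
noncomputable def solB (S : PerturbedSystem) (A₀ t₀ : ℝ) (q : ℕ) (σ : ℝ)
    (d : ℕ → NPChoice) (i₀ : ℕ) (m : ℕ) (t : ℝ) : ℝ :=
  PowerSeries.coeff m (substPuiseux σ (npRamification d i₀)
    (fun k j => Series2.co k j (S.auxB A₀ t₀ q t))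
    (puiseuxBeta0 σ (S.bifCoeff A₀ t₀ q) d i₀))

/-- The natural number `N` bounds all the data that enter the value of `ε₀`: the size of the
Taylor coefficients of `ω`, `F`, `G` on the torus `A = A₀`, the distance of `A₀` from the
complement of `W`, `|ω'(A₀)|` from below, `q`, and, for the run `d 0, …, d i₀` of the
Newton-Puiseux process, the number of steps, the integers and roots chosen, and
`|P^(i₀)'(c_{i₀})|` from below. -/
structure DataBound (S : PerturbedSystem) (A₀ t₀ : ℝ) (q : ℕ) (σ : ℝ)
    (d : ℕ → NPChoice) (i₀ : ℕ) (N : ℕ) : Prop where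
  q_le : q ≤ N
  ball_subset : Metric.ball A₀ (1 / (N : ℝ)) ⊆ S.W
  twist : 1 ≤ N * |deriv S.ω A₀|
  taylor_ω : ∀ s : ℕ, |iteratedDeriv s S.ω A₀ / (s.factorial : ℝ)| ≤ (N : ℝ) ^ (s + 1)
  taylor_F : ∀ (α t : ℝ) (r s : ℕ), |taylorCoeff S.F α A₀ t r s| ≤ (N : ℝ) ^ (r + s + 1)
  taylor_G : ∀ (α t : ℝ) (r s : ℕ), |taylorCoeff S.G α A₀ t r s| ≤ (N : ℝ) ^ (r + s + 1)
  steps_le : i₀ ≤ N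
  choices_le : ∀ i ≤ i₀, (d i).p ≤ N ∧ (d i).h ≤ N ∧ (d i).s ≤ N ∧ |(d i).c| ≤ N
  slope : 1 ≤ N * |npSlope σ (S.bifCoeff A₀ t₀ q) d i₀|

end PerturbedSystem

/-! The proof is a Lyapunov–Schmidt reduction followed by the Newton–Puiseux algorithm, with every
estimate made explicit. Writing `α = ω(A₀)t + β`, `A = A₀ + B` and subtracting the mean of `Γ` from
the action equation leaves an auxiliary system. It is solvable in `T`-periodic series for every
value `β₀` of the mean of `β`: the choice of the mean of `B` removes the mean from the angle
equation. The original system is then satisfied wherever `ε𝓕(ε, β₀) = 0`.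

The formal solution is a fixed point of `auxStep` (`auxStep_aux`), because each application of
`auxStep` fixes one more order in `ε`. Its convergence is read off from the weighted norm `wnorm`,
the sum of `sup_t |u_{k,j}(t)| ρ^k δ^j`, which is submultiplicative and is controlled under mean,
primitive and composition. For explicit `ρ`, `δ` the map `auxStep` sends a product of balls into
itself (`wnorm_auxStep_le`). All approximations stay in these balls and their coefficients
stabilise, so the limit satisfies the same bounds and no contraction argument is needed. In
particular the coefficients of `𝓕` grow at most geometrically (`geomBound_bifCoeff`).

Moving `t₀` by `τ` in the Melnikov function is the same as moving the phase by `-ω(A₀)τ`. Hence a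
zero of order `n` of `M` makes `𝓕(0, ·)` a series of order `n` (`hasOrder_bifCoeff`). Along the
Newton–Puiseux process let `ν_i` be the order of `𝓕^(i)(0, ·)`; it drops to the multiplicity of the
chosen root, and `𝔭^(i) · ν_{i+1}!` divides `ν_i!` (`mul_factorial_dvd`). The product of these
relations is `𝔭 ∣ n!`.

After the step with a simple root, `𝓕^(i₀+1)` vanishes at the origin and has slope `C ≠ 0` in `y`,
so the recursion for `y(η)` is that of the implicit function theorem, and a second self-mapping
estimate bounds it (`psNorm_implicitTrunc_le`). Undoing the substitutions turns the zero `y(η)` into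
a zero `β₀(η)` of `𝓕` (`eval2_puiseuxBeta0`). Evaluating the formal solution there gives a true
solution (`isSubharmonicSolution`), and absolute convergence identifies it with the series in `η`
(`hasSum_substPuiseux`). All constants are arithmetic expressions in `N`, which makes `ε₀`
computable. -/

/-! ### Cauchy estimates and Taylor expansions of real analytic functions. -/

section Analysis

open Set Filter Topology

variable {E : Type*} [NormedAddCommGroup E] [NormedSpace ℝ E]

/-- The iterated derivatives of an analytic function satisfy locally uniform Cauchy estimates. -/
theorem AnalyticAt.exists_norm_iteratedFDeriv_le {f : E → ℝ} {x : E} (hf : AnalyticAt ℝ f x) :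
    ∃ C : ℝ, 1 ≤ C ∧ ∀ᶠ y in 𝓝 x, ∀ (n : ℕ) (v : Fin n → E), (∀ i, ‖v i‖ ≤ 1) →
      |iteratedFDeriv ℝ n f y v| ≤ C ^ (n + 1) * n.factorial := by
  obtain ⟨p, R, hp⟩ := hf
  obtain ⟨r, hr0, hrR⟩ := ENNReal.lt_iff_exists_nnreal_btwn.1 hp.r_pos
  have hr0' : 0 < r := by exact_mod_cast hr0
  set ρ : NNReal := r / 2 with hρ
  have hρ0 : 0 < ρ := half_pos hr0'
  have hρr : ρ + ρ = r := add_halves r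
  have hsum : ((ρ : ENNReal) + ρ) < p.radius := by
    rw [← ENNReal.coe_add, hρr]; exact hrR.trans_le hp.r_le
  have hS := p.changeOriginSeries_summable_aux₁ hsum
  set S : NNReal := ∑' s : Σ k l : ℕ, { s : Finset (Fin (k + l)) // s.card = l },
    ‖p (s.1 + s.2.1)‖₊ * ρ ^ s.2.1 * ρ ^ s.1
  -- One convergent sum `S`, taken at radius `ρ + ρ`, dominates the re-expansions at all centres `y`
  -- with `‖y‖ ≤ ρ` simultaneously; this gives the uniformity in the base point.
  have key : ∀ y : E, ‖y‖₊ ≤ ρ → ∀ n, ‖p.changeOrigin y n‖₊ * ρ ^ n ≤ S := by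
    intro y hy n
    have hylt : (‖y‖₊ : ENNReal) < p.radius := by
      refine lt_of_le_of_lt ?_ hsum
      calc (‖y‖₊ : ENNReal) ≤ ρ := by exact_mod_cast hy
        _ ≤ ρ + ρ := le_self_add
    have hρlt : (ρ : ENNReal) < p.radius := lt_of_le_of_lt le_self_add hsum
    have h1 := p.nnnorm_changeOrigin_le n hylt
    have h2 : (∑' s : Σ l : ℕ, { s : Finset (Fin (n + l)) // s.card = l },
        ‖p (n + s.1)‖₊ * ‖y‖₊ ^ s.1) ≤
        ∑' s : Σ l : ℕ, { s : Finset (Fin (n + l)) // s.card = l }, ‖p (n + s.1)‖₊ * ρ ^ s.1 := by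
      refine Summable.tsum_le_tsum (fun s => ?_) (p.changeOriginSeries_summable_aux₂ hylt n)
        (p.changeOriginSeries_summable_aux₂ hρlt n)
      gcongr
    calc ‖p.changeOrigin y n‖₊ * ρ ^ n
        ≤ (∑' s : Σ l : ℕ, { s : Finset (Fin (n + l)) // s.card = l },
            ‖p (n + s.1)‖₊ * ρ ^ s.1) * ρ ^ n := by gcongr; exact h1.trans h2
      _ = ∑' s : Σ l : ℕ, { s : Finset (Fin (n + l)) // s.card = l },
            ‖p (n + s.1)‖₊ * ρ ^ s.1 * ρ ^ n := by rw [NNReal.tsum_mul_right]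
      _ ≤ S := by
        have hS' := NNReal.summable_sigma.1 hS
        have : S = ∑' k, ∑' s : Σ l : ℕ, { s : Finset (Fin (k + l)) // s.card = l },
            ‖p (k + s.1)‖₊ * ρ ^ s.1 * ρ ^ k := by
          exact hS.tsum_sigma' hS'.1
        rw [this]
        exact hS'.2.le_tsum n (fun _ _ => zero_le)
  refine ⟨max 1 (max (S : ℝ) (ρ : ℝ)⁻¹), le_max_left _ _, ?_⟩
  have hnb : Metric.ball x ρ ∈ 𝓝 x := Metric.ball_mem_nhds _ (by exact_mod_cast hρ0)
  filter_upwards [hnb] with z hz n v hv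
  set y := z - x with hy
  have hyρ : ‖y‖₊ ≤ ρ := by
    have : ‖y‖ ≤ ρ := by
      rw [hy, ← dist_eq_norm]; exact (Metric.mem_ball.1 hz).le
    exact_mod_cast this
  have hyR : (‖y‖₊ : ENNReal) < R := by
    refine lt_of_le_of_lt ?_ hrR
    have : ρ ≤ r := by rw [← hρr]; exact le_self_add
    exact_mod_cast hyρ.trans this
  have hch := hp.changeOrigin hyR
  have hxz : x + y = z := by rw [hy]; abel
  rw [hxz] at hch
  rw [hch.iteratedFDeriv_eq_sum_of_completeSpace v]
  set M : ℝ := max 1 (max (S : ℝ) (ρ : ℝ)⁻¹)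
  have hM1 : 1 ≤ M := le_max_left _ _
  have hb : ‖p.changeOrigin y n‖ ≤ M ^ (n + 1) := by
    have h := key y hyρ n
    have h' : ‖p.changeOrigin y n‖ * (ρ : ℝ) ^ n ≤ S := by exact_mod_cast h
    have hρpos : (0 : ℝ) < ρ := by exact_mod_cast hρ0
    have : ‖p.changeOrigin y n‖ ≤ S * ((ρ : ℝ)⁻¹) ^ n := by
      rw [inv_pow, ← div_eq_mul_inv, le_div_iff₀ (pow_pos hρpos n)]; exact h'
    refine this.trans ?_
    rw [pow_succ, mul_comm]
    gcongr
    · exact (le_max_right _ _).trans (le_max_right _ _)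
    · exact (le_max_left _ _).trans (le_max_right _ _)
  -- The `n`-th derivative is the symmetrised `n`-th coefficient of the re-expanded series: the `n!`
  -- permutations account for the factorial.
  calc |∑ σ : Equiv.Perm (Fin n), p.changeOrigin y n fun i => v (σ i)|
      ≤ ∑ σ : Equiv.Perm (Fin n), |p.changeOrigin y n fun i => v (σ i)| :=
        Finset.abs_sum_le_sum_abs _ _
    _ ≤ ∑ σ : Equiv.Perm (Fin n), M ^ (n + 1) := by
        refine Finset.sum_le_sum fun σ _ => ?_
        have := (p.changeOrigin y n).le_opNorm (fun i => v (σ i))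
        rw [Real.norm_eq_abs] at this
        refine this.trans ?_
        calc ‖p.changeOrigin y n‖ * ∏ i, ‖v (σ i)‖ ≤ ‖p.changeOrigin y n‖ * 1 := by
              gcongr
              exact Finset.prod_le_one (fun i _ => norm_nonneg _) (fun i _ => hv _)
          _ ≤ M ^ (n + 1) := by rw [mul_one]; exact hb
    _ = M ^ (n + 1) * n.factorial := by
        simp [Finset.sum_const, Fintype.card_perm, mul_comm]

/-- The derivative in the direction `e`. -/
noncomputable def dirDeriv (e : E) (g : E → ℝ) (x : E) : ℝ := fderiv ℝ g x e

theorem AnalyticOnNhd.dirDeriv {g : E → ℝ} {Ω : Set E} (hg : AnalyticOnNhd ℝ g Ω) (e : E) :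
    AnalyticOnNhd ℝ (dirDeriv e g) Ω := by
  intro x hx
  have h := hg.fderiv x hx
  exact ((ContinuousLinearMap.apply ℝ ℝ e).analyticAt _).comp h

theorem AnalyticOnNhd.iterate_dirDeriv {g : E → ℝ} {Ω : Set E} (hg : AnalyticOnNhd ℝ g Ω) (e : E)
    (r : ℕ) : AnalyticOnNhd ℝ ((_root_.dirDeriv e)^[r] g) Ω := by
  induction r with
  | zero => exact hg
  | succ r ih => rw [Function.iterate_succ_apply']; exact ih.dirDeriv e

/-- Turns the one-variable iterated derivatives in `taylorCoeff` into iterates of `dirDeriv`, which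
stay analytic jointly in all variables. -/
theorem iteratedDeriv_line {g : E → ℝ} {Ω : Set E} (hΩ : IsOpen Ω) (hg : AnalyticOnNhd ℝ g Ω)
    (x e : E) (r : ℕ) : ∀ τ : ℝ, x + τ • e ∈ Ω →
      iteratedDeriv r (fun τ => g (x + τ • e)) τ = ((dirDeriv e)^[r] g) (x + τ • e) := by
  induction r with
  | zero => intro τ _; simp
  | succ r ih =>
    intro τ hτ
    have hcont : Continuous fun τ : ℝ => x + τ • e := by fun_prop
    have hev : iteratedDeriv r (fun τ => g (x + τ • e)) =ᶠ[𝓝 τ]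
        fun τ => ((dirDeriv e)^[r] g) (x + τ • e) := by
      filter_upwards [hcont.continuousAt.preimage_mem_nhds (hΩ.mem_nhds hτ)] with τ' h'
      exact ih τ' h'
    rw [iteratedDeriv_succ, hev.deriv_eq, Function.iterate_succ_apply']
    have h1 := ((hg.iterate_dirDeriv e r) _ hτ).differentiableAt.hasFDerivAt
    have h2 : HasDerivAt (fun τ : ℝ => x + τ • e) e τ := by
      simpa using ((hasDerivAt_id τ).smul_const e).const_add x
    exact (h1.comp_hasDerivAt τ h2).deriv

/-- Each directional derivative adds one slot, filled with `e`, to the multilinear derivative. Since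
`g` may itself already be a derivative of `f`, two applications reach the mixed partial derivatives,
to which the Cauchy estimates then apply. -/
theorem exists_dirDeriv_eq_iteratedFDeriv {f g : E → ℝ} {Ω : Set E} (hΩ : IsOpen Ω)
    (hf : AnalyticOnNhd ℝ f Ω) {n : ℕ} {e : E} (he : ‖e‖ ≤ 1)
    (hg : ∃ v : Fin n → E, (∀ i, ‖v i‖ ≤ 1) ∧ ∀ x ∈ Ω, g x = iteratedFDeriv ℝ n f x v) (r : ℕ) :
    ∃ v : Fin (n + r) → E, (∀ i, ‖v i‖ ≤ 1) ∧
      ∀ x ∈ Ω, ((dirDeriv e)^[r] g) x = iteratedFDeriv ℝ (n + r) f x v := by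
  induction r with
  | zero => exact hg
  | succ r ih =>
    obtain ⟨v, hv, h⟩ := ih
    refine ⟨Fin.cons e v, fun i => ?_, fun x hx => ?_⟩
    · refine Fin.cases ?_ (fun j => ?_) i
      · simpa using he
      · simpa using hv j
    · rw [Function.iterate_succ_apply']
      have hev : ((dirDeriv e)^[r] g) =ᶠ[𝓝 x] fun y => iteratedFDeriv ℝ (n + r) f y v := by
        filter_upwards [hΩ.mem_nhds hx] with y hy using h y hy
      unfold dirDeriv at hev ⊢
      rw [hev.fderiv_eq]
      have h1 : DifferentiableAt ℝ (iteratedFDeriv ℝ (n + r) f) x :=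
        (hf.iteratedFDeriv (n + r) x hx).differentiableAt
      have h2 := (ContinuousMultilinearMap.apply ℝ (fun _ : Fin (n + r) => E) ℝ
        v).hasFDerivAt.comp x h1.hasFDerivAt
      have h3 : (fun y => iteratedFDeriv ℝ (n + r) f y v) =
        (ContinuousMultilinearMap.apply ℝ (fun _ : Fin (n + r) => E) ℝ v) ∘
          iteratedFDeriv ℝ (n + r) f := rfl
      rw [h3, h2.fderiv]
      change _ = iteratedFDeriv ℝ (n + r + 1) f x (Fin.cons e v : Fin (n + r + 1) → E)
      rw [iteratedFDeriv_succ_apply_left]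
      simp

/-- The coefficient bound makes the Taylor series converge on the whole ball of radius `1 / N`. Its
sum agrees with `g` near the centre, and the identity theorem on the connected ball extends the
equality. -/
theorem hasSum_taylor_of_bound {g : ℝ → ℝ} {a N K : ℝ} (hN : 0 < N)
    (hg : AnalyticOnNhd ℝ g (Metric.ball a (1 / N)))
    (hb : ∀ s, |iteratedDeriv s g a / (s.factorial : ℝ)| ≤ K * N ^ s) {x : ℝ} (hx : |x| < 1 / N) :
    HasSum (fun s => iteratedDeriv s g a / (s.factorial : ℝ) * x ^ s) (g (a + x)) := by
  set c : ℕ → ℝ := fun s => iteratedDeriv s g a / (s.factorial : ℝ) with hc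
  set p : FormalMultilinearSeries ℝ ℝ ℝ := FormalMultilinearSeries.ofScalars ℝ c with hp
  have hrad : ENNReal.ofReal (1 / N) ≤ p.radius := by
    have h : (((1 / N).toNNReal : NNReal) : ENNReal) ≤ p.radius := by
      refine p.le_radius_of_bound K fun n => ?_
      have : ‖p n‖ = |c n| := by
        rw [hp, FormalMultilinearSeries.ofScalars_norm, Real.norm_eq_abs]
      rw [this, Real.coe_toNNReal _ (by positivity)]
      calc |c n| * (1 / N) ^ n ≤ K * N ^ n * (1 / N) ^ n := by gcongr; exact hb n
        _ = K := by rw [mul_assoc, ← mul_pow, mul_one_div_cancel hN.ne']; simp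
    exact h
  have hpos : (0 : ENNReal) < p.radius :=
    lt_of_lt_of_le (ENNReal.ofReal_pos.2 (by positivity)) hrad
  have hps := p.hasFPowerSeriesOnBall hpos
  have hmem : ∀ z : ℝ, |z| < 1 / N → z ∈ Metric.eball (0 : ℝ) p.radius := by
    intro z hz
    refine Metric.eball_subset_eball hrad ?_
    rw [Metric.eball_ofReal, Metric.mem_ball, Real.dist_eq, sub_zero]; exact hz
  have hsum0 : ∀ z : ℝ, |z| < 1 / N → HasSum (fun s => c s * z ^ s) (p.sum z) := by
    intro z hz
    have := hps.hasSum (hmem z hz)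
    rw [zero_add] at this
    refine this.congr_fun ?_
    intro s
    rw [hp, FormalMultilinearSeries.ofScalars_apply_eq, smul_eq_mul]
  have han : AnalyticOnNhd ℝ (fun z => p.sum (z - a)) (Metric.ball a (1 / N)) := by
    intro z hz
    have h1 : AnalyticAt ℝ p.sum (z - a) := by
      apply hps.analyticAt_of_mem
      apply hmem
      simpa [Real.dist_eq] using hz
    exact AnalyticAt.comp (g := p.sum) (f := fun z => z - a) h1 (by fun_prop)
  have ha0 : a ∈ Metric.ball a (1 / N) := Metric.mem_ball_self (by positivity)
  have hev : g =ᶠ[𝓝 a] fun z => p.sum (z - a) := by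
    have h2 := (hg a ha0).hasFPowerSeriesAt
    have h2' : HasFPowerSeriesAt g p a := by
      convert h2 using 2
    have h3 : HasFPowerSeriesAt (fun z => p.sum (z - a)) p a := by
      have := hps.hasFPowerSeriesAt.comp_sub a
      simpa using this
    obtain ⟨r1, h1⟩ := h2'
    obtain ⟨r2, h2⟩ := h3
    have hr : 0 < min r1 r2 := lt_min h1.r_pos h2.r_pos
    filter_upwards [Metric.eball_mem_nhds a hr] with z hz
    have e1 := h1.hasSum_sub (Metric.eball_subset_eball (min_le_left _ _) hz)
    have e2 := h2.hasSum_sub (Metric.eball_subset_eball (min_le_right _ _) hz)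
    exact e1.unique e2
  have heq := hg.eqOn_of_preconnected_of_eventuallyEq han
    (convex_ball a (1 / N)).isPreconnected ha0 hev
  have hxa : a + x ∈ Metric.ball a (1 / N) := by simpa [Real.dist_eq] using hx
  rw [heq hxa]
  simpa using hsum0 x hx

end Analysis

/-! ### Taylor coefficients in angle and action: continuity, periodicity, bounds, convergence. -/

section TaylorCoefficients

open Set Filter Topology

variable {W : Set ℝ} {H : ℝ → ℝ → ℝ → ℝ}

/-- The iterated partial derivatives as iterated directional derivatives. -/
theorem iteratedDeriv_action_eq (hW : IsOpen W)
    (hH : AnalyticOnNhd ℝ (fun x : ℝ × ℝ × ℝ => H x.1 x.2.1 x.2.2) (univ ×ˢ W ×ˢ univ))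
    {A : ℝ} (hA : A ∈ W) (α t : ℝ) (s : ℕ) :
    iteratedDeriv s (fun A' => H α A' t) A =
      ((dirDeriv ((0, 1, 0) : ℝ × ℝ × ℝ))^[s] fun x : ℝ × ℝ × ℝ => H x.1 x.2.1 x.2.2)
        (α, A, t) := by
  have hΩ : IsOpen ((univ : Set ℝ) ×ˢ W ×ˢ (univ : Set ℝ)) :=
    isOpen_univ.prod (hW.prod isOpen_univ)
  -- The base point has action `0`, so that the parameter along the line is the action itself.
  have := iteratedDeriv_line hΩ hH (α, 0, t) (0, 1, 0) s A (by simpa using hA)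
  simpa using this

theorem taylorCoeff_eq (hW : IsOpen W)
    (hH : AnalyticOnNhd ℝ (fun x : ℝ × ℝ × ℝ => H x.1 x.2.1 x.2.2) (univ ×ˢ W ×ˢ univ))
    {A : ℝ} (hA : A ∈ W) (α t : ℝ) (r s : ℕ) :
    taylorCoeff H α A t r s =
      ((dirDeriv ((1, 0, 0) : ℝ × ℝ × ℝ))^[r] ((dirDeriv ((0, 1, 0) : ℝ × ℝ × ℝ))^[s]
        fun x : ℝ × ℝ × ℝ => H x.1 x.2.1 x.2.2)) (α, A, t) /
        ((r.factorial : ℝ) * (s.factorial : ℝ)) := by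
  have hΩ : IsOpen ((univ : Set ℝ) ×ˢ W ×ˢ (univ : Set ℝ)) :=
    isOpen_univ.prod (hW.prod isOpen_univ)
  have h1 : (fun a => iteratedDeriv s (fun A' => H a A' t) A) = fun a =>
      ((dirDeriv ((0, 1, 0) : ℝ × ℝ × ℝ))^[s] fun x : ℝ × ℝ × ℝ => H x.1 x.2.1 x.2.2)
        (a, A, t) := by
    funext a; exact iteratedDeriv_action_eq hW hH hA a t s
  have := iteratedDeriv_line hΩ (hH.iterate_dirDeriv (0, 1, 0) s) (0, A, t) (1, 0, 0) r α
    (by simpa using hA)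
  unfold taylorCoeff
  rw [h1]
  congr 1
  simpa using this

theorem continuous_taylorCoeff (hW : IsOpen W)
    (hH : AnalyticOnNhd ℝ (fun x : ℝ × ℝ × ℝ => H x.1 x.2.1 x.2.2) (univ ×ˢ W ×ˢ univ))
    {A : ℝ} (hA : A ∈ W) {a b : ℝ → ℝ} (ha : Continuous a) (hb : Continuous b) (r s : ℕ) :
    Continuous fun t => taylorCoeff H (a t) A (b t) r s := by
  simp_rw [fun t => taylorCoeff_eq hW hH hA (a t) (b t) r s]
  refine Continuous.div_const ?_ _
  have h := ((hH.iterate_dirDeriv ((0, 1, 0) : ℝ × ℝ × ℝ) s).iterate_dirDeriv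
    ((1, 0, 0) : ℝ × ℝ × ℝ) r).continuousOn
  exact h.comp_continuous (f := fun t => (a t, A, b t)) (by fun_prop) (fun t => by simpa using hA)

theorem taylorCoeff_add_period (hW : IsOpen W) {A : ℝ} (hA : A ∈ W) {a b : ℝ}
    (hper : ∀ α t, ∀ A ∈ W, H (α + a) A (t + b) = H α A t) (α t : ℝ) (r s : ℕ) :
    taylorCoeff H (α + a) A (t + b) r s = taylorCoeff H α A t r s := by
  unfold taylorCoeff
  congr 1
  have h1 : ∀ x, iteratedDeriv s (fun A' => H (x + a) A' (t + b)) A =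
      iteratedDeriv s (fun A' => H x A' t) A := by
    intro x
    -- Periodicity is available only for actions in `W`; the derivative in the action depends only
    -- on the germ at `A`, and `W` is open.
    apply Filter.EventuallyEq.iteratedDeriv_eq
    filter_upwards [hW.mem_nhds hA] with A' hA' using hper x t A' hA'
  have h2 := congrFun (iteratedDeriv_comp_add_const r
    (fun x => iteratedDeriv s (fun A' => H x A' (t + b)) A) a) α
  simp only [h1] at h2
  exact h2.symm

/-- Periodicity in each of the two angles. -/
theorem periodic_int_mul (hα : ∀ α t, ∀ A ∈ W, H (α + 2 * Real.pi) A t = H α A t)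
    (ht : ∀ α t, ∀ A ∈ W, H α A (t + 2 * Real.pi) = H α A t) (k l : ℤ) (α t : ℝ) {A : ℝ}
    (hA : A ∈ W) : H (α + 2 * Real.pi * k) A (t + 2 * Real.pi * l) = H α A t := by
  have h1 : Function.Periodic (fun α => H α A (t + 2 * Real.pi * l)) (2 * Real.pi) :=
    fun x => hα x _ A hA
  have h2 : Function.Periodic (fun t => H α A t) (2 * Real.pi) := fun x => ht α x A hA
  have e1 := h1.int_mul k α
  have e2 := h2.int_mul l t
  rw [mul_comm (2 * Real.pi) (k : ℝ), e1, mul_comm (2 * Real.pi) (l : ℝ), e2]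

/-- The local Cauchy estimates are glued over the compact set `[0, 2π] × {A} × [0, 2π]`; periodicity
carries the bound to all angles and times. -/
theorem exists_taylorCoeff_bound (hW : IsOpen W)
    (hH : AnalyticOnNhd ℝ (fun x : ℝ × ℝ × ℝ => H x.1 x.2.1 x.2.2) (univ ×ˢ W ×ˢ univ))
    (hα : ∀ α t, ∀ A ∈ W, H (α + 2 * Real.pi) A t = H α A t)
    (ht : ∀ α t, ∀ A ∈ W, H α A (t + 2 * Real.pi) = H α A t) {A : ℝ} (hA : A ∈ W) :
    ∃ C : ℝ, 1 ≤ C ∧ ∀ α t r s, |taylorCoeff H α A t r s| ≤ C ^ (r + s + 1) := by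
  have hΩ : IsOpen ((univ : Set ℝ) ×ˢ W ×ˢ (univ : Set ℝ)) :=
    isOpen_univ.prod (hW.prod isOpen_univ)
  set f : ℝ × ℝ × ℝ → ℝ := fun x => H x.1 x.2.1 x.2.2
  set Kc : Set (ℝ × ℝ × ℝ) := Icc 0 (2 * Real.pi) ×ˢ {A} ×ˢ Icc 0 (2 * Real.pi) with hK
  have hKc : IsCompact Kc := isCompact_Icc.prod (isCompact_singleton.prod isCompact_Icc)
  obtain ⟨C, hC1, hC⟩ : ∃ C : ℝ, 1 ≤ C ∧ ∀ y ∈ Kc, ∀ (n : ℕ) (v : Fin n → ℝ × ℝ × ℝ),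
      (∀ i, ‖v i‖ ≤ 1) → |iteratedFDeriv ℝ n f y v| ≤ C ^ (n + 1) * n.factorial := by
    refine hKc.induction_on (p := fun S => ∃ C : ℝ, 1 ≤ C ∧ ∀ y ∈ S, ∀ (n : ℕ)
      (v : Fin n → ℝ × ℝ × ℝ), (∀ i, ‖v i‖ ≤ 1) →
      |iteratedFDeriv ℝ n f y v| ≤ C ^ (n + 1) * n.factorial) ?_ ?_ ?_ ?_
    · exact ⟨1, le_rfl, fun y hy => absurd hy (notMem_empty y)⟩
    · rintro S S' hSS' ⟨C, h1, h⟩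
      exact ⟨C, h1, fun y hy => h y (hSS' hy)⟩
    · rintro S S' ⟨C, h1, h⟩ ⟨C', h1', h'⟩
      refine ⟨max C C', h1.trans (le_max_left _ _), ?_⟩
      rintro y (hy | hy) n v hv
      · refine (h y hy n v hv).trans ?_
        gcongr
        exact le_max_left _ _
      · refine (h' y hy n v hv).trans ?_
        gcongr
        exact le_max_right _ _
    · intro y hy
      have hyΩ : y ∈ (univ : Set ℝ) ×ˢ W ×ˢ (univ : Set ℝ) := by
        simp only [hK, mem_prod, mem_singleton_iff] at hy
        simp [hy.2.1, hA]
      obtain ⟨C, h1, h⟩ := (hH y hyΩ).exists_norm_iteratedFDeriv_le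
      exact ⟨_, mem_nhdsWithin_of_mem_nhds h, C, h1, fun z hz => hz⟩
  -- The factor `2` pays for `(r + s)! ≤ 2 ^ (r + s) r! s!`.
  refine ⟨2 * C, by linarith, ?_⟩
  have main : ∀ α ∈ Icc 0 (2 * Real.pi), ∀ t ∈ Icc 0 (2 * Real.pi), ∀ r s,
      |taylorCoeff H α A t r s| ≤ (2 * C) ^ (r + s + 1) := by
    intro α hα' t ht' r s
    rw [taylorCoeff_eq hW hH hA]
    obtain ⟨v, hv, h⟩ := exists_dirDeriv_eq_iteratedFDeriv (n := 0) (f := f) (g := f) hΩ hH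
      (e := (0, 1, 0)) (by simp [Prod.norm_def])
      ⟨Fin.elim0, fun i => i.elim0, fun x _ => by simp⟩ s
    obtain ⟨w, hw, h'⟩ := exists_dirDeriv_eq_iteratedFDeriv hΩ hH (e := (1, 0, 0))
      (by simp [Prod.norm_def]) ⟨v, hv, h⟩ r
    rw [h' (α, A, t) (by simpa using hA)]
    have hb := hC (α, A, t) (by simp [hK, hα'.1, hα'.2, ht'.1, ht'.2]) _ w hw
    have hpos : (0 : ℝ) < (r.factorial : ℝ) * s.factorial := by positivity
    rw [abs_div, abs_of_pos hpos, div_le_iff₀ hpos]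
    refine hb.trans ?_
    have e : 0 + s + r = r + s := by omega
    rw [e]
    have hch : ((r + s).factorial : ℝ) ≤ 2 ^ (r + s) * (r.factorial * s.factorial) := by
      have h1 := Nat.add_choose_mul_factorial_mul_factorial r s
      have h2 : (r + s).choose s ≤ 2 ^ (r + s) := Nat.choose_le_two_pow _ _
      have h3 : (r + s).factorial ≤ 2 ^ (r + s) * (r.factorial * s.factorial) := by
        rw [← h1, mul_assoc]; gcongr
      exact_mod_cast h3
    calc C ^ (r + s + 1) * ((r + s).factorial : ℝ)
        ≤ C ^ (r + s + 1) * (2 ^ (r + s) * (r.factorial * s.factorial)) := by gcongr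
      _ ≤ C ^ (r + s + 1) * (2 ^ (r + s + 1) * (r.factorial * s.factorial)) := by
          exact mul_le_mul_of_nonneg_left (mul_le_mul_of_nonneg_right
            (pow_le_pow_right₀ one_le_two (Nat.le_succ _)) hpos.le) (by positivity)
      _ = (2 * C) ^ (r + s + 1) * (r.factorial * s.factorial) := by rw [mul_pow]; ring
  intro α t r s
  obtain ⟨a, ha, k, hk⟩ : ∃ a ∈ Icc 0 (2 * Real.pi), ∃ k : ℤ, α = a + 2 * Real.pi * k := by
    refine ⟨toIcoMod Real.two_pi_pos 0 α, ?_, toIcoDiv Real.two_pi_pos 0 α, ?_⟩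
    · have := toIcoMod_mem_Ico' Real.two_pi_pos α
      exact ⟨this.1, this.2.le⟩
    · have := toIcoMod_add_toIcoDiv_zsmul Real.two_pi_pos 0 α
      rw [zsmul_eq_mul] at this; linarith
  obtain ⟨b, hb, l, hl⟩ : ∃ b ∈ Icc 0 (2 * Real.pi), ∃ l : ℤ, t = b + 2 * Real.pi * l := by
    refine ⟨toIcoMod Real.two_pi_pos 0 t, ?_, toIcoDiv Real.two_pi_pos 0 t, ?_⟩
    · have := toIcoMod_mem_Ico' Real.two_pi_pos t
      exact ⟨this.1, this.2.le⟩
    · have := toIcoMod_add_toIcoDiv_zsmul Real.two_pi_pos 0 t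
      rw [zsmul_eq_mul] at this; linarith
  rw [hk, hl, taylorCoeff_add_period hW hA
    (fun α t A hA => periodic_int_mul hα ht k l α t hA)]
  exact main a ha b hb r s

/-- The Taylor expansion in angle and action, valid on the full polydisc on which the bounds of
the coefficients give convergence. -/
theorem hasSum_taylorCoeff {N : ℝ} (hN : 0 < N) (hW : IsOpen W)
    (hH : AnalyticOnNhd ℝ (fun x : ℝ × ℝ × ℝ => H x.1 x.2.1 x.2.2) (univ ×ˢ W ×ˢ univ))
    {A : ℝ} (hball : Metric.ball A (1 / N) ⊆ W)
    (hb : ∀ α t r s, |taylorCoeff H α A t r s| ≤ N ^ (r + s + 1))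
    (α t : ℝ) {a b : ℝ} (ha : |a| < 1 / N) (hb' : |b| < 1 / N) :
    HasSum (fun x : ℕ × ℕ => taylorCoeff H α A t x.1 x.2 * a ^ x.1 * b ^ x.2)
      (H (α + a) (A + b) t) := by
  have hA : A ∈ W := hball (Metric.mem_ball_self (by positivity))
  have hΩ : IsOpen ((univ : Set ℝ) ×ˢ W ×ˢ (univ : Set ℝ)) :=
    isOpen_univ.prod (hW.prod isOpen_univ)
  have hs0 : ∀ α s, |iteratedDeriv s (fun A' => H α A' t) A / (s.factorial : ℝ)| ≤ N * N ^ s := by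
    intro α s
    have := hb α t 0 s
    simp only [taylorCoeff, iteratedDeriv_zero, Nat.factorial_zero, Nat.cast_one, one_mul,
      zero_add] at this
    rwa [mul_comm, ← pow_succ]
  -- The expansion in the action is made at the displaced angle `α + a`; its coefficients are then
  -- expanded in `a`. Absolute convergence of the double series makes the order of summation
  -- immaterial.
  have hs1 : HasSum (fun s => iteratedDeriv s (fun A' => H (α + a) A' t) A / (s.factorial : ℝ) *
      b ^ s) (H (α + a) (A + b) t) := by
    refine hasSum_taylor_of_bound (g := fun A' => H (α + a) A' t) hN ?_ (hs0 (α + a)) hb'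
    intro y hy
    exact AnalyticAt.fun_comp (g := fun x : ℝ × ℝ × ℝ => H x.1 x.2.1 x.2.2)
      (f := fun y => (α + a, y, t)) (hH (α + a, y, t) (by simpa using hball hy)) (by fun_prop)
  have hs2 : ∀ s, HasSum (fun r => taylorCoeff H α A t r s * a ^ r)
      (iteratedDeriv s (fun A' => H (α + a) A' t) A / (s.factorial : ℝ)) := by
    intro s
    have han : AnalyticOnNhd ℝ (fun x => iteratedDeriv s (fun A' => H x A' t) A)
        (Metric.ball α (1 / N)) := by
      intro x _
      have h1 : (fun a => iteratedDeriv s (fun A' => H a A' t) A) = fun a =>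
          ((dirDeriv ((0, 1, 0) : ℝ × ℝ × ℝ))^[s] fun x : ℝ × ℝ × ℝ => H x.1 x.2.1 x.2.2)
            (a, A, t) := by
        funext a; exact iteratedDeriv_action_eq hW hH hA a t s
      rw [h1]
      exact AnalyticAt.fun_comp (f := fun a => (a, A, t))
        (hH.iterate_dirDeriv (0, 1, 0) s (x, A, t) (by simpa using hA)) (by fun_prop)
    have hs := hasSum_taylor_of_bound (K := N ^ (s + 1) * s.factorial) hN han (fun r => ?_) ha
    · have := hs.div_const (s.factorial : ℝ)
      refine this.congr_fun ?_
      intro r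
      simp only [taylorCoeff]
      field_simp
    · have := hb α t r s
      simp only [taylorCoeff] at this
      have hsf : (0 : ℝ) < s.factorial := by positivity
      rw [← div_div, abs_div _ (s.factorial : ℝ), abs_of_pos hsf, div_le_iff₀ hsf] at this
      refine this.trans (le_of_eq ?_)
      ring
  have hNa : N * |a| < 1 := by rw [mul_comm]; exact (lt_div_iff₀ hN).1 ha
  have hNb : N * |b| < 1 := by rw [mul_comm]; exact (lt_div_iff₀ hN).1 hb'
  have hsum : Summable fun x : ℕ × ℕ => taylorCoeff H α A t x.1 x.2 * a ^ x.1 * b ^ x.2 := by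
    have g1 := summable_geometric_of_lt_one (by positivity) hNa
    have g2 := summable_geometric_of_lt_one (by positivity) hNb
    have g := (g1.mul_of_nonneg g2 (fun _ => by positivity) (fun _ => by positivity)).mul_left N
    refine Summable.of_norm_bounded g fun x => ?_
    rw [Real.norm_eq_abs, abs_mul, abs_mul, abs_pow, abs_pow]
    calc |taylorCoeff H α A t x.1 x.2| * |a| ^ x.1 * |b| ^ x.2
        ≤ N ^ (x.1 + x.2 + 1) * |a| ^ x.1 * |b| ^ x.2 := by gcongr; exact hb _ _ _ _
      _ = _ := by rw [mul_pow, mul_pow]; ring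
  have hswap : HasSum (fun x : ℕ × ℕ => taylorCoeff H α A t x.2 x.1 * a ^ x.2 * b ^ x.1)
      (∑' x : ℕ × ℕ, taylorCoeff H α A t x.1 x.2 * a ^ x.1 * b ^ x.2) :=
    (Equiv.prodComm ℕ ℕ).hasSum_iff.2 hsum.hasSum
  have h3 := hswap.prod_fiberwise (fun s => (hs2 s).mul_right (b ^ s))
  rw [← h3.unique hs1]
  exact hsum.hasSum

end TaylorCoefficients

/-! ### Sums over bi-indices -/

section Antidiagonal

open scoped ENNReal

/-- With this instance the Cauchy product of series in two variables is a convolution over a single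
index type, so one lemma about weighted sums serves series in `η` and series in `(ε, β₀)` alike. -/
noncomputable instance Nat.prodHasAntidiagonal : Finset.HasAntidiagonal (ℕ × ℕ) where
  antidiagonal x := (Finset.HasAntidiagonal.antidiagonal x.1 ×ˢ Finset.HasAntidiagonal.antidiagonal x.2).map
    (Equiv.prodProdProdComm ℕ ℕ ℕ ℕ).toEmbedding
  mem_antidiagonal := by
    rintro ⟨k, j⟩ ⟨⟨a, b⟩, ⟨c, d⟩⟩
    simp [Prod.ext_iff]

theorem Nat.sum_antidiagonal_prod {M : Type*} [AddCommMonoid M] (x : ℕ × ℕ)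
    (f : (ℕ × ℕ) × (ℕ × ℕ) → M) :
    ∑ p ∈ Finset.HasAntidiagonal.antidiagonal x, f p = ∑ a ∈ Finset.HasAntidiagonal.antidiagonal x.1,
      ∑ b ∈ Finset.HasAntidiagonal.antidiagonal x.2, f ((a.1, b.1), (a.2, b.2)) := by
  rw [← Finset.sum_product']
  exact Finset.sum_map _ _ _

variable {A : Type*} [AddCommMonoid A] [Finset.HasAntidiagonal A]

theorem ENNReal.tsum_sum_antidiagonal (F : A × A → ℝ≥0∞) :
    ∑' n, ∑ p ∈ Finset.HasAntidiagonal.antidiagonal n, F p = ∑' p, F p := by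
  rw [← Finset.HasAntidiagonal.sigmaAntidiagonalEquivProd.tsum_eq F, ENNReal.tsum_sigma']
  refine tsum_congr fun n => ?_
  rw [tsum_fintype, ← Finset.sum_coe_sort]
  rfl

/-- Weighted sums turn convolutions into products. -/
theorem ENNReal.tsum_antidiagonal_mul (U V w : A → ℝ≥0∞) (hw : ∀ x y, w (x + y) = w x * w y) :
    ∑' x, (∑ p ∈ Finset.HasAntidiagonal.antidiagonal x, U p.1 * V p.2) * w x =
      (∑' x, U x * w x) * ∑' x, V x * w x := by
  have h1 : ∀ x, (∑ p ∈ Finset.HasAntidiagonal.antidiagonal x, U p.1 * V p.2) * w x =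
      ∑ p ∈ Finset.HasAntidiagonal.antidiagonal x, (U p.1 * w p.1) * (V p.2 * w p.2) := by
    intro x
    rw [Finset.sum_mul]
    refine Finset.sum_congr rfl fun p hp => ?_
    rw [← Finset.HasAntidiagonal.mem_antidiagonal.1 hp, hw]
    ring
  simp_rw [h1]
  rw [ENNReal.tsum_sum_antidiagonal (fun p : A × A => (U p.1 * w p.1) * (V p.2 * w p.2)),
    ENNReal.tsum_prod', ← ENNReal.tsum_mul_right]
  simp_rw [ENNReal.tsum_mul_left]

theorem Real.tsum_antidiagonal_mul (u v w : A → ℝ) (hw : ∀ x y, w (x + y) = w x * w y)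
    (hu : Summable fun x => ‖u x * w x‖) (hv : Summable fun x => ‖v x * w x‖) :
    ∑' x, (∑ p ∈ Finset.HasAntidiagonal.antidiagonal x, u p.1 * v p.2) * w x =
      (∑' x, u x * w x) * ∑' x, v x * w x := by
  have h1 : ∀ x, (∑ p ∈ Finset.HasAntidiagonal.antidiagonal x, u p.1 * v p.2) * w x =
      ∑ p ∈ Finset.HasAntidiagonal.antidiagonal x, (u p.1 * w p.1) * (v p.2 * w p.2) := by
    intro x
    rw [Finset.sum_mul]
    refine Finset.sum_congr rfl fun p hp => ?_
    rw [← Finset.HasAntidiagonal.mem_antidiagonal.1 hp, hw]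
    ring
  simp_rw [h1]
  exact (hu.of_norm.tsum_mul_tsum_eq_tsum_sum_antidiagonal hv.of_norm
    (summable_mul_of_summable_norm hu hv)).symm

end Antidiagonal

/-! ### Coefficients of formal series in `(ε, β₀)`. -/

namespace Series2

open scoped ENNReal

@[simp] theorem co_ofCoeffs (f : ℕ → ℕ → ℝ) (k j : ℕ) : co k j (ofCoeffs f) = f k j := by
  simp [co, ofCoeffs]

@[ext] theorem ext_co {u v : Series2} (h : ∀ k j, co k j u = co k j v) : u = v := by
  refine PowerSeries.ext fun k => PowerSeries.ext fun j => h k j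

@[simp] theorem co_zero (k j : ℕ) : co k j 0 = 0 := by simp [co]

@[simp] theorem co_add (k j : ℕ) (u v : Series2) : co k j (u + v) = co k j u + co k j v := by
  simp [co]

@[simp] theorem co_sub (k j : ℕ) (u v : Series2) : co k j (u - v) = co k j u - co k j v := by
  simp [co]

theorem co_one (k j : ℕ) : co k j 1 = if k = 0 ∧ j = 0 then 1 else 0 := by
  simp only [co, PowerSeries.coeff_one]
  split_ifs <;> simp_all [PowerSeries.coeff_one]

theorem co_mul (x : ℕ × ℕ) (u v : Series2) : co x.1 x.2 (u * v) =
    ∑ p ∈ Finset.HasAntidiagonal.antidiagonal x, co p.1.1 p.1.2 u * co p.2.1 p.2.2 v := by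
  rw [Nat.sum_antidiagonal_prod]
  simp [co, PowerSeries.coeff_mul]

@[simp] theorem co_eps_mul_zero (j : ℕ) (u : Series2) : co 0 j (eps * u) = 0 := by
  simp [co, eps]

@[simp] theorem co_eps_mul_succ (k j : ℕ) (u : Series2) : co (k + 1) j (eps * u) = co k j u := by
  simp [co, eps, PowerSeries.coeff_succ_X_mul]

theorem co_beta0 (k j : ℕ) : co k j beta0 = if k = 0 ∧ j = 1 then 1 else 0 := by
  simp only [co, beta0, PowerSeries.coeff_C]
  split_ifs <;> simp_all [PowerSeries.coeff_X]

@[simp] theorem co_mean (T : ℝ) (u : ℝ → Series2) (k j : ℕ) :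
    co k j (mean T u) = meanOver T (fun t => co k j (u t)) := co_ofCoeffs _ _ _

@[simp] theorem co_prim (T : ℝ) (u : ℝ → Series2) (t : ℝ) (k j : ℕ) :
    co k j (prim T u t) = meanZeroPrimitive T (fun t => co k j (u t)) t := co_ofCoeffs _ _ _

@[simp] theorem co_scale (a : ℝ) (u : Series2) (k j : ℕ) : co k j (scale a u) = a * co k j u :=
  co_ofCoeffs _ _ _

theorem co_compTaylor (g : ℕ → ℕ → ℝ) (u v : Series2) (k j : ℕ) :
    co k j (compTaylor g u v) = ∑ r ∈ Finset.range (k + j + 1), ∑ s ∈ Finset.range (k + j + 1),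
      g r s * co k j (u ^ r * v ^ s) := co_ofCoeffs _ _ _

/-- All terms of total degree less than `n` vanish. -/
def VanishesBelow (n : ℕ) (u : Series2) : Prop := ∀ k j, k + j < n → co k j u = 0

theorem VanishesBelow.mul {m n : ℕ} {u v : Series2} (hu : VanishesBelow m u)
    (hv : VanishesBelow n v) : VanishesBelow (m + n) (u * v) := by
  intro k j hkj
  rw [co_mul (k, j)]
  refine Finset.sum_eq_zero fun p hp => ?_
  have h := Finset.HasAntidiagonal.mem_antidiagonal.1 hp
  simp only [Prod.ext_iff, Prod.fst_add, Prod.snd_add] at h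
  by_cases h1 : p.1.1 + p.1.2 < m
  · rw [hu _ _ h1, zero_mul]
  · rw [hv _ _ (by omega), mul_zero]

theorem VanishesBelow.pow {u : Series2} (hu : VanishesBelow 1 u) (n : ℕ) :
    VanishesBelow n (u ^ n) := by
  induction n with
  | zero => intro k j h; omega
  | succ n ih => rw [pow_succ]; exact ih.mul hu

theorem vanishesBelow_one {u : Series2} (h : co 0 0 u = 0) : VanishesBelow 1 u := by
  intro k j hkj
  obtain ⟨rfl, rfl⟩ : k = 0 ∧ j = 0 := by omega
  exact h

/-- Shows that the finite truncation in `compTaylor` discards nothing when `u` and `v` have no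
constant term. -/
theorem co_pow_mul_pow_eq_zero {u v : Series2} (hu : co 0 0 u = 0) (hv : co 0 0 v = 0)
    {r s k j : ℕ} (h : k + j < r + s) : co k j (u ^ r * v ^ s) = 0 :=
  ((vanishesBelow_one hu).pow r).mul ((vanishesBelow_one hv).pow s) k j h

/-! ### Weighted sums of suprema of coefficients -/

/-- The supremum over time of a coefficient. -/
noncomputable def supCo (u : ℝ → Series2) (x : ℕ × ℕ) : ℝ≥0∞ := ⨆ t, ‖co x.1 x.2 (u t)‖ₑ

theorem enorm_co_le_supCo (u : ℝ → Series2) (k j : ℕ) (t : ℝ) :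
    ‖co k j (u t)‖ₑ ≤ supCo u (k, j) := le_iSup (fun t => ‖co k j (u t)‖ₑ) t

/-- The weight `ρ ^ k * δ ^ j`. -/
noncomputable def weight (ρ δ : ℝ≥0∞) (x : ℕ × ℕ) : ℝ≥0∞ := ρ ^ x.1 * δ ^ x.2

theorem weight_add (ρ δ : ℝ≥0∞) (x y : ℕ × ℕ) :
    weight ρ δ (x + y) = weight ρ δ x * weight ρ δ y := by
  simp only [weight, Prod.fst_add, Prod.snd_add, pow_add]; ring

/-- The weighted `ℓ¹` norm `∑ sup_t |u_{k,j}(t)| ρ ^ k δ ^ j`. -/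
noncomputable def wnorm (ρ δ : ℝ≥0∞) (u : ℝ → Series2) : ℝ≥0∞ :=
  ∑' x, supCo u x * weight ρ δ x

variable {ρ δ : ℝ≥0∞}

theorem wnorm_le_mul_of_le {u v : ℝ → Series2} {C : ℝ≥0∞}
    (h : ∀ k j t, ‖co k j (u t)‖ₑ ≤ C * supCo v (k, j)) : wnorm ρ δ u ≤ C * wnorm ρ δ v := by
  rw [wnorm, wnorm, ← ENNReal.tsum_mul_left]
  refine ENNReal.tsum_le_tsum fun x => ?_
  rw [← mul_assoc]
  gcongr
  exact iSup_le fun t => h _ _ t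

theorem wnorm_add_le (u v : ℝ → Series2) :
    wnorm ρ δ (fun t => u t + v t) ≤ wnorm ρ δ u + wnorm ρ δ v := by
  rw [wnorm, wnorm, wnorm, ← ENNReal.tsum_add]
  refine ENNReal.tsum_le_tsum fun x => ?_
  rw [← add_mul]
  gcongr
  refine iSup_le fun t => ?_
  rw [co_add]
  exact (enorm_add_le _ _).trans
    (add_le_add (enorm_co_le_supCo u _ _ t) (enorm_co_le_supCo v _ _ t))

theorem wnorm_sub_le (u v : ℝ → Series2) :
    wnorm ρ δ (fun t => u t - v t) ≤ wnorm ρ δ u + wnorm ρ δ v := by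
  rw [wnorm, wnorm, wnorm, ← ENNReal.tsum_add]
  refine ENNReal.tsum_le_tsum fun x => ?_
  rw [← add_mul]
  gcongr
  refine iSup_le fun t => ?_
  rw [co_sub]
  exact (enorm_sub_le).trans
    (add_le_add (enorm_co_le_supCo u _ _ t) (enorm_co_le_supCo v _ _ t))

theorem supCo_mul_le (u v : ℝ → Series2) (x : ℕ × ℕ) :
    supCo (fun t => u t * v t) x ≤ ∑ p ∈ Finset.HasAntidiagonal.antidiagonal x, supCo u p.1 * supCo v p.2 := by
  refine iSup_le fun t => ?_
  rw [co_mul]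
  refine (enorm_sum_le _ _).trans (Finset.sum_le_sum fun p _ => ?_)
  rw [enorm_mul]
  exact mul_le_mul' (enorm_co_le_supCo u _ _ t) (enorm_co_le_supCo v _ _ t)

/-- Rests on the multiplicativity of the weight. As the sums take values in `ℝ≥0∞`, no summability
has to be known in advance. -/
theorem wnorm_mul_le (u v : ℝ → Series2) :
    wnorm ρ δ (fun t => u t * v t) ≤ wnorm ρ δ u * wnorm ρ δ v := by
  rw [wnorm, wnorm, wnorm, ← ENNReal.tsum_antidiagonal_mul _ _ _ (weight_add ρ δ)]
  exact ENNReal.tsum_le_tsum fun x => mul_le_mul' (supCo_mul_le u v x) le_rfl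

theorem wnorm_one_le : wnorm ρ δ (fun _ => 1) ≤ 1 := by
  rw [wnorm, tsum_eq_single (0, 0)]
  · simp [supCo, weight, co_one]
  · rintro ⟨k, j⟩ h
    have : ¬ (k = 0 ∧ j = 0) := by simpa [Prod.ext_iff] using h
    simp [supCo, co_one, this]

theorem wnorm_beta0_le : wnorm ρ δ (fun _ => beta0) ≤ δ := by
  rw [wnorm, tsum_eq_single (0, 1)]
  · simp [supCo, weight, co_beta0]
  · rintro ⟨k, j⟩ h
    have : ¬ (k = 0 ∧ j = 1) := by simpa [Prod.ext_iff] using h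
    simp [supCo, co_beta0, this]

theorem wnorm_pow_le (u : ℝ → Series2) (n : ℕ) :
    wnorm ρ δ (fun t => u t ^ n) ≤ wnorm ρ δ u ^ n := by
  induction n with
  | zero => simpa using wnorm_one_le
  | succ n ih =>
    simp_rw [pow_succ]
    exact (wnorm_mul_le _ _).trans (mul_le_mul' ih le_rfl)

theorem wnorm_pow_mul_pow_le (u v : ℝ → Series2) (r s : ℕ) :
    wnorm ρ δ (fun t => u t ^ r * v t ^ s) ≤ wnorm ρ δ u ^ r * wnorm ρ δ v ^ s :=
  (wnorm_mul_le _ _).trans (mul_le_mul' (wnorm_pow_le _ _) (wnorm_pow_le _ _))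

theorem wnorm_eps_mul_le (u : ℝ → Series2) :
    wnorm ρ δ (fun t => eps * u t) ≤ ρ * wnorm ρ δ u := by
  rw [wnorm, wnorm, ENNReal.tsum_prod', ENNReal.tsum_prod', tsum_eq_zero_add' ENNReal.summable]
  have h0 : ∑' j, supCo (fun t => eps * u t) (0, j) * weight ρ δ (0, j) = 0 := by
    simp [supCo]
  rw [h0, zero_add, ← ENNReal.tsum_mul_left]
  refine ENNReal.tsum_le_tsum fun k => ?_
  rw [← ENNReal.tsum_mul_left]
  refine ENNReal.tsum_le_tsum fun j => ?_
  simp only [supCo, co_eps_mul_succ, weight, pow_succ]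
  exact le_of_eq (by ring)

/-- The method of majorants: time-dependent Taylor coefficients are replaced by their suprema and
the arguments by their norms. -/
theorem wnorm_compTaylor_le (g : ℝ → ℕ → ℕ → ℝ) (u v : ℝ → Series2) :
    wnorm ρ δ (fun t => compTaylor (g t) (u t) (v t)) ≤
      ∑' y : ℕ × ℕ, (⨆ t, ‖g t y.1 y.2‖ₑ) * (wnorm ρ δ u ^ y.1 * wnorm ρ δ v ^ y.2) := by
  have h1 : ∀ x : ℕ × ℕ, supCo (fun t => compTaylor (g t) (u t) (v t)) x ≤
      ∑' y : ℕ × ℕ, (⨆ t, ‖g t y.1 y.2‖ₑ) * supCo (fun t => u t ^ y.1 * v t ^ y.2) x := by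
    intro x
    refine iSup_le fun t => ?_
    rw [co_compTaylor, ← Finset.sum_product']
    refine (enorm_sum_le _ _).trans (le_trans ?_ (ENNReal.sum_le_tsum
      (Finset.range (x.1 + x.2 + 1) ×ˢ Finset.range (x.1 + x.2 + 1))))
    refine Finset.sum_le_sum fun y _ => ?_
    rw [enorm_mul]
    exact mul_le_mul' (le_iSup (fun t => ‖g t y.1 y.2‖ₑ) t)
      (enorm_co_le_supCo (fun t => u t ^ y.1 * v t ^ y.2) _ _ t)
  calc wnorm ρ δ (fun t => compTaylor (g t) (u t) (v t))
      ≤ ∑' x, (∑' y : ℕ × ℕ, (⨆ t, ‖g t y.1 y.2‖ₑ) *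
          supCo (fun t => u t ^ y.1 * v t ^ y.2) x) * weight ρ δ x :=
        ENNReal.tsum_le_tsum fun x => mul_le_mul' (h1 x) le_rfl
    _ = ∑' y : ℕ × ℕ, (⨆ t, ‖g t y.1 y.2‖ₑ) * wnorm ρ δ (fun t => u t ^ y.1 * v t ^ y.2) := by
        simp_rw [← ENNReal.tsum_mul_right]
        rw [ENNReal.tsum_comm]
        refine tsum_congr fun y => ?_
        rw [wnorm, ← ENNReal.tsum_mul_left]
        exact tsum_congr fun x => mul_assoc _ _ _
    _ ≤ _ := ENNReal.tsum_le_tsum fun y => mul_le_mul' le_rfl (wnorm_pow_mul_pow_le _ _ _ _)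

end Series2

/-! ### The mean and the mean zero primitive of a periodic function. -/

section MeanAndPrimitive

open MeasureTheory intervalIntegral

variable {T : ℝ} {f : ℝ → ℝ}

theorem abs_meanOver_le (hT : 0 < T) {M : ℝ} (hM : ∀ t, |f t| ≤ M) : |meanOver T f| ≤ M := by
  have h := norm_integral_le_of_norm_le_const (a := 0) (b := T) (f := f) (C := M)
    (fun t _ => by simpa using hM t)
  rw [Real.norm_eq_abs, sub_zero, abs_of_pos hT] at h
  rw [meanOver, abs_mul, abs_of_pos (inv_pos.2 hT), inv_mul_le_iff₀ hT, mul_comm]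
  exact h

theorem meanOver_const (hT : 0 < T) (c : ℝ) : meanOver T (fun _ => c) = c := by
  simp [meanOver, hT.ne']

theorem hasDerivAt_meanZeroPrimitive (hf : Continuous f) (t : ℝ) :
    HasDerivAt (meanZeroPrimitive T f) (f t - meanOver T f) t := by
  have hc : Continuous fun τ => f τ - meanOver T f := hf.sub continuous_const
  exact (integral_hasDerivAt_right (hc.intervalIntegrable _ _)
    hc.stronglyMeasurable.stronglyMeasurableAtFilter hc.continuousAt).sub_const _

theorem continuous_meanZeroPrimitive (hf : Continuous f) :
    Continuous (meanZeroPrimitive T f) :=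
  continuous_iff_continuousAt.2 fun t => (hasDerivAt_meanZeroPrimitive hf t).continuousAt

theorem meanZeroPrimitive_zero : meanZeroPrimitive T (fun _ => 0) = fun _ => 0 := by
  funext t; simp [meanZeroPrimitive, meanOver]

theorem integral_sub_meanOver (hT : 0 < T) (hf : Continuous f) :
    ∫ τ in (0 : ℝ)..T, (f τ - meanOver T f) = 0 := by
  rw [integral_sub (hf.intervalIntegrable _ _) (by simp),
    intervalIntegral.integral_const, meanOver]
  simp [hT.ne']

/-- The primitive returns to its value after a period exactly because the integrand has mean zero.
-/
theorem periodic_integral_sub_meanOver (hT : 0 < T) (hf : Continuous f)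
    (hp : Function.Periodic f T) :
    Function.Periodic (fun t => ∫ τ in (0 : ℝ)..t, (f τ - meanOver T f)) T := by
  intro t
  have hc : Continuous fun τ => f τ - meanOver T f := hf.sub continuous_const
  have hp' : Function.Periodic (fun τ => f τ - meanOver T f) T := fun x => by
    simp only [hp x]
  have h1 := integral_add_adjacent_intervals (hc.intervalIntegrable (μ := volume) 0 t)
    (hc.intervalIntegrable t (t + T))
  have h2 := hp'.intervalIntegral_add_eq t 0
  rw [zero_add, integral_sub_meanOver hT hf] at h2
  simp only [← h1, h2, add_zero]

theorem periodic_meanZeroPrimitive (hT : 0 < T) (hf : Continuous f)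
    (hp : Function.Periodic f T) : Function.Periodic (meanZeroPrimitive T f) T := by
  intro t
  have := periodic_integral_sub_meanOver hT hf hp t
  simp only at this
  simp only [meanZeroPrimitive, this]

/-- The integrand `f - ⟨f⟩` is at most `2M`, and by periodicity it need be integrated over at most
one period: this gives `2TM`. Normalising the mean to zero costs another `2TM`. -/
theorem abs_meanZeroPrimitive_le (hT : 0 < T) (hf : Continuous f) (hp : Function.Periodic f T)
    {M : ℝ} (hM : ∀ t, |f t| ≤ M) (t : ℝ) : |meanZeroPrimitive T f t| ≤ 4 * T * M := by
  have hm := abs_meanOver_le hT hM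
  have hd : ∀ τ, |f τ - meanOver T f| ≤ 2 * M := fun τ =>
    (abs_sub _ _).trans (by linarith [hM τ])
  have hM0 : 0 ≤ M := (abs_nonneg _).trans hm
  have hI : ∀ t, |∫ τ in (0 : ℝ)..t, (f τ - meanOver T f)| ≤ 2 * T * M := by
    intro t
    obtain ⟨s, hs, hst⟩ := (periodic_integral_sub_meanOver hT hf hp).exists_mem_Ico₀ hT t
    rw [hst]
    have h := norm_integral_le_of_norm_le_const (a := 0) (b := s)
      (f := fun τ => f τ - meanOver T f) (C := 2 * M) (fun t _ => by simpa using hd t)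
    rw [Real.norm_eq_abs, sub_zero, abs_of_nonneg hs.1] at h
    refine h.trans ?_
    have := mul_le_mul_of_nonneg_left hs.2.le (by positivity : 0 ≤ 2 * M)
    linarith
  have h2 := abs_meanOver_le hT hI
  rw [meanZeroPrimitive]
  exact (abs_sub _ _).trans (by linarith [hI t])

end MeanAndPrimitive

/-! ### Periodic families of series; norms of mean and primitive. -/

namespace Series2

open scoped ENNReal

/-- All coefficients are continuous and `T`-periodic functions of time. -/
def Regular (T : ℝ) (u : ℝ → Series2) : Prop :=
  ∀ k j, Continuous (fun t => co k j (u t)) ∧ Function.Periodic (fun t => co k j (u t)) T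

section Regular

variable {T : ℝ} {u v : ℝ → Series2}

theorem Regular.continuous (hu : Regular T u) (k j : ℕ) : Continuous fun t => co k j (u t) :=
  (hu k j).1

theorem Regular.co_add_period (hu : Regular T u) (k j : ℕ) (t : ℝ) :
    co k j (u (t + T)) = co k j (u t) := (hu k j).2 t

theorem regular_const (w : Series2) : Regular T fun _ => w :=
  fun _ _ => ⟨continuous_const, fun _ => rfl⟩

theorem Regular.add (hu : Regular T u) (hv : Regular T v) : Regular T fun t => u t + v t := by
  intro k j
  simp only [co_add]
  exact ⟨(hu k j).1.add (hv k j).1, (hu k j).2.add (hv k j).2⟩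

theorem Regular.sub (hu : Regular T u) (hv : Regular T v) : Regular T fun t => u t - v t := by
  intro k j
  simp only [co_sub]
  exact ⟨(hu k j).1.sub (hv k j).1, (hu k j).2.sub (hv k j).2⟩

theorem Regular.mul (hu : Regular T u) (hv : Regular T v) : Regular T fun t => u t * v t := by
  intro k j
  simp only [co_mul (k, j)]
  refine ⟨continuous_finsetSum _ fun p _ => (hu _ _).1.mul (hv _ _).1, fun t => ?_⟩
  refine Finset.sum_congr rfl fun p _ => ?_
  rw [hu.co_add_period, hv.co_add_period]

theorem Regular.pow (hu : Regular T u) (n : ℕ) : Regular T fun t => u t ^ n := by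
  induction n with
  | zero => simpa using regular_const 1
  | succ n ih => simp_rw [pow_succ]; exact ih.mul hu

theorem Regular.scale (hu : Regular T u) (a : ℝ) : Regular T fun t => scale a (u t) := by
  intro k j
  simp only [co_scale]
  exact ⟨continuous_const.mul (hu k j).1, fun t => by simp only [hu.co_add_period]⟩

theorem Regular.compTaylor {g : ℝ → ℕ → ℕ → ℝ} (hu : Regular T u) (hv : Regular T v)
    (hg : ∀ r s, Continuous (fun t => g t r s) ∧ Function.Periodic (fun t => g t r s) T) :
    Regular T fun t => compTaylor (g t) (u t) (v t) := by
  intro k j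
  simp only [co_compTaylor]
  refine ⟨continuous_finsetSum _ fun r _ => continuous_finsetSum _ fun s _ =>
    (hg r s).1.mul (((hu.pow r).mul (hv.pow s)) k j).1, fun t => ?_⟩
  refine Finset.sum_congr rfl fun r _ => Finset.sum_congr rfl fun s _ => ?_
  have h1 := (hg r s).2 t
  have h2 := ((hu.pow r).mul (hv.pow s)).co_add_period k j t
  simp only at h1
  rw [h1, h2]

theorem Regular.prim (hT : 0 < T) (hu : Regular T u) : Regular T (prim T u) := by
  intro k j
  simp only [co_prim]
  exact ⟨continuous_meanZeroPrimitive (hu k j).1,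
    periodic_meanZeroPrimitive hT (hu k j).1 (hu k j).2⟩

end Regular

variable {T : ℝ} {ρ δ : ℝ≥0∞} {u : ℝ → Series2}

theorem abs_co_le_toReal_supCo {k j : ℕ} (h : supCo u (k, j) ≠ ⊤) (t : ℝ) :
    |co k j (u t)| ≤ (supCo u (k, j)).toReal := by
  have := ENNReal.toReal_mono h (enorm_co_le_supCo u k j t)
  simpa using this

/-- Transfers estimates proved for real bounds `M` to the extended supremum. When the supremum is
infinite, `0 < C` makes the right-hand side infinite as well. -/
theorem enorm_le_mul_supCo {k j : ℕ} {x C : ℝ} (hC : 0 < C)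
    (h : ∀ M, (∀ t, |co k j (u t)| ≤ M) → |x| ≤ C * M) :
    ‖x‖ₑ ≤ ENNReal.ofReal C * supCo u (k, j) := by
  by_cases hs : supCo u (k, j) = ⊤
  · rw [hs, ENNReal.mul_top (by simpa using hC)]; exact le_top
  · have := h _ (abs_co_le_toReal_supCo hs)
    rw [← ENNReal.ofReal_toReal hs, ← ENNReal.ofReal_mul hC.le, ← ofReal_norm]
    exact ENNReal.ofReal_le_ofReal this

theorem wnorm_mean_le (hT : 0 < T) : wnorm ρ δ (fun _ => mean T u) ≤ wnorm ρ δ u := by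
  have := wnorm_le_mul_of_le (ρ := ρ) (δ := δ) (u := fun _ => mean T u) (v := u)
    (C := ENNReal.ofReal 1) (fun k j t => by
      rw [co_mean]
      exact enorm_le_mul_supCo one_pos fun M hM => by
        rw [one_mul]; exact abs_meanOver_le hT hM)
  simpa using this

theorem wnorm_prim_le (hT : 0 < T) (hu : Regular T u) :
    wnorm ρ δ (prim T u) ≤ ENNReal.ofReal (4 * T) * wnorm ρ δ u :=
  wnorm_le_mul_of_le fun k j t => by
    rw [co_prim]
    exact enorm_le_mul_supCo (by positivity) fun M hM =>
      abs_meanZeroPrimitive_le hT (hu k j).1 (hu k j).2 hM t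

theorem wnorm_scale_le (a : ℝ) :
    wnorm ρ δ (fun t => scale a (u t)) ≤ ‖a‖ₑ * wnorm ρ δ u :=
  wnorm_le_mul_of_le fun k j t => by
    rw [co_scale, enorm_mul]
    exact mul_le_mul' le_rfl (enorm_co_le_supCo u k j t)

/-! ### Congruences modulo powers of `ε` -/

/-- The coefficients of order less than `k` in `ε` agree. -/
def CongrBelow (k : ℕ) (u v : Series2) : Prop := ∀ i < k, ∀ j, co i j u = co i j v

/-- As divisibility by `ε ^ k`, the congruence can be handled by ring identities for differences of
powers. -/
theorem congrBelow_iff_dvd {k : ℕ} {u v : Series2} :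
    CongrBelow k u v ↔ (PowerSeries.X : Series2) ^ k ∣ u - v := by
  rw [PowerSeries.X_pow_dvd_iff]
  refine forall_congr' fun i => forall_congr' fun _ => ?_
  rw [map_sub, sub_eq_zero, PowerSeries.ext_iff]
  rfl

theorem CongrBelow.pow_mul_pow {k : ℕ} {u u' v v' : Series2} (hu : CongrBelow k u u')
    (hv : CongrBelow k v v') (r s : ℕ) : CongrBelow k (u ^ r * v ^ s) (u' ^ r * v' ^ s) := by
  rw [congrBelow_iff_dvd] at *
  have : u ^ r * v ^ s - u' ^ r * v' ^ s =
    (u ^ r - u' ^ r) * v ^ s + u' ^ r * (v ^ s - v' ^ s) := by ring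
  rw [this]
  exact dvd_add ((hu.trans (sub_dvd_pow_sub_pow _ _ _)).mul_right _)
    ((hv.trans (sub_dvd_pow_sub_pow _ _ _)).mul_left _)

theorem CongrBelow.compTaylor {k : ℕ} {u u' v v' : Series2} (hu : CongrBelow k u u')
    (hv : CongrBelow k v v') (g : ℕ → ℕ → ℝ) :
    CongrBelow k (compTaylor g u v) (compTaylor g u' v') := by
  intro i hi j
  simp only [co_compTaylor]
  refine Finset.sum_congr rfl fun r _ => Finset.sum_congr rfl fun s _ => ?_
  rw [hu.pow_mul_pow hv r s i hi j]

theorem CongrBelow.eps_mul {k : ℕ} {u v : Series2} (h : CongrBelow k u v) :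
    CongrBelow (k + 1) (eps * u) (eps * v) := by
  intro i hi j
  cases i with
  | zero => simp
  | succ i => simpa using h i (by omega) j

theorem CongrBelow.add {k : ℕ} {u u' v v' : Series2} (hu : CongrBelow k u u')
    (hv : CongrBelow k v v') : CongrBelow k (u + v) (u' + v') := by
  intro i hi j
  rw [co_add, co_add, hu i hi, hv i hi]

/-- Without linear terms, composition gains one order. -/
theorem CongrBelow.compTaylor_of_two_le {k : ℕ} {u u' v v' : Series2}
    (hv : CongrBelow k v v') (h0 : CongrBelow 1 v 0) (h0' : CongrBelow 1 v' 0) (g : ℕ → ℝ) :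
    CongrBelow (k + 1) (Series2.compTaylor (fun r s => if r = 0 ∧ 2 ≤ s then g s else 0) u v)
      (Series2.compTaylor (fun r s => if r = 0 ∧ 2 ≤ s then g s else 0) u' v') := by
  intro i hi j
  simp only [co_compTaylor]
  refine Finset.sum_congr rfl fun r _ => Finset.sum_congr rfl fun s _ => ?_
  split_ifs with h
  · obtain ⟨rfl, hs⟩ := h
    obtain ⟨s, rfl⟩ : ∃ m, s = m + 1 + 1 := ⟨s - 2, by omega⟩
    have : CongrBelow (k + 1) (v ^ (s + 1 + 1)) (v' ^ (s + 1 + 1)) := by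
      rw [congrBelow_iff_dvd] at *
      -- In both summands one factor is divisible by `ε ^ k`, as `v - v'` is, and the other by `ε`,
      -- as `v` and `v'` are.
      have e : v ^ (s + 1 + 1) - v' ^ (s + 1 + 1) =
        (v - v') * v ^ (s + 1) + (v ^ (s + 1) - v' ^ (s + 1)) * v' := by ring
      rw [e, pow_succ]
      rw [pow_one, sub_zero] at h0 h0'
      exact dvd_add (mul_dvd_mul hv (dvd_pow h0 (by omega)))
        (mul_dvd_mul (hv.trans (sub_dvd_pow_sub_pow _ _ _)) h0')
    simp only [pow_zero, one_mul]
    rw [this i hi j]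
  · simp

end Series2

/-! ### The formal solution as a fixed point. -/

namespace PerturbedSystem

open Series2

variable (S : PerturbedSystem) (A₀ t₀ : ℝ) (q : ℕ)

theorem formalGamma_congr {k : ℕ} {β β' B B' : ℝ → Series2}
    (hβ : ∀ t, CongrBelow k (β t) (β' t)) (hB : ∀ t, CongrBelow k (B t) (B' t)) (t : ℝ) :
    CongrBelow (k + 1) (S.formalGamma A₀ t₀ β B t) (S.formalGamma A₀ t₀ β' B' t) :=
  ((hβ t).compTaylor (hB t) _).eps_mul

/-- The gain of one order has two sources: the prefactor `ε` of `F`, and the absence of a linear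
term in the frequency remainder, whose argument `B` is divisible by `ε`. -/
theorem formalPhi_congr {k : ℕ} {β β' B B' : ℝ → Series2}
    (hβ : ∀ t, CongrBelow k (β t) (β' t)) (hB : ∀ t, CongrBelow k (B t) (B' t))
    (h0 : ∀ t, CongrBelow 1 (B t) 0) (h0' : ∀ t, CongrBelow 1 (B' t) 0) (t : ℝ) :
    CongrBelow (k + 1) (S.formalPhi A₀ t₀ β B t) (S.formalPhi A₀ t₀ β' B' t) :=
  ((hβ t).compTaylor (hB t) _).eps_mul.add ((hB t).compTaylor_of_two_le (h0 t) (h0' t) _)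

theorem co_formalGamma_zero (β B : ℝ → Series2) (t : ℝ) (j : ℕ) :
    co 0 j (S.formalGamma A₀ t₀ β B t) = 0 := by simp [formalGamma]

theorem co_formalPhi_zero {β B : ℝ → Series2} (h0 : ∀ t, CongrBelow 1 (B t) 0) (t : ℝ) (j : ℕ) :
    co 0 j (S.formalPhi A₀ t₀ β B t) = 0 := by
  have h := CongrBelow.compTaylor_of_two_le (k := 0) (u := β t) (u' := 0)
    (fun i hi => absurd hi (Nat.not_lt_zero i)) (h0 t) (fun _ _ _ => rfl)
    (fun s => iteratedDeriv s S.ω A₀ / (s.factorial : ℝ)) 0 (by omega) j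
  rw [formalPhi, co_add, co_eps_mul_zero, zero_add, h, co_compTaylor]
  refine Finset.sum_eq_zero fun r _ => Finset.sum_eq_zero fun s _ => ?_
  split_ifs with h
  · have : s ≠ 0 := by omega
    simp [this]
  · simp

theorem auxStep_congr {k : ℕ} {u u' : (ℝ → Series2) × (ℝ → Series2)}
    (hβ : ∀ t, CongrBelow k (u.1 t) (u'.1 t)) (hB : ∀ t, CongrBelow k (u.2 t) (u'.2 t))
    (h0 : ∀ t, CongrBelow 1 (u.2 t) 0) (h0' : ∀ t, CongrBelow 1 (u'.2 t) 0) (t : ℝ) :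
    CongrBelow (k + 1) ((S.auxStep A₀ t₀ q u).1 t) ((S.auxStep A₀ t₀ q u').1 t) ∧
      CongrBelow (k + 1) ((S.auxStep A₀ t₀ q u).2 t) ((S.auxStep A₀ t₀ q u').2 t) := by
  have hΓ := S.formalGamma_congr A₀ t₀ hβ hB
  have hΦ := S.formalPhi_congr A₀ t₀ hβ hB h0 h0'
  constructor
  · intro i hi j
    simp only [auxStep, co_add, co_prim, co_scale, fun t => hΓ t i hi j, fun t => hΦ t i hi j]
  · intro i hi j
    simp only [auxStep, co_sub, co_prim, co_scale, co_mean, fun t => hΓ t i hi j,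
      fun t => hΦ t i hi j]

theorem auxStep_zero {u : (ℝ → Series2) × (ℝ → Series2)} (h0 : ∀ t, CongrBelow 1 (u.2 t) 0)
    (t : ℝ) : CongrBelow 1 ((S.auxStep A₀ t₀ q u).1 t) beta0 ∧
      CongrBelow 1 ((S.auxStep A₀ t₀ q u).2 t) 0 := by
  have hz : ∀ T : ℝ, meanOver T (fun _ => 0) = 0 := fun T => by simp [meanOver]
  constructor
  · intro i hi j
    obtain rfl : i = 0 := by omega
    simp [auxStep, co_formalGamma_zero, S.co_formalPhi_zero A₀ t₀ h0, meanZeroPrimitive_zero]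
  · intro i hi j
    obtain rfl : i = 0 := by omega
    simp [auxStep, co_formalGamma_zero, S.co_formalPhi_zero A₀ t₀ h0, meanZeroPrimitive_zero, hz]

theorem auxIter_snd_zero (n : ℕ) (t : ℝ) : CongrBelow 1 ((S.auxIter A₀ t₀ q n).2 t) 0 := by
  induction n generalizing t with
  | zero => intro i _ j; rfl
  | succ n ih => exact (S.auxStep_zero A₀ t₀ q ih t).2

/-- Each application of `auxStep` improves the agreement by one order, so the coefficients of order
`k` are frozen from the `k`-th approximation on. This justifies the diagonal definition of `auxBeta`
and `auxB`. -/
theorem auxIter_congr_succ (n : ℕ) (t : ℝ) :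
    CongrBelow (n + 1) ((S.auxIter A₀ t₀ q (n + 1)).1 t) ((S.auxIter A₀ t₀ q n).1 t) ∧
      CongrBelow (n + 1) ((S.auxIter A₀ t₀ q (n + 1)).2 t) ((S.auxIter A₀ t₀ q n).2 t) := by
  induction n generalizing t with
  | zero => exact S.auxStep_zero A₀ t₀ q (S.auxIter_snd_zero A₀ t₀ q 0) t
  | succ n ih =>
    exact S.auxStep_congr A₀ t₀ q (fun t => (ih t).1) (fun t => (ih t).2)
      (S.auxIter_snd_zero A₀ t₀ q _) (S.auxIter_snd_zero A₀ t₀ q _) t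

theorem co_auxIter_of_le {k n : ℕ} (h : k ≤ n) (j : ℕ) (t : ℝ) :
    co k j ((S.auxIter A₀ t₀ q n).1 t) = co k j (S.auxBeta A₀ t₀ q t) ∧
      co k j ((S.auxIter A₀ t₀ q n).2 t) = co k j (S.auxB A₀ t₀ q t) := by
  induction n, h using Nat.le_induction with
  | base => simp [auxBeta, auxB]
  | succ n hn ih =>
    have := S.auxIter_congr_succ A₀ t₀ q n t
    rw [this.1 k (by omega) j, this.2 k (by omega) j]
    exact ih

theorem auxBeta_congr (n : ℕ) (t : ℝ) :
    CongrBelow (n + 1) (S.auxBeta A₀ t₀ q t) ((S.auxIter A₀ t₀ q n).1 t) :=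
  fun _ hi j => (S.co_auxIter_of_le A₀ t₀ q (Nat.lt_succ_iff.1 hi) j t).1.symm

theorem auxB_congr (n : ℕ) (t : ℝ) :
    CongrBelow (n + 1) (S.auxB A₀ t₀ q t) ((S.auxIter A₀ t₀ q n).2 t) :=
  fun _ hi j => (S.co_auxIter_of_le A₀ t₀ q (Nat.lt_succ_iff.1 hi) j t).2.symm

theorem auxB_zero (t : ℝ) : CongrBelow 1 (S.auxB A₀ t₀ q t) 0 := by
  intro i hi j
  rw [S.auxB_congr A₀ t₀ q 0 t i (by omega) j]
  exact S.auxIter_snd_zero A₀ t₀ q 0 t i hi j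

/-- The formal solution of the auxiliary system is a fixed point of `auxStep`. -/
theorem auxStep_aux :
    S.auxStep A₀ t₀ q (S.auxBeta A₀ t₀ q, S.auxB A₀ t₀ q) =
      (S.auxBeta A₀ t₀ q, S.auxB A₀ t₀ q) := by
  -- The limit agrees with the `n`-th approximation through order `n`, so its image under `auxStep`
  -- agrees with the next approximation through order `n + 1`. Coefficients of order `k` are read
  -- off with `n = k`.
  have h : ∀ n t, _ := fun n t => S.auxStep_congr A₀ t₀ q (k := n + 1)
    (u := (S.auxBeta A₀ t₀ q, S.auxB A₀ t₀ q)) (u' := S.auxIter A₀ t₀ q n)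
    (S.auxBeta_congr A₀ t₀ q n) (S.auxB_congr A₀ t₀ q n) (S.auxB_zero A₀ t₀ q)
    (S.auxIter_snd_zero A₀ t₀ q n) t
  refine Prod.ext (funext fun t => Series2.ext_co fun k j => ?_)
    (funext fun t => Series2.ext_co fun k j => ?_)
  · rw [(h k t).1 k (by omega) j]
    exact (S.co_auxIter_of_le A₀ t₀ q (Nat.le_succ k) j t).1
  · rw [(h k t).2 k (by omega) j]
    exact (S.co_auxIter_of_le A₀ t₀ q (Nat.le_succ k) j t).2

theorem co_auxBeta_zero_zero (t : ℝ) : co 0 0 (S.auxBeta A₀ t₀ q t) = 0 := by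
  rw [S.auxBeta_congr A₀ t₀ q 0 t 0 (by omega) 0]
  simp [auxIter, co_beta0]

theorem co_auxB_zero_left (j : ℕ) (t : ℝ) : co 0 j (S.auxB A₀ t₀ q t) = 0 := by
  rw [S.auxB_zero A₀ t₀ q t 0 (by omega) j, co_zero]

end PerturbedSystem

/-! ### Quantitative data on the unperturbed torus. -/

namespace PerturbedSystem

open Series2
open scoped ENNReal NNReal

/-- The quantitative part of the hypotheses that concerns the torus `A = A₀`. -/
structure TorusBound (S : PerturbedSystem) (A₀ : ℝ) (p : ℤ) (q N : ℕ) : Prop where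
  q_pos : 0 < q
  freq : S.ω A₀ = (p : ℝ) / (q : ℝ)
  q_le : q ≤ N
  ball_subset : Metric.ball A₀ (1 / (N : ℝ)) ⊆ S.W
  twist : 1 ≤ N * |deriv S.ω A₀|
  taylor_ω : ∀ s : ℕ, |iteratedDeriv s S.ω A₀ / (s.factorial : ℝ)| ≤ (N : ℝ) ^ (s + 1)
  taylor_F : ∀ (α t : ℝ) (r s : ℕ), |taylorCoeff S.F α A₀ t r s| ≤ (N : ℝ) ^ (r + s + 1)
  taylor_G : ∀ (α t : ℝ) (r s : ℕ), |taylorCoeff S.G α A₀ t r s| ≤ (N : ℝ) ^ (r + s + 1)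

namespace TorusBound

variable {S : PerturbedSystem} {A₀ : ℝ} {p : ℤ} {q N : ℕ}

theorem one_le (h : S.TorusBound A₀ p q N) : 1 ≤ N := h.q_pos.trans_le h.q_le

theorem cast_pos (h : S.TorusBound A₀ p q N) : (0 : ℝ) < N := by exact_mod_cast h.one_le

theorem mem_W (h : S.TorusBound A₀ p q N) : A₀ ∈ S.W :=
  h.ball_subset (Metric.mem_ball_self (one_div_pos.2 h.cast_pos))

theorem period_pos (h : S.TorusBound A₀ p q N) : 0 < 2 * Real.pi * (q : ℝ) :=
  mul_pos Real.two_pi_pos (by exact_mod_cast h.q_pos)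

theorem freq_mul_period (h : S.TorusBound A₀ p q N) :
    S.ω A₀ * (2 * Real.pi * q) = 2 * Real.pi * p := by
  have : (q : ℝ) ≠ 0 := by exact_mod_cast h.q_pos.ne'
  rw [h.freq]; field_simp

/-- The norm of the primitive is at most `4T = 8πq`, and `8π < 28`; the constant `28 * N` below
always stands for one integration. -/
theorem four_mul_period_le (h : S.TorusBound A₀ p q N) :
    4 * (2 * Real.pi * (q : ℝ)) ≤ 28 * N := by
  have h1 : (q : ℝ) ≤ N := by exact_mod_cast h.q_le
  have h2 : (0 : ℝ) ≤ q := by positivity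
  nlinarith [Real.pi_lt_d2, Real.pi_pos]

theorem enorm_deriv_le (h : S.TorusBound A₀ p q N) : ‖deriv S.ω A₀‖ₑ ≤ (N : ℝ≥0∞) ^ 2 := by
  have := h.taylor_ω 1
  rw [iteratedDeriv_one, Nat.factorial_one, Nat.cast_one, div_one] at this
  rw [← ofReal_norm]
  refine (ENNReal.ofReal_le_ofReal this).trans ?_
  rw [ENNReal.ofReal_pow (by positivity), ENNReal.ofReal_natCast]

theorem deriv_ne_zero (h : S.TorusBound A₀ p q N) : deriv S.ω A₀ ≠ 0 := by
  intro h0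
  have := h.twist
  rw [h0] at this
  norm_num at this

theorem enorm_inv_deriv_le (h : S.TorusBound A₀ p q N) : ‖(deriv S.ω A₀)⁻¹‖ₑ ≤ (N : ℝ≥0∞) := by
  rw [← ofReal_norm, norm_inv, Real.norm_eq_abs, ← ENNReal.ofReal_natCast]
  refine ENNReal.ofReal_le_ofReal ?_
  rw [inv_le_iff_one_le_mul₀ (abs_pos.2 h.deriv_ne_zero)]
  exact h.twist

end TorusBound

section Regularity

variable {S : PerturbedSystem} {A₀ : ℝ} {p : ℤ} {q N : ℕ} (t₀ : ℝ)

/-- During the time `T = 2πq` the angle advances by `2πp` and the time by `q` full periods, so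
resonance makes the coefficients `T`-periodic along the unperturbed orbit. -/
theorem regular_taylorCoeff (hA : A₀ ∈ S.W) {H : ℝ → ℝ → ℝ → ℝ} {w T : ℝ}
    (hw : w * T = 2 * Real.pi * p) (hT : T = 2 * Real.pi * q)
    (hH : AnalyticOnNhd ℝ (fun x : ℝ × ℝ × ℝ => H x.1 x.2.1 x.2.2)
      (Set.univ ×ˢ S.W ×ˢ Set.univ))
    (hα : ∀ α t, ∀ A ∈ S.W, H (α + 2 * Real.pi) A t = H α A t)
    (ht : ∀ α t, ∀ A ∈ S.W, H α A (t + 2 * Real.pi) = H α A t) (r s : ℕ) :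
    Continuous (fun t => taylorCoeff H (w * t) A₀ (t + t₀) r s) ∧
      Function.Periodic (fun t => taylorCoeff H (w * t) A₀ (t + t₀) r s) T := by
  refine ⟨continuous_taylorCoeff S.isOpen_W hH hA (by fun_prop) (by fun_prop) r s, fun t => ?_⟩
  have h1 : w * (t + T) = w * t + 2 * Real.pi * p := by rw [mul_add, hw]
  have h2 : t + T + t₀ = t + t₀ + 2 * Real.pi * ((q : ℤ) : ℝ) := by rw [hT]; push_cast; ring
  simp only [h1, h2]
  exact taylorCoeff_add_period S.isOpen_W hA
    (fun α t A hA => periodic_int_mul hα ht p q α t hA) _ _ r s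

theorem TorusBound.regular_formalGamma (h : S.TorusBound A₀ p q N) {β B : ℝ → Series2}
    (hβ : Regular (2 * Real.pi * q) β) (hB : Regular (2 * Real.pi * q) B) :
    Regular (2 * Real.pi * q) (S.formalGamma A₀ t₀ β B) :=
  (regular_const _).mul (hβ.compTaylor hB (regular_taylorCoeff t₀ h.mem_W
    h.freq_mul_period rfl S.analytic_G S.periodic_G_α S.periodic_G_t))

theorem TorusBound.regular_formalPhi (h : S.TorusBound A₀ p q N) {β B : ℝ → Series2}
    (hβ : Regular (2 * Real.pi * q) β) (hB : Regular (2 * Real.pi * q) B) :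
    Regular (2 * Real.pi * q) (S.formalPhi A₀ t₀ β B) :=
  ((regular_const _).mul (hβ.compTaylor hB (regular_taylorCoeff t₀ h.mem_W
    h.freq_mul_period rfl S.analytic_F S.periodic_F_α S.periodic_F_t))).add
    (hβ.compTaylor hB fun _ _ => ⟨continuous_const, fun _ => rfl⟩)

theorem TorusBound.regular_auxStep (h : S.TorusBound A₀ p q N)
    {u : (ℝ → Series2) × (ℝ → Series2)}
    (hβ : Regular (2 * Real.pi * q) u.1) (hB : Regular (2 * Real.pi * q) u.2) :
    Regular (2 * Real.pi * q) (S.auxStep A₀ t₀ q u).1 ∧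
      Regular (2 * Real.pi * q) (S.auxStep A₀ t₀ q u).2 := by
  have hΓ := h.regular_formalGamma t₀ hβ hB
  have hΦ := h.regular_formalPhi t₀ hβ hB
  exact ⟨((regular_const _).add (hΦ.prim h.period_pos)).add
      (((hΓ.prim h.period_pos).prim h.period_pos).scale _),
    (hΓ.prim h.period_pos).sub (regular_const _)⟩

theorem TorusBound.regular_auxIter (h : S.TorusBound A₀ p q N) (n : ℕ) :
    Regular (2 * Real.pi * q) (S.auxIter A₀ t₀ q n).1 ∧
      Regular (2 * Real.pi * q) (S.auxIter A₀ t₀ q n).2 := by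
  induction n with
  | zero => exact ⟨regular_const _, regular_const _⟩
  | succ n ih => exact h.regular_auxStep t₀ ih.1 ih.2

theorem TorusBound.regular_auxBeta (h : S.TorusBound A₀ p q N) :
    Regular (2 * Real.pi * q) (S.auxBeta A₀ t₀ q) := fun k j => by
  simpa [auxBeta] using (h.regular_auxIter t₀ k).1 k j

theorem TorusBound.regular_auxB (h : S.TorusBound A₀ p q N) :
    Regular (2 * Real.pi * q) (S.auxB A₀ t₀ q) := fun k j => by
  simpa [auxB] using (h.regular_auxIter t₀ k).2 k j

end Regularity

/-! ### An invariant ball and the convergence of the formal solution. -/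

section Norms

theorem tsum_two_inv_pow_prod (c : ℝ≥0∞) :
    ∑' y : ℕ × ℕ, c * (2⁻¹ ^ y.1 * 2⁻¹ ^ y.2) = 4 * c := by
  have h2 : ∑' n : ℕ, (2⁻¹ : ℝ≥0∞) ^ n = 2 := by
    rw [ENNReal.tsum_geometric, ENNReal.one_sub_inv_two, inv_inv]
  rw [ENNReal.tsum_mul_left, ENNReal.tsum_prod']
  simp_rw [ENNReal.tsum_mul_left, ENNReal.tsum_mul_right]
  rw [h2, mul_comm]
  congr 1
  norm_num

variable {N : ℕ} {ρ δ : ℝ≥0∞} {u v : ℝ → Series2}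

theorem enorm_le_natCast_pow {x : ℝ} {m : ℕ} (h : |x| ≤ (N : ℝ) ^ m) :
    ‖x‖ₑ ≤ (N : ℝ≥0∞) ^ m := by
  rw [← ofReal_norm]
  refine (ENNReal.ofReal_le_ofReal h).trans ?_
  rw [ENNReal.ofReal_pow (by positivity), ENNReal.ofReal_natCast]

/-- Arguments of norm at most half the radius `1 / N` turn the majorant into `N` times a double
geometric series of ratio `1/2`, whose sum is `4`. -/
theorem wnorm_compTaylor_le_four_mul (g : ℝ → ℕ → ℕ → ℝ)
    (hg : ∀ t r s, |g t r s| ≤ (N : ℝ) ^ (r + s + 1))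
    (hu : N * wnorm ρ δ u ≤ 2⁻¹) (hv : N * wnorm ρ δ v ≤ 2⁻¹) :
    wnorm ρ δ (fun t => compTaylor (g t) (u t) (v t)) ≤ 4 * N := by
  refine (wnorm_compTaylor_le g u v).trans ?_
  rw [← tsum_two_inv_pow_prod]
  refine ENNReal.tsum_le_tsum fun y => ?_
  calc (⨆ t, ‖g t y.1 y.2‖ₑ) * (wnorm ρ δ u ^ y.1 * wnorm ρ δ v ^ y.2)
      ≤ (N : ℝ≥0∞) ^ (y.1 + y.2 + 1) * (wnorm ρ δ u ^ y.1 * wnorm ρ δ v ^ y.2) :=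
        mul_le_mul' (iSup_le fun t => enorm_le_natCast_pow (hg t _ _)) le_rfl
    _ = N * ((N * wnorm ρ δ u) ^ y.1 * (N * wnorm ρ δ v) ^ y.2) := by
        rw [mul_pow, mul_pow]; ring
    _ ≤ _ := by gcongr

theorem wnorm_compTaylor_two_le (g : ℕ → ℝ) (hg : ∀ s, |g s| ≤ (N : ℝ) ^ (s + 1))
    (hv : N * wnorm ρ δ v ≤ 2⁻¹) :
    wnorm ρ δ (fun t => compTaylor (fun r s => if r = 0 ∧ 2 ≤ s then g s else 0) (u t) (v t)) ≤
      16 * (N ^ 3 * wnorm ρ δ v ^ 2) := by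
  refine (wnorm_compTaylor_le (fun _ r s => if r = 0 ∧ 2 ≤ s then g s else 0) u v).trans ?_
  have e : (16 : ℝ≥0∞) * (N ^ 3 * wnorm ρ δ v ^ 2) = 4 * (4 * (N ^ 3 * wnorm ρ δ v ^ 2)) := by
    ring
  rw [e, ← tsum_two_inv_pow_prod]
  refine ENNReal.tsum_le_tsum fun y => ?_
  rw [ciSup_const]
  split_ifs with hy
  · obtain ⟨h1, h2⟩ := hy
    obtain ⟨s, hs⟩ : ∃ s, y.2 = s + 2 := ⟨y.2 - 2, by omega⟩
    rw [h1, hs, pow_zero, pow_zero, one_mul, one_mul]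
    -- Splitting off the square of the norm uses up two powers of `1/2`. The factor `4` restores
    -- them, so that the same geometric series can be used; hence `16 = 4 * 4`.
    have h4 : (4 : ℝ≥0∞) * (2⁻¹ ^ 2) = 1 := by
      rw [← ENNReal.inv_pow]
      have : (2 : ℝ≥0∞) ^ 2 = 4 := by norm_num
      rw [this]
      exact ENNReal.mul_inv_cancel (by norm_num) (by norm_num)
    calc ‖g (s + 2)‖ₑ * wnorm ρ δ v ^ (s + 2)
        ≤ (N : ℝ≥0∞) ^ (s + 2 + 1) * wnorm ρ δ v ^ (s + 2) :=
          mul_le_mul' (enorm_le_natCast_pow (hg _)) le_rfl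
      _ = N ^ 3 * wnorm ρ δ v ^ 2 * (N * wnorm ρ δ v) ^ s := by rw [mul_pow]; ring
      _ ≤ N ^ 3 * wnorm ρ δ v ^ 2 * 2⁻¹ ^ s := by gcongr
      _ = (4 * 2⁻¹ ^ 2) * (N ^ 3 * wnorm ρ δ v ^ 2 * 2⁻¹ ^ s) := by rw [h4, one_mul]
      _ = 4 * (N ^ 3 * wnorm ρ δ v ^ 2) * 2⁻¹ ^ (s + 2) := by ring
  · simp

variable {S : PerturbedSystem} {A₀ : ℝ} {p : ℤ} {q : ℕ} (t₀ : ℝ)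

theorem TorusBound.wnorm_formalGamma_le (h : S.TorusBound A₀ p q N)
    (hu : N * wnorm ρ δ u ≤ 2⁻¹) (hv : N * wnorm ρ δ v ≤ 2⁻¹) :
    wnorm ρ δ (S.formalGamma A₀ t₀ u v) ≤ ρ * (4 * N) :=
  (wnorm_eps_mul_le _).trans (mul_le_mul' le_rfl (wnorm_compTaylor_le_four_mul
    (fun t => taylorCoeff S.G (S.ω A₀ * t) A₀ (t + t₀)) (fun _ _ _ => h.taylor_G _ _ _ _) hu hv))

theorem TorusBound.wnorm_formalPhi_le (h : S.TorusBound A₀ p q N)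
    (hu : N * wnorm ρ δ u ≤ 2⁻¹) (hv : N * wnorm ρ δ v ≤ 2⁻¹) :
    wnorm ρ δ (S.formalPhi A₀ t₀ u v) ≤ ρ * (4 * N) + 16 * (N ^ 3 * wnorm ρ δ v ^ 2) :=
  (wnorm_add_le _ _).trans (add_le_add ((wnorm_eps_mul_le _).trans (mul_le_mul' le_rfl
    (wnorm_compTaylor_le_four_mul (fun t => taylorCoeff S.F (S.ω A₀ * t) A₀ (t + t₀))
      (fun _ _ _ => h.taylor_F _ _ _ _) hu hv)))
    (wnorm_compTaylor_two_le (fun s => iteratedDeriv s S.ω A₀ / (s.factorial : ℝ)) h.taylor_ω hv))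

/-- The radius of convergence in `ε` of the formal solution. -/
noncomputable def epsRadius (N : ℕ) : ℝ≥0 := (10 ^ 6 * (N : ℝ≥0) ^ 7)⁻¹

/-- The radius of convergence in `β₀` of the formal solution. -/
noncomputable def betaRadius (N : ℕ) : ℝ≥0 := (4 * (N : ℝ≥0))⁻¹

/-- The bound of the norm of the action component. -/
noncomputable def actionBound (N : ℕ) : ℝ≥0 := (1000 * (N : ℝ≥0) ^ 5)⁻¹

/-- The bound of the norm of the angle component. -/
noncomputable def angleBound (N : ℕ) : ℝ≥0 := (2 * (N : ℝ≥0))⁻¹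

/-- The terms bound `β₀`, one integral of `Φ`, and `ω'` times a double integral of `Γ`. In `m = 1/N`
the claim is `m/4 + (112 m⁵ + 448 m⁶ + 3136 m²)/10⁶ ≤ m/2`. -/
theorem angle_majorant_le (hN : 1 ≤ N) :
    betaRadius N + 28 * N * (epsRadius N * (4 * N) + 16 * (N ^ 3 * actionBound N ^ 2)) +
      N ^ 2 * (28 * N * (28 * N * (epsRadius N * (4 * N)))) ≤ angleBound N := by
  rw [← NNReal.coe_le_coe]
  simp only [betaRadius, epsRadius, actionBound, angleBound]
  push_cast
  have hn : (1 : ℝ) ≤ N := by exact_mod_cast hN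
  have hn0 : (N : ℝ) ≠ 0 := by positivity
  set m : ℝ := (N : ℝ)⁻¹ with hm
  have hm1 : m ≤ 1 := inv_le_one_of_one_le₀ hn
  have hm0 : 0 ≤ m := by positivity
  have e : (4 * (N : ℝ))⁻¹ + 28 * N * ((10 ^ 6 * (N : ℝ) ^ 7)⁻¹ * (4 * N) +
      16 * (N ^ 3 * ((1000 * (N : ℝ) ^ 5)⁻¹) ^ 2)) +
      N ^ 2 * (28 * N * (28 * N * ((10 ^ 6 * (N : ℝ) ^ 7)⁻¹ * (4 * N)))) =
      m / 4 + (112 * m ^ 5 + 448 * m ^ 6 + 3136 * m ^ 2) / 10 ^ 6 := by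
    rw [hm]; field_simp; ring
  have e2 : (2 * (N : ℝ))⁻¹ = m / 2 := by rw [hm]; field_simp
  rw [e, e2]
  have p5 : m ^ 5 ≤ m := pow_le_of_le_one hm0 hm1 (by norm_num)
  have p6 : m ^ 6 ≤ m := pow_le_of_le_one hm0 hm1 (by norm_num)
  have p2 : m ^ 2 ≤ m := pow_le_of_le_one hm0 hm1 (by norm_num)
  linarith

/-- The terms bound one integral of `Γ` and `⟨Φ⟩ / ω'`. In `m = 1/N` the claim is `(116 m⁵ + 16
m⁶)/10⁶ ≤ m⁵/1000`; the action bound enters the left-hand side only squared. -/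
theorem action_majorant_le (hN : 1 ≤ N) :
    28 * N * (epsRadius N * (4 * N)) +
      N * (epsRadius N * (4 * N) + 16 * (N ^ 3 * actionBound N ^ 2)) ≤ actionBound N := by
  rw [← NNReal.coe_le_coe]
  simp only [epsRadius, actionBound]
  push_cast
  have hn : (1 : ℝ) ≤ N := by exact_mod_cast hN
  have hn0 : (N : ℝ) ≠ 0 := by positivity
  set m : ℝ := (N : ℝ)⁻¹ with hm
  have hm1 : m ≤ 1 := inv_le_one_of_one_le₀ hn
  have hm0 : 0 ≤ m := by positivity
  have e : 28 * N * ((10 ^ 6 * (N : ℝ) ^ 7)⁻¹ * (4 * N)) +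
      N * ((10 ^ 6 * (N : ℝ) ^ 7)⁻¹ * (4 * N) +
      16 * (N ^ 3 * ((1000 * (N : ℝ) ^ 5)⁻¹) ^ 2)) = (116 * m ^ 5 + 16 * m ^ 6) / 10 ^ 6 := by
    rw [hm]; field_simp; ring
  have e2 : (1000 * (N : ℝ) ^ 5)⁻¹ = m ^ 5 / 1000 := by rw [hm]; field_simp
  rw [e, e2]
  have p6 : m ^ 6 ≤ m ^ 5 := pow_le_pow_of_le_one hm0 hm1 (by norm_num)
  have p5 : 0 ≤ m ^ 5 := by positivity
  linarith

theorem natCast_mul_le_two_inv {x : ℝ≥0∞} (hN : 1 ≤ N) (h : x ≤ angleBound N) :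
    N * x ≤ 2⁻¹ := by
  have hn : (N : ℝ≥0) ≠ 0 := by exact_mod_cast (by omega : N ≠ 0)
  calc (N : ℝ≥0∞) * x ≤ ((N : ℝ≥0) : ℝ≥0∞) * angleBound N := by gcongr; simp
    _ = (((N : ℝ≥0) * angleBound N : ℝ≥0) : ℝ≥0∞) := by push_cast; rfl
    _ = ((2⁻¹ : ℝ≥0) : ℝ≥0∞) := by
        congr 1; rw [angleBound, mul_inv]; field_simp
    _ = 2⁻¹ := by rw [ENNReal.coe_inv (by norm_num)]; norm_num

theorem actionBound_le_angleBound (hN : 1 ≤ N) : actionBound N ≤ angleBound N := by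
  have hn : (1 : ℝ≥0) ≤ N := by exact_mod_cast hN
  rw [actionBound, angleBound]
  have h5 : (N : ℝ≥0) ≤ N ^ 5 := le_self_pow₀ hn (by norm_num)
  gcongr
  norm_num

theorem TorusBound.wnorm_auxStep_le (h : S.TorusBound A₀ p q N)
    {u : (ℝ → Series2) × (ℝ → Series2)}
    (h1 : Regular (2 * Real.pi * q) u.1) (h2 : Regular (2 * Real.pi * q) u.2)
    (hu : wnorm (epsRadius N) (betaRadius N) u.1 ≤ angleBound N)
    (hv : wnorm (epsRadius N) (betaRadius N) u.2 ≤ actionBound N) :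
    wnorm (epsRadius N) (betaRadius N) (S.auxStep A₀ t₀ q u).1 ≤ angleBound N ∧
      wnorm (epsRadius N) (betaRadius N) (S.auxStep A₀ t₀ q u).2 ≤ actionBound N := by
  have hu' := natCast_mul_le_two_inv h.one_le hu
  have hv' := natCast_mul_le_two_inv h.one_le
    (hv.trans (ENNReal.coe_le_coe.2 (actionBound_le_angleBound h.one_le)))
  have hΓr := h.regular_formalGamma t₀ h1 h2
  have hΦr := h.regular_formalPhi t₀ h1 h2
  have hΓ := h.wnorm_formalGamma_le t₀ hu' hv'
  have hΦ : wnorm (epsRadius N) (betaRadius N) (S.formalPhi A₀ t₀ u.1 u.2) ≤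
      epsRadius N * (4 * N) + 16 * (N ^ 3 * (actionBound N : ℝ≥0∞) ^ 2) :=
    (h.wnorm_formalPhi_le t₀ hu' hv').trans (by gcongr)
  have hT : ENNReal.ofReal (4 * (2 * Real.pi * q)) ≤ 28 * N := by
    refine (ENNReal.ofReal_le_ofReal h.four_mul_period_le).trans ?_
    rw [ENNReal.ofReal_mul (by norm_num), ENNReal.ofReal_natCast, ENNReal.ofReal_ofNat]
  have pΓ := (wnorm_prim_le h.period_pos hΓr).trans (mul_le_mul' hT hΓ)
  have pΦ := (wnorm_prim_le h.period_pos hΦr).trans (mul_le_mul' hT hΦ)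
  have ppΓ := (wnorm_prim_le h.period_pos (hΓr.prim h.period_pos)).trans (mul_le_mul' hT pΓ)
  constructor
  · refine (wnorm_add_le _ _).trans ((add_le_add ((wnorm_add_le _ _).trans (add_le_add
      wnorm_beta0_le pΦ)) ((wnorm_scale_le _).trans (mul_le_mul' h.enorm_deriv_le ppΓ))).trans ?_)
    exact_mod_cast angle_majorant_le h.one_le
  · refine (wnorm_sub_le _ _).trans ((add_le_add pΓ ((wnorm_scale_le _).trans
      (mul_le_mul' h.enorm_inv_deriv_le ((wnorm_mean_le h.period_pos).trans hΦ)))).trans ?_)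
    exact_mod_cast action_majorant_le h.one_le

theorem TorusBound.wnorm_auxIter_le (h : S.TorusBound A₀ p q N) (n : ℕ) :
    wnorm (epsRadius N) (betaRadius N) (S.auxIter A₀ t₀ q n).1 ≤ angleBound N ∧
      wnorm (epsRadius N) (betaRadius N) (S.auxIter A₀ t₀ q n).2 ≤ actionBound N := by
  induction n with
  | zero =>
    refine ⟨wnorm_beta0_le.trans ?_, ?_⟩
    · have : betaRadius N ≤ angleBound N := le_trans
        (by rw [add_assoc]; exact le_self_add) (angle_majorant_le h.one_le)
      exact_mod_cast this
    · simp [auxIter, wnorm, supCo]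
  | succ n ih =>
    have hr := h.regular_auxIter t₀ n
    exact h.wnorm_auxStep_le t₀ hr.1 hr.2 ih.1 ih.2

/-- Partial sums over the orders `k < n` in `ε` coincide with those of the `n`-th approximation. A
uniform bound of the approximations therefore passes to the limit without any estimate of their
differences. -/
theorem wnorm_le_of_eventually_eq {w : ℝ → Series2} {W : ℕ → ℝ → Series2} {C : ℝ≥0∞}
    (hW : ∀ n, wnorm ρ δ (W n) ≤ C)
    (h : ∀ n k j t, k ≤ n → co k j (W n t) = co k j (w t)) : wnorm ρ δ w ≤ C := by
  rw [wnorm, ENNReal.tsum_prod']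
  refine ENNReal.tsum_le_of_sum_range_le fun n => ?_
  refine le_trans ?_ (hW n)
  rw [wnorm, ENNReal.tsum_prod']
  refine le_trans (Finset.sum_le_sum fun k hk => ?_) (ENNReal.sum_le_tsum (Finset.range n))
  refine ENNReal.tsum_le_tsum fun j => ?_
  simp only [supCo, h n k j _ (Finset.mem_range.1 hk).le]
  exact le_rfl

theorem TorusBound.wnorm_auxBeta_le (h : S.TorusBound A₀ p q N) :
    wnorm (epsRadius N) (betaRadius N) (S.auxBeta A₀ t₀ q) ≤ angleBound N :=
  wnorm_le_of_eventually_eq (fun n => (h.wnorm_auxIter_le t₀ n).1)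
    fun _ _ j t hk => (S.co_auxIter_of_le A₀ t₀ q hk j t).1

theorem TorusBound.wnorm_auxB_le (h : S.TorusBound A₀ p q N) :
    wnorm (epsRadius N) (betaRadius N) (S.auxB A₀ t₀ q) ≤ actionBound N :=
  wnorm_le_of_eventually_eq (fun n => (h.wnorm_auxIter_le t₀ n).2)
    fun _ _ j t hk => (S.co_auxIter_of_le A₀ t₀ q hk j t).2

end Norms

end PerturbedSystem

/-! ### Orders and ramification in the Newton-Puiseux process -/

section NewtonPuiseux

open Polynomial

/-- The order of the series `f(0, y)` is `ν`. -/
def HasOrder (f : ℕ → ℕ → ℝ) (ν : ℕ) : Prop := f 0 ν ≠ 0 ∧ ∀ j < ν, f 0 j = 0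

namespace NPChoice

variable {d : NPChoice} {f : ℕ → ℕ → ℝ} {σ : ℝ}

theorem mem_newtonRegion {k j : ℕ} (h : f k j ≠ 0) : ((k : ℝ), (j : ℝ)) ∈ newtonRegion f :=
  subset_convexHull ℝ _ ⟨k, j, h, le_rfl, le_rfl⟩

theorem IsSegment.le_of_ne_zero (hd : d.IsSegment f) {k j : ℕ} (h : f k j ≠ 0) :
    d.s ≤ d.p * k + d.h * j := by
  have : (d.s : ℝ) ≤ d.p * k + d.h * j := hd.2.2.2.1 _ (mem_newtonRegion h)
  exact_mod_cast this

/-- A segment carries at least two terms of the series. -/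
theorem IsSegment.exists_pair (hd : d.IsSegment f) : ∃ k j k' j' : ℕ,
    f k j ≠ 0 ∧ f k' j' ≠ 0 ∧ d.p * k + d.h * j = d.s ∧ d.p * k' + d.h * j' = d.s ∧ j < j' := by
  obtain ⟨hp, hh, -, hle, hnt⟩ := hd
  have hp' : (0 : ℝ) < d.p := by exact_mod_cast hp
  have hh' : (0 : ℝ) < d.h := by exact_mod_cast hh
  by_contra hcon
  push Not at hcon
  have huniq : ∀ k j k' j' : ℕ, f k j ≠ 0 → f k' j' ≠ 0 → d.p * k + d.h * j = d.s →
      d.p * k' + d.h * j' = d.s → k = k' ∧ j = j' := by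
    intro k j k' j' h1 h2 h3 h4
    have e1 := hcon k j k' j' h1 h2 h3 h4
    have e2 := hcon k' j' k j h2 h1 h4 h3
    have e : j = j' := le_antisymm e2 e1
    subst e
    have : d.p * k = d.p * k' := by omega
    exact ⟨Nat.eq_of_mul_eq_mul_left hp this, rfl⟩
  -- If no term lies on the line, any point serves as `z`; the value `0` is arbitrary.
  obtain ⟨z, hz⟩ : ∃ z : ℝ × ℝ, ∀ k j : ℕ, f k j ≠ 0 → d.p * k + d.h * j = d.s →
      ((k : ℝ), (j : ℝ)) = z := by
    by_cases hex : ∃ k j : ℕ, f k j ≠ 0 ∧ d.p * k + d.h * j = d.s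
    · obtain ⟨k, j, h1, h2⟩ := hex
      refine ⟨(k, j), fun k' j' h1' h2' => ?_⟩
      obtain ⟨rfl, rfl⟩ := huniq k' j' k j h1' h1 h2' h2
      rfl
    · push Not at hex
      exact ⟨0, fun k j h1 h2 => absurd h2 (hex k j h1)⟩
  set L : ℝ × ℝ → ℝ := fun x => d.p * x.1 + d.h * x.2 with hL
  -- The half-plane above the line, with its boundary line reduced to the single point `z`, is still
  -- convex. It contains all the quadrants, hence their convex hull, which therefore cannot meet the
  -- line in two points.
  have hconv : Convex ℝ {x : ℝ × ℝ | (d.s : ℝ) ≤ L x ∧ (L x = d.s → x = z)} := by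
    intro x hx y hy a b ha hb hab
    have hLxy : L (a • x + b • y) = a * L x + b * L y := by
      simp only [hL, Prod.fst_add, Prod.snd_add, Prod.smul_fst, Prod.smul_snd, smul_eq_mul]; ring
    refine ⟨?_, fun he => ?_⟩
    · rw [hLxy]
      nlinarith [mul_le_mul_of_nonneg_left hx.1 ha, mul_le_mul_of_nonneg_left hy.1 hb]
    · rw [hLxy] at he
      have h1 : a * (L x - d.s) + b * (L y - d.s) = 0 := by
        have : (d.s : ℝ) = (a + b) * d.s := by rw [hab, one_mul]
        linarith
      have h2 : 0 ≤ a * (L x - d.s) := mul_nonneg ha (sub_nonneg.2 hx.1)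
      have h3 : 0 ≤ b * (L y - d.s) := mul_nonneg hb (sub_nonneg.2 hy.1)
      have h4 : a * (L x - d.s) = 0 := by linarith
      have h5 : b * (L y - d.s) = 0 := by linarith
      rcases mul_eq_zero.1 h4 with h4 | h4 <;> rcases mul_eq_zero.1 h5 with h5 | h5
      · linarith
      · have hb1 : b = 1 := by linarith
        rw [h4, hb1, zero_smul, one_smul, zero_add]
        exact hy.2 (by linarith)
      · have ha1 : a = 1 := by linarith
        rw [h5, ha1, zero_smul, one_smul, add_zero]
        exact hx.2 (by linarith)
      · rw [hx.2 (by linarith), hy.2 (by linarith), ← add_smul, hab, one_smul]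
  have hsub : newtonRegion f ⊆ {x : ℝ × ℝ | (d.s : ℝ) ≤ L x ∧ (L x = d.s → x = z)} := by
    refine convexHull_min ?_ hconv
    rintro x ⟨k, j, hf, hk, hj⟩
    refine ⟨hle x (subset_convexHull ℝ _ ⟨k, j, hf, hk, hj⟩), fun he => ?_⟩
    have h0 := hle _ (mem_newtonRegion hf)
    simp only [hL] at he h0
    have h1 : (d.p : ℝ) * k ≤ d.p * x.1 := by gcongr
    have h2 : (d.h : ℝ) * j ≤ d.h * x.2 := by gcongr
    have h3 : (d.p : ℝ) * k = d.p * x.1 := by linarith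
    have h4 : (d.h : ℝ) * j = d.h * x.2 := by linarith
    have h5 : (k : ℝ) = x.1 := mul_left_cancel₀ hp'.ne' h3
    have h6 : (j : ℝ) = x.2 := mul_left_cancel₀ hh'.ne' h4
    rw [← hz k j hf (by exact_mod_cast (by linarith : (d.p : ℝ) * k + d.h * j = d.s)), h5, h6]
  obtain ⟨x, hx, y, hy, hxy⟩ := hnt
  exact hxy (((hsub hx.1).2 hx.2).trans ((hsub hy.1).2 hy.2).symm)

/-- On a segment the exponent of `ε` is determined by that of `y`. -/
theorem coeff_poly (hp : 0 < d.p) (hh : 0 < d.h) {k j : ℕ} (h : d.p * k + d.h * j = d.s) :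
    (d.poly σ f).coeff j = σ ^ k * f k j := by
  rw [poly, finsetSum_coeff, Finset.sum_eq_single (k, j)]
  · rw [coeff_C_mul, coeff_X_pow_self, mul_one]
  · rintro ⟨k', j'⟩ hx hne
    simp only [Finset.mem_filter, Finset.mem_product, Finset.mem_range] at hx
    rw [coeff_C_mul, coeff_X_pow, if_neg, mul_zero]
    rintro rfl
    apply hne
    have : d.p * k' = d.p * k := by omega
    rw [Nat.eq_of_mul_eq_mul_left hp this]
  · intro hx
    exfalso
    apply hx
    simp only [Finset.mem_filter, Finset.mem_product, Finset.mem_range]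
    refine ⟨⟨?_, ?_⟩, h⟩
    · have := Nat.le_mul_of_pos_left k hp; omega
    · have := Nat.le_mul_of_pos_left j hh; omega

theorem exists_of_coeff_poly_ne_zero {j : ℕ} (h : (d.poly σ f).coeff j ≠ 0) :
    ∃ k, d.p * k + d.h * j = d.s ∧ f k j ≠ 0 := by
  rw [poly, finsetSum_coeff] at h
  obtain ⟨⟨k, j'⟩, hx, hne⟩ := Finset.exists_ne_zero_of_sum_ne_zero h
  simp only [Finset.mem_filter, Finset.mem_product, Finset.mem_range] at hx
  rw [coeff_C_mul, coeff_X_pow] at hne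
  split_ifs at hne with hj
  · subst hj
    exact ⟨k, hx.2, fun h0 => hne (by rw [h0]; simp)⟩
  · simp at hne

theorem IsSegment.poly_ne_zero (hd : d.IsSegment f) (hσ : σ ≠ 0) : d.poly σ f ≠ 0 := by
  obtain ⟨k, j, k', j', h1, -, h3, -, -⟩ := hd.exists_pair
  intro h0
  have := coeff_poly (σ := σ) (f := f) hd.1 hd.2.1 h3
  rw [h0, coeff_zero] at this
  exact mul_ne_zero (pow_ne_zero _ hσ) h1 this.symm

/-- At `η = 0` only the terms on the segment survive, and the new series is `P(c + y)`. The order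
and the slope of the next series are thus read off from the polynomial `P` at `c`. -/
theorem next_zero_eq_coeff_taylor (l : ℕ) :
    d.next σ f 0 l = (taylor d.c (d.poly σ f)).coeff l := by
  rw [next, poly, map_sum, finsetSum_coeff]
  refine Finset.sum_congr rfl fun x _ => ?_
  rw [taylor_coeff, C_mul_X_pow_eq_monomial, hasseDeriv_monomial, eval_monomial]
  ring

theorem hasOrder_next (hP : d.poly σ f ≠ 0) :
    HasOrder (d.next σ f) ((d.poly σ f).rootMultiplicity d.c) := by
  have h1 : (d.poly σ f).rootMultiplicity d.c = (taylor d.c (d.poly σ f)).natTrailingDegree := by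
    rw [rootMultiplicity_eq_natTrailingDegree, taylor_apply]
  have h2 : taylor d.c (d.poly σ f) ≠ 0 := by
    intro h; exact hP ((taylor_eq_zero _ _).1 h)
  rw [h1]
  refine ⟨?_, fun j hj => ?_⟩
  · rw [next_zero_eq_coeff_taylor]
    exact trailingCoeff_nonzero_iff_nonzero.2 h2
  · rw [next_zero_eq_coeff_taylor]
    exact coeff_eq_zero_of_lt_natTrailingDegree hj

/-- The point `(0, ν)` belongs to the Newton region, so `s ≤ h * ν`, while a term of exponent `j` on
the line has `h * j ≤ s`. -/
theorem IsSegment.natDegree_le (hd : d.IsSegment f) {ν : ℕ} (hν : HasOrder f ν) :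
    (d.poly σ f).natDegree ≤ ν := by
  rw [natDegree_le_iff_coeff_eq_zero]
  intro j hj
  by_contra hne
  obtain ⟨k, hk, -⟩ := exists_of_coeff_poly_ne_zero hne
  have h1 := hd.le_of_ne_zero hν.1
  have h2 : d.h * (ν + 1) ≤ d.h * j := Nat.mul_le_mul_left _ hj
  have h3 := hd.2.1
  rw [Nat.mul_add] at h2
  omega

/-- The exponents on a segment are congruent modulo `p`. -/
theorem IsSegment.modEq (hd : d.IsSegment f) {k j k' j' : ℕ} (h : d.p * k + d.h * j = d.s)
    (h' : d.p * k' + d.h * j' = d.s) : j ≡ j' [MOD d.p] := by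
  have h1 : d.h * j ≡ d.h * j' [MOD d.p] := by
    have e1 : d.p * k + d.h * j ≡ d.h * j [MOD d.p] := by
      simp [Nat.ModEq]
    have e2 : d.p * k' + d.h * j' ≡ d.h * j' [MOD d.p] := by
      simp [Nat.ModEq]
    rw [h] at e1
    rw [h'] at e2
    exact e1.symm.trans e2
  exact Nat.ModEq.cancel_left_of_coprime hd.2.2.1 h1

end NPChoice

/-- For `c ≠ 0`, a root of `X ^ a * Q(X ^ p)` has multiplicity at most `deg Q`. -/
theorem Polynomial.mul_rootMultiplicity_le_of_sparse {P : ℝ[X]} (hP : P ≠ 0) {p a : ℕ}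
    (hp : 0 < p) (hcoeff : ∀ j, P.coeff j ≠ 0 → j ≡ a [MOD p]) {c : ℝ} (hc : c ≠ 0) :
    p * P.rootMultiplicity c ≤ P.natDegree := by
  obtain ⟨b, hbp, hb⟩ : ∃ b < p, a ≡ b [MOD p] := ⟨a % p, Nat.mod_lt _ hp, (Nat.mod_modEq _ _).symm⟩
  obtain ⟨Q, hQ⟩ : ∃ Q : ℝ[X], P = X ^ b * expand ℝ p Q := by
    refine ⟨∑ i ∈ Finset.range (P.natDegree + 1), C (P.coeff (b + p * i)) * X ^ i, ?_⟩
    ext j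
    rw [mul_comm, coeff_mul_X_pow']
    by_cases hbj : b ≤ j
    · rw [if_pos hbj, coeff_expand hp]
      split_ifs with hdvd
      · obtain ⟨i, hi⟩ := hdvd
        have hj : j = b + p * i := by omega
        rw [hi, Nat.mul_div_cancel_left i hp, finsetSum_coeff]
        simp only [coeff_C_mul, coeff_X_pow, mul_ite, mul_one, mul_zero]
        rw [Finset.sum_ite_eq, hj]
        split_ifs with hmem
        · rfl
        · rw [Finset.mem_range, not_lt] at hmem
          apply coeff_eq_zero_of_natDegree_lt
          have := Nat.le_mul_of_pos_left i hp
          omega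
      · by_contra hne
        apply hdvd
        have := ((hcoeff j hne).trans hb).symm
        exact (Nat.modEq_iff_dvd' hbj).1 this
    · rw [if_neg hbj]
      by_contra hne
      have := (hcoeff j hne).trans hb
      have e := Nat.ModEq.eq_of_lt_of_lt this (by omega) hbp
      omega
  have hQ0 : Q ≠ 0 := by rintro rfl; apply hP; rw [hQ]; simp
  have hcp : c ^ p ≠ 0 := pow_ne_zero _ hc
  obtain ⟨R, hR, hRr⟩ := exists_eq_pow_rootMultiplicity_mul_and_not_dvd Q hQ0 (c ^ p)
  set r := Q.rootMultiplicity (c ^ p) with hr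
  have hdeg : P.natDegree = b + Q.natDegree * p := by
    rw [hQ, natDegree_mul (pow_ne_zero _ X_ne_zero) ((expand_ne_zero hp).2 hQ0), natDegree_X_pow,
      natDegree_expand]
  have hrQ : r ≤ Q.natDegree := by
    rw [hr, ← count_roots]
    exact (Multiset.count_le_card _ _).trans (card_roots' Q)
  -- As `c ≠ 0`, the polynomial `X ^ p - c ^ p` is separable. The multiplicity of `c` in `P` is
  -- therefore at most that of `c ^ p` in `Q`.
  have hsep : (X ^ p - C (c ^ p) : ℝ[X]).rootMultiplicity c ≤ 1 := by
    apply rootMultiplicity_le_one_of_separable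
    exact separable_X_pow_sub_C _ (by exact_mod_cast hp.ne') hcp
  have hmul : P.rootMultiplicity c ≤ r := by
    have hP' : P = X ^ b * ((X ^ p - C (c ^ p)) ^ r * expand ℝ p R) := by
      rw [hQ, hR]; simp
    have hRe : expand ℝ p R ≠ 0 := by
      rw [expand_ne_zero hp]
      rintro rfl
      exact hRr (dvd_zero _)
    have hXp : (X ^ p - C (c ^ p) : ℝ[X]) ≠ 0 := X_pow_sub_C_ne_zero hp _
    have hne1 : (X ^ p - C (c ^ p) : ℝ[X]) ^ r * expand ℝ p R ≠ 0 :=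
      mul_ne_zero (pow_ne_zero _ hXp) hRe
    rw [hP', rootMultiplicity_mul (mul_ne_zero (pow_ne_zero _ X_ne_zero) hne1),
      rootMultiplicity_mul hne1]
    have z1 : (X ^ b : ℝ[X]).rootMultiplicity c = 0 := by
      apply rootMultiplicity_eq_zero
      simp [IsRoot, hc]
    have z2 : (expand ℝ p R).rootMultiplicity c = 0 := by
      apply rootMultiplicity_eq_zero
      rw [IsRoot, expand_eval]
      intro h0
      exact hRr (dvd_iff_isRoot.2 h0)
    have z3 : ((X ^ p - C (c ^ p) : ℝ[X]) ^ r).rootMultiplicity c ≤ r := by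
      have : ∀ m : ℕ, ((X ^ p - C (c ^ p) : ℝ[X]) ^ m).rootMultiplicity c ≤ m := by
        intro m
        induction m with
        | zero => rw [pow_zero, ← C_1, rootMultiplicity_C]
        | succ m ih =>
          rw [pow_succ, rootMultiplicity_mul (mul_ne_zero (pow_ne_zero _ hXp) hXp)]
          omega
      exact this r
    omega
  calc p * P.rootMultiplicity c ≤ p * Q.natDegree := Nat.mul_le_mul_left _ (hmul.trans hrQ)
    _ ≤ P.natDegree := by rw [hdeg, mul_comm]; exact Nat.le_add_left _ _

namespace NPChoice

variable {d : NPChoice} {f : ℕ → ℕ → ℝ} {σ : ℝ}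

/-- Exponents on the segment are congruent modulo `p`. If `c = 0`, the multiplicity `m` is at most
the smaller of two distinct exponents, so `p + m ≤ ν` and `p! m!` divides `ν!`. If `c ≠ 0`,
sparseness of the polynomial gives `p * m ≤ ν`, and `p * m!` divides `(p * m)!` when `m > 0`. -/
theorem IsSegment.mul_factorial_dvd (hd : d.IsSegment f) (hσ : σ ≠ 0) {ν : ℕ}
    (hν : HasOrder f ν) :
    d.p * ((d.poly σ f).rootMultiplicity d.c).factorial ∣ ν.factorial := by
  have hp := hd.1
  have hP := hd.poly_ne_zero hσ
  obtain ⟨k, j, k', j', h1, h2, h3, h4, hjj⟩ := hd.exists_pair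
  have hcj : (d.poly σ f).coeff j ≠ 0 := by
    rw [coeff_poly hd.1 hd.2.1 h3]; exact mul_ne_zero (pow_ne_zero _ hσ) h1
  have hcj' : (d.poly σ f).coeff j' ≠ 0 := by
    rw [coeff_poly hd.1 hd.2.1 h4]; exact mul_ne_zero (pow_ne_zero _ hσ) h2
  have hj'ν : j' ≤ ν := (le_natDegree_of_ne_zero hcj').trans (hd.natDegree_le hν)
  have hmod := hd.modEq h3 h4
  have hpj : j + d.p ≤ j' := by
    have := (Nat.modEq_iff_dvd' hjj.le).1 hmod
    have := Nat.le_of_dvd (by omega) this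
    omega
  set m := (d.poly σ f).rootMultiplicity d.c with hm
  by_cases hc : d.c = 0
  · have hmj : m ≤ j := by
      rw [hm, hc, rootMultiplicity_eq_natTrailingDegree']
      exact natTrailingDegree_le_of_ne_zero hcj
    have hν' : d.p + m ≤ ν := by omega
    calc d.p * m.factorial ∣ d.p.factorial * m.factorial :=
          mul_dvd_mul (Nat.dvd_factorial hp le_rfl) dvd_rfl
      _ ∣ (d.p + m).factorial := Nat.factorial_mul_factorial_dvd_factorial_add _ _
      _ ∣ ν.factorial := Nat.factorial_dvd_factorial hν'
  · have hpm : d.p * m ≤ ν := by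
      refine le_trans (Polynomial.mul_rootMultiplicity_le_of_sparse hP hp (a := j) ?_ hc)
        (hd.natDegree_le hν)
      intro i hi
      obtain ⟨k'', hk'', -⟩ := exists_of_coeff_poly_ne_zero hi
      exact hd.modEq hk'' h3
    rcases Nat.eq_zero_or_pos m with h0 | h0
    · rw [h0, Nat.factorial_zero, mul_one]
      exact Nat.dvd_factorial hp (by omega)
    -- One has `(pm)! = pm (pm - 1)!`, and `(m - 1)!` divides `(pm - 1)!`.
    · have hdvd : d.p * m.factorial ∣ (d.p * m).factorial := by
        obtain ⟨i, hi⟩ : ∃ i, m = i + 1 := ⟨m - 1, by omega⟩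
        obtain ⟨l, hl⟩ : ∃ l, d.p * m = l + 1 :=
          ⟨d.p * m - 1, by have := Nat.mul_pos hp h0; omega⟩
        have hil : i ≤ l := by have := Nat.le_mul_of_pos_left m hp; omega
        rw [hl, Nat.factorial_succ, ← hl, hi, Nat.factorial_succ, ← mul_assoc]
        exact mul_dvd_mul dvd_rfl (Nat.factorial_dvd_factorial hil)
      exact hdvd.trans (Nat.factorial_dvd_factorial hpm)

end NPChoice

variable {f : ℕ → ℕ → ℝ} {σ : ℝ} {d : ℕ → NPChoice} {i₀ : ℕ}

theorem npSign_ne_zero (hσ : σ ≠ 0) (i : ℕ) : npSign σ i ≠ 0 := by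
  unfold npSign; split_ifs <;> simp [hσ]

/-- The factorial of the current order is the part of `n!` still available for later ramification;
each step spends a factor `p` of it. -/
theorem IsSimpleNPRun.prod_mul_factorial_dvd (hr : IsSimpleNPRun σ f d i₀) (hσ : σ ≠ 0) {n : ℕ}
    (hn : HasOrder f n) : ∀ i ≤ i₀ + 1, ∃ ν, HasOrder (npSeries σ f d i) ν ∧
      (∏ l ∈ Finset.range i, (d l).p) * ν.factorial ∣ n.factorial := by
  intro i hi
  induction i with
  | zero => exact ⟨n, hn, by simp⟩
  | succ i ih =>
    obtain ⟨ν, hν, hdvd⟩ := ih (by omega)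
    have hd := (hr.1 i (by omega)).1
    have hs := npSign_ne_zero hσ i
    refine ⟨_, NPChoice.hasOrder_next (hd.poly_ne_zero hs), ?_⟩
    rw [Finset.prod_range_succ, mul_assoc]
    exact (mul_dvd_mul dvd_rfl (hd.mul_factorial_dvd hs hν)).trans hdvd

/-- The ramification index divides `n!`. -/
theorem IsSimpleNPRun.npRamification_dvd (hr : IsSimpleNPRun σ f d i₀) (hσ : σ ≠ 0) {n : ℕ}
    (hn : HasOrder f n) : npRamification d i₀ ∣ n.factorial := by
  obtain ⟨ν, -, h⟩ := hr.prod_mul_factorial_dvd hσ hn (i₀ + 1) le_rfl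
  exact (Dvd.intro _ rfl).trans h

theorem IsSimpleNPRun.p_pos (hr : IsSimpleNPRun σ f d i₀) {i : ℕ} (hi : i ≤ i₀) : 0 < (d i).p :=
  (hr.1 i hi).1.1

theorem IsSimpleNPRun.npSeries_zero_zero (hr : IsSimpleNPRun σ f d i₀) :
    npSeries σ f d (i₀ + 1) 0 0 = 0 := by
  change (d i₀).next _ _ 0 0 = 0
  rw [NPChoice.next_zero_eq_coeff_taylor, taylor_coeff_zero]
  exact (hr.1 i₀ le_rfl).2

theorem npSeries_zero_one (σ : ℝ) (f : ℕ → ℕ → ℝ) (d : ℕ → NPChoice) (i₀ : ℕ) :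
    npSeries σ f d (i₀ + 1) 0 1 = npSlope σ f d i₀ := by
  change (d i₀).next _ _ 0 1 = _
  rw [NPChoice.next_zero_eq_coeff_taylor, taylor_coeff_one]
  rfl

theorem IsSimpleNPRun.npSlope_ne_zero (hr : IsSimpleNPRun σ f d i₀) : npSlope σ f d i₀ ≠ 0 := by
  intro h0
  have hP : npPoly σ f d i₀ ≠ 0 := by
    intro h
    have := hr.2
    rw [h, rootMultiplicity_zero] at this
    omega
  have := (one_lt_rootMultiplicity_iff_isRoot hP).2 ⟨(hr.1 i₀ le_rfl).2, h0⟩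
  have := hr.2
  omega

/-! ### Bounds of the coefficients -/

/-- The coefficients are bounded by `K ^ (k + j + 1)`. -/
def GeomBound (K : ℝ) (f : ℕ → ℕ → ℝ) : Prop := ∀ k j, |f k j| ≤ K ^ (k + j + 1)

theorem GeomBound.mono {K K' : ℝ} (hK : 0 ≤ K) (h : K ≤ K') {f : ℕ → ℕ → ℝ}
    (hf : GeomBound K f) : GeomBound K' f :=
  fun k j => (hf k j).trans (by gcongr)

/-- The sum has at most `4 ^ L` terms, `L = s + m + 1`, and each is at most `(2NK) ^ L`, the factor
`2 ^ L` coming from the binomial coefficient. The exponent `n + 1` in the new base absorbs the shift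
by `s ≤ n`. -/
theorem GeomBound.next {d : NPChoice} {f : ℕ → ℕ → ℝ} {σ K N : ℝ} (hf : GeomBound K f)
    (hK : 1 ≤ K) (hN : 1 ≤ N) (hσ : |σ| = 1) (hp : 0 < d.p) (hh : 0 < d.h) (hc : |d.c| ≤ N) {n : ℕ} (hsn : d.s ≤ n) :
    GeomBound ((8 * N * K) ^ (n + 1)) (d.next σ f) := by
  intro m l
  have hterm : ∀ x ∈ (Finset.range (d.s + m + 1) ×ˢ Finset.range (d.s + m + 1)).filter
      (fun x => d.p * x.1 + d.h * x.2 = d.s + m),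
      |σ ^ x.1 * f x.1 x.2 * (x.2.choose l : ℝ) * d.c ^ (x.2 - l)| ≤
        (2 * N * K) ^ (d.s + m + 1) := by
    rintro ⟨k, j⟩ hx
    simp only [Finset.mem_filter, Finset.mem_product, Finset.mem_range] at hx
    have hk := Nat.le_mul_of_pos_left k hp
    have hj := Nat.le_mul_of_pos_left j hh
    have hch : (j.choose l : ℝ) ≤ 2 ^ (d.s + m + 1) := by
      have h1 : j.choose l ≤ 2 ^ j := Nat.choose_le_two_pow _ _
      have h2 : (2 : ℕ) ^ j ≤ 2 ^ (d.s + m + 1) := Nat.pow_le_pow_right (by norm_num) (by omega)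
      exact_mod_cast h1.trans h2
    have hcp : |d.c| ^ (j - l) ≤ N ^ (d.s + m + 1) :=
      (pow_le_pow_left₀ (abs_nonneg _) hc _).trans (pow_le_pow_right₀ hN (by omega))
    have hfk : |f k j| ≤ K ^ (d.s + m + 1) :=
      (hf k j).trans (pow_le_pow_right₀ hK (by omega))
    rw [abs_mul, abs_mul, abs_mul, abs_pow, abs_pow, hσ, one_pow, one_mul, Nat.abs_cast]
    calc |f k j| * (j.choose l : ℝ) * |d.c| ^ (j - l)
        ≤ K ^ (d.s + m + 1) * 2 ^ (d.s + m + 1) * N ^ (d.s + m + 1) := by gcongr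
      _ = (2 * N * K) ^ (d.s + m + 1) := by rw [mul_pow, mul_pow]; ring
  have hcard : ((((Finset.range (d.s + m + 1) ×ˢ Finset.range (d.s + m + 1)).filter
      (fun x => d.p * x.1 + d.h * x.2 = d.s + m)).card : ℕ) : ℝ) ≤ 4 ^ (d.s + m + 1) := by
    have h1 := Finset.card_filter_le (Finset.range (d.s + m + 1) ×ˢ Finset.range (d.s + m + 1))
      (fun x => d.p * x.1 + d.h * x.2 = d.s + m)
    rw [Finset.card_product, Finset.card_range] at h1
    have h2 : d.s + m + 1 ≤ 2 ^ (d.s + m + 1) := Nat.lt_two_pow_self.le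
    have h3 : (d.s + m + 1) * (d.s + m + 1) ≤ 4 ^ (d.s + m + 1) := by
      calc _ ≤ 2 ^ (d.s + m + 1) * 2 ^ (d.s + m + 1) := Nat.mul_le_mul h2 h2
        _ = 4 ^ (d.s + m + 1) := by rw [← mul_pow]; norm_num
    exact_mod_cast h1.trans h3
  have h8 : 1 ≤ 8 * N * K := by nlinarith
  calc |d.next σ f m l| ≤ ∑ x ∈ _, _ := Finset.abs_sum_le_sum_abs _ _
    _ ≤ _ := Finset.sum_le_card_nsmul _ _ _ hterm
    _ ≤ 4 ^ (d.s + m + 1) * (2 * N * K) ^ (d.s + m + 1) := by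
        rw [nsmul_eq_mul]; gcongr
    _ = (8 * N * K) ^ (d.s + m + 1) := by rw [← mul_pow]; ring
    _ ≤ ((8 * N * K) ^ (n + 1)) ^ (m + l + 1) := by
        rw [← pow_mul]
        refine pow_le_pow_right₀ h8 ?_
        have : (n + 1) * (m + l + 1) = n + m + 1 + (n * (m + l) + l) := by ring
        omega

/-- The growth of the bounds in the Newton-Puiseux process. -/
def npBound (N K : ℕ) : ℕ → ℕ
  | 0 => K
  | i + 1 => (8 * N * npBound N K i) ^ (N + 1)

theorem npBound_pos {N K : ℕ} (hN : 1 ≤ N) (hK : 1 ≤ K) (i : ℕ) : 1 ≤ npBound N K i := by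
  induction i with
  | zero => exact hK
  | succ i ih => exact Nat.one_le_pow _ _ (by positivity)

theorem npBound_mono {N K : ℕ} (hN : 1 ≤ N) (hK : 1 ≤ K) : Monotone (npBound N K) := by
  refine monotone_nat_of_le_succ fun i => ?_
  have h1 := npBound_pos hN hK i
  calc npBound N K i ≤ 8 * N * npBound N K i := Nat.le_mul_of_pos_left _ (by omega)
    _ ≤ (8 * N * npBound N K i) ^ (N + 1) := Nat.le_self_pow (by omega) _

theorem abs_npSign (hσ : |σ| = 1) (i : ℕ) : |npSign σ i| = 1 := by
  unfold npSign; split_ifs <;> simp [hσ]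

theorem IsSimpleNPRun.geomBound (hr : IsSimpleNPRun σ f d i₀) (hσ : |σ| = 1) {N K : ℕ}
    (hN : 1 ≤ N) (hK : 1 ≤ K) (hf : GeomBound K f)
    (hd : ∀ i ≤ i₀, (d i).s ≤ N ∧ |(d i).c| ≤ N) :
    ∀ i ≤ i₀ + 1, GeomBound (npBound N K i) (npSeries σ f d i) := by
  intro i hi
  induction i with
  | zero => exact hf
  | succ i ih =>
    have hs := (hr.1 i (by omega)).1
    have := (ih (by omega)).next (d := d i) (σ := npSign σ i) (N := N) (n := N)
      (by exact_mod_cast npBound_pos hN hK i) (by exact_mod_cast hN) (abs_npSign hσ i) hs.1 hs.2.1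
      (hd i (by omega)).2 (hd i (by omega)).1
    simpa [npBound, npSeries] using this

end NewtonPuiseux

/-! ### The bifurcation series: growth of its coefficients and its order at `ε = 0`. -/

theorem iteratedDeriv_eq_of_hasSum {g : ℝ → ℝ} {a r : ℝ} (hr : 0 < r) {c : ℕ → ℝ}
    (h : ∀ x, |x| < r → HasSum (fun n => c n * x ^ n) (g (a + x))) (n : ℕ) :
    iteratedDeriv n g a = n.factorial * c n := by
  set p : FormalMultilinearSeries ℝ ℝ ℝ := FormalMultilinearSeries.ofScalars ℝ c with hp
  have hrad : ENNReal.ofReal (r / 2) ≤ p.radius := by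
    have h1 : (((r / 2).toNNReal : NNReal) : ENNReal) ≤ p.radius := by
      refine p.le_radius_of_tendsto (l := 0) ?_
      have h2 := (h (r / 2) (by rw [abs_of_pos (by positivity)]; linarith)).summable
      have h3 := h2.tendsto_atTop_zero.norm
      rw [norm_zero] at h3
      refine h3.congr fun n => ?_
      rw [hp, FormalMultilinearSeries.ofScalars_norm, Real.coe_toNNReal _ (by positivity),
        norm_mul, norm_pow, Real.norm_of_nonneg (by positivity : 0 ≤ r / 2)]
    exact h1
  have hps : HasFPowerSeriesOnBall g p a (ENNReal.ofReal (r / 2)) := by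
    refine ⟨hrad, ENNReal.ofReal_pos.2 (by positivity), fun {y} hy => ?_⟩
    rw [Metric.eball_ofReal, Metric.mem_ball, Real.dist_eq, sub_zero] at hy
    refine (h y (by linarith)).congr_fun fun n => ?_
    rw [hp, FormalMultilinearSeries.ofScalars_apply_eq, smul_eq_mul]
  have h1 := hps.hasFPowerSeriesAt
  have h2 := h1.analyticAt.hasFPowerSeriesAt
  have h3 := h1.eq_formalMultilinearSeries h2
  have h4 := congrArg (fun P => FormalMultilinearSeries.coeff P n) h3
  simp only [hp, FormalMultilinearSeries.coeff_ofScalars] at h4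
  rw [h4]
  have : (n.factorial : ℝ) ≠ 0 := by positivity
  field_simp

namespace Series2

open scoped ENNReal NNReal

theorem abs_co_mul_le_of_wnorm_le {ρ δ C : ℝ≥0} {u : ℝ → Series2} (h : wnorm ρ δ u ≤ C)
    (k j : ℕ) (t : ℝ) : |co k j (u t)| * (ρ ^ k * δ ^ j) ≤ C := by
  have h1 : ‖co k j (u t)‖ₑ * weight ρ δ (k, j) ≤ C :=
    (mul_le_mul' (enorm_co_le_supCo u k j t) le_rfl).trans
      ((ENNReal.le_tsum (k, j)).trans h)
  rw [weight, enorm_eq_nnnorm] at h1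
  have h2 : ‖co k j (u t)‖₊ * (ρ ^ k * δ ^ j) ≤ C := by exact_mod_cast h1
  exact_mod_cast h2

end Series2

namespace PerturbedSystem

open Series2
open scoped ENNReal NNReal

variable {S : PerturbedSystem} {A₀ : ℝ} {p : ℤ} {q N : ℕ} (t₀ : ℝ)

theorem TorusBound.wnorm_gamma_aux_le (h : S.TorusBound A₀ p q N) :
    wnorm (epsRadius N) (betaRadius N)
      (S.formalGamma A₀ t₀ (S.auxBeta A₀ t₀ q) (S.auxB A₀ t₀ q)) ≤ epsRadius N * (4 * N) :=
  h.wnorm_formalGamma_le t₀ (natCast_mul_le_two_inv h.one_le (h.wnorm_auxBeta_le t₀))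
    (natCast_mul_le_two_inv h.one_le ((h.wnorm_auxB_le t₀).trans
      (ENNReal.coe_le_coe.2 (actionBound_le_angleBound h.one_le))))

/-- The coefficients of the bifurcation series grow at most geometrically. -/
theorem TorusBound.geomBound_bifCoeff (h : S.TorusBound A₀ p q N) :
    GeomBound ((10 ^ 6 * N ^ 7 : ℕ) : ℝ) (S.bifCoeff A₀ t₀ q) := by
  intro k j
  have h1 : wnorm (epsRadius N) (betaRadius N) (fun _ => mean (2 * Real.pi * q)
      (S.formalGamma A₀ t₀ (S.auxBeta A₀ t₀ q) (S.auxB A₀ t₀ q))) ≤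
      ((epsRadius N * (4 * N) : ℝ≥0) : ℝ≥0∞) := by
    push_cast
    exact (wnorm_mean_le h.period_pos).trans (h.wnorm_gamma_aux_le t₀)
  have h2 := abs_co_mul_le_of_wnorm_le h1 (k + 1) j 0
  have hn : (1 : ℝ) ≤ N := by exact_mod_cast h.one_le
  have hρ : (0 : ℝ) < epsRadius N := by simp only [epsRadius]; push_cast; positivity
  have hδ : (0 : ℝ) < betaRadius N := by simp only [betaRadius]; push_cast; positivity
  change |S.bifCoeff A₀ t₀ q k j| * _ ≤ _ at h2
  push_cast at h2
  -- The definition `ε𝓕 = ⟨Γ⟩` shifts the order by one; the extra power of the radius cancels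
  -- against the factor `ε` in the bound of `Γ`.
  have h3 : |S.bifCoeff A₀ t₀ q k j| * ((epsRadius N : ℝ) ^ k * (betaRadius N : ℝ) ^ j) ≤
      4 * N := by
    rw [pow_succ] at h2
    refine le_of_mul_le_mul_left ?_ hρ
    linarith
  set K : ℝ := ((10 ^ 6 * N ^ 7 : ℕ) : ℝ) with hK
  have hKρ : (epsRadius N : ℝ) = K⁻¹ := by simp only [epsRadius, hK]; push_cast; norm_num
  have h7 : (N : ℝ) ≤ N ^ 7 := le_self_pow₀ hn (by norm_num)
  have hK4 : 4 * (N : ℝ) ≤ K := by rw [hK]; push_cast; linarith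
  have hK0 : 0 < K := by linarith
  have hKδ : K⁻¹ ≤ (betaRadius N : ℝ) := by
    simp only [betaRadius]; push_cast
    exact inv_anti₀ (by positivity) hK4
  have h4 : |S.bifCoeff A₀ t₀ q k j| * (K⁻¹ ^ k * K⁻¹ ^ j) ≤ K := by
    refine le_trans ?_ (h3.trans hK4)
    rw [hKρ]
    gcongr
  rw [← pow_add, inv_pow, mul_inv_le_iff₀ (pow_pos hK0 _)] at h4
  rw [pow_succ, mul_comm]
  exact h4

/-- At `ε = 0` the bifurcation function is the mean of the Taylor coefficients of `G`. -/
theorem bifCoeff_zero (S : PerturbedSystem) (A₀ t₀ : ℝ) (q : ℕ) (j : ℕ) :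
    S.bifCoeff A₀ t₀ q 0 j = meanOver (2 * Real.pi * q)
      (fun t => taylorCoeff S.G (S.ω A₀ * t) A₀ (t + t₀) j 0) := by
  rw [bifCoeff, co_mean]
  congr 1
  funext t
  -- At order zero in `ε` the angle component is `β₀` and the action component is `0`, so only the
  -- term with `r = j`, `s = 0` contributes.
  rw [formalGamma, co_eps_mul_succ,
    (S.auxBeta_congr A₀ t₀ q 0 t).compTaylor (S.auxB_zero A₀ t₀ q t) _ 0 (by omega) j,
    co_compTaylor, zero_add, Finset.sum_eq_single j, Finset.sum_eq_single 0]
  · simp [auxIter, co, beta0, ← map_pow, PowerSeries.coeff_X_pow]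
  · intro s _ hs
    simp [hs]
  · simp
  · intro r _ hr
    refine Finset.sum_eq_zero fun s _ => ?_
    rcases Nat.eq_zero_or_pos s with rfl | hs
    · simp [auxIter, co, beta0, ← map_pow, PowerSeries.coeff_X_pow, hr.symm]
    · simp [hs.ne']
  · simp

/-- Taylor expansion of `G` in the phase under the integral; the geometric bounds justify the
interchange by dominated convergence. -/
theorem TorusBound.hasSum_bifCoeff_zero (h : S.TorusBound A₀ p q N) {b : ℝ}
    (hb : |b| < 1 / (N : ℝ)) :
    HasSum (fun j => S.bifCoeff A₀ t₀ q 0 j * b ^ j)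
      (meanOver (2 * Real.pi * q) fun t => S.G (S.ω A₀ * t + b) A₀ (t + t₀)) := by
  have hreg := fun r s => regular_taylorCoeff t₀ h.mem_W h.freq_mul_period rfl S.analytic_G
    S.periodic_G_α S.periodic_G_t r s
  have hNb : (N : ℝ) * |b| < 1 := by
    rw [mul_comm]; exact (lt_div_iff₀ h.cast_pos).1 hb
  have hsumb : Summable fun n : ℕ => (N : ℝ) * (N * |b|) ^ n :=
    (summable_geometric_of_lt_one (by positivity) hNb).mul_left _
  have hpt : ∀ t, HasSum (fun j => taylorCoeff S.G (S.ω A₀ * t) A₀ (t + t₀) j 0 * b ^ j)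
      (S.G (S.ω A₀ * t + b) A₀ (t + t₀)) := by
    intro t
    have h1 := hasSum_taylorCoeff h.cast_pos S.isOpen_W S.analytic_G h.ball_subset h.taylor_G
      (S.ω A₀ * t) (t + t₀) hb (b := 0) (by simpa using h.cast_pos)
    rw [add_zero] at h1
    have h2 := h1.prod_fiberwise (g := fun j =>
      taylorCoeff S.G (S.ω A₀ * t) A₀ (t + t₀) j 0 * b ^ j) (fun j => by
        have := hasSum_single (f := fun s => taylorCoeff S.G (S.ω A₀ * t) A₀ (t + t₀) j s * b ^ j *
          (0 : ℝ) ^ s) 0 (fun s hs => by simp [hs])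
        simpa using this)
    exact h2
  have key := intervalIntegral.hasSum_integral_of_dominated_convergence (a := 0)
    (b := 2 * Real.pi * q) (μ := MeasureTheory.volume)
    (F := fun j t => taylorCoeff S.G (S.ω A₀ * t) A₀ (t + t₀) j 0 * b ^ j)
    (f := fun t => S.G (S.ω A₀ * t + b) A₀ (t + t₀))
    (fun n _ => (N : ℝ) * (N * |b|) ^ n)
    (fun n => (((hreg n 0).1.mul continuous_const).aestronglyMeasurable))
    (fun n => Filter.Eventually.of_forall fun t _ => by
      rw [norm_mul, norm_pow, Real.norm_eq_abs, Real.norm_eq_abs]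
      have := h.taylor_G (S.ω A₀ * t) (t + t₀) n 0
      calc _ ≤ (N : ℝ) ^ (n + 0 + 1) * |b| ^ n := by gcongr
        _ = _ := by rw [mul_pow]; ring)
    (Filter.Eventually.of_forall fun _ _ => hsumb) (by simp)
    (Filter.Eventually.of_forall fun t _ => hpt t)
  have := key.mul_left (2 * Real.pi * q)⁻¹
  refine this.congr_fun fun j => ?_
  rw [bifCoeff_zero, meanOver, intervalIntegral.integral_mul_const]
  ring

/-- The substitution `t ↦ t - τ` trades a shift of the initial time for a shift of the phase, and
periodicity moves the interval of integration back to `[0, T]`. -/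
theorem TorusBound.melnikov_add (h : S.TorusBound A₀ p q N) (τ : ℝ) :
    S.melnikov A₀ q (t₀ + τ) =
      meanOver (2 * Real.pi * q) fun t => S.G (S.ω A₀ * t + -S.ω A₀ * τ) A₀ (t + t₀) := by
  set f : ℝ → ℝ := fun t => S.G (S.ω A₀ * t + -S.ω A₀ * τ) A₀ (t + t₀) with hf
  have hper : Function.Periodic f (2 * Real.pi * q) := by
    intro t
    have h1 : S.ω A₀ * (t + 2 * Real.pi * q) + -S.ω A₀ * τ =
        (S.ω A₀ * t + -S.ω A₀ * τ) + 2 * Real.pi * p := by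
      rw [mul_add, h.freq_mul_period]; ring
    have h2 : t + 2 * Real.pi * q + t₀ = t + t₀ + 2 * Real.pi * ((q : ℤ) : ℝ) := by
      push_cast; ring
    simp only [hf, h1, h2]
    exact periodic_int_mul S.periodic_G_α S.periodic_G_t p q _ _ h.mem_W
  have h1 : (fun t => S.G (S.ω A₀ * t) A₀ (t + (t₀ + τ))) = fun t => f (t + τ) := by
    funext t
    simp only [hf]
    congr 1 <;> ring
  rw [melnikov, h1, meanOver, meanOver, intervalIntegral.integral_comp_add_right]
  congr 1
  have := hper.intervalIntegral_add_eq τ 0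
  rw [zero_add, add_comm τ] at this
  rw [zero_add, this]

/-- A zero of order `n` of the Melnikov function gives a bifurcation function of order `n`. -/
theorem TorusBound.hasOrder_bifCoeff (h : S.TorusBound A₀ p q N) {n : ℕ}
    (hn : IsZeroOfOrder (S.melnikov A₀ q) t₀ n) : HasOrder (S.bifCoeff A₀ t₀ q) n := by
  set w := S.ω A₀ with hw
  have hr : 0 < 1 / ((N : ℝ) * (|w| + 1)) := by
    have := h.cast_pos
    positivity
  have hder := iteratedDeriv_eq_of_hasSum (g := S.melnikov A₀ q) (a := t₀) hr
    (c := fun j => S.bifCoeff A₀ t₀ q 0 j * (-w) ^ j) (fun x hx => by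
      rw [h.melnikov_add]
      have hb : |-w * x| < 1 / (N : ℝ) := by
        rw [abs_mul, abs_neg]
        have h0 := h.cast_pos
        rw [lt_div_iff₀ (by positivity)] at hx ⊢
        have h1 : |w| * |x| * N ≤ |x| * (N * (|w| + 1)) := by
          nlinarith [mul_nonneg (abs_nonneg x) h0.le]
        linarith
      refine (h.hasSum_bifCoeff_zero t₀ hb).congr_fun fun j => ?_
      rw [mul_pow, mul_assoc])
  -- For zero frequency the formula just obtained would make every derivative of positive order
  -- vanish, against the finite order `n ≥ 1` of the zero.
  have hw0 : -w ≠ 0 := by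
    intro h0
    apply hn.2.2
    rw [hder, h0, zero_pow (by have := hn.1; omega), mul_zero, mul_zero]
  refine ⟨fun h0 => hn.2.2 (by rw [hder, h0]; simp), fun j hj => ?_⟩
  have := hn.2.1 j hj
  rw [hder] at this
  have hf : (j.factorial : ℝ) ≠ 0 := by positivity
  rcases mul_eq_zero.1 this with h1 | h1
  · exact absurd h1 hf
  · exact (mul_eq_zero.1 h1).resolve_right (pow_ne_zero _ hw0)

end PerturbedSystem

/-! ### Weighted norms of series in `η`. -/

section PowerSeriesNorm

open PowerSeries
open scoped ENNReal NNReal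

/-- The weighted `ℓ¹` norm `∑ |b_n| r ^ n`. -/
noncomputable def psNorm (r : ℝ≥0∞) (b : PowerSeries ℝ) : ℝ≥0∞ := ∑' n, ‖coeff n b‖ₑ * r ^ n

variable {r : ℝ≥0∞}

theorem psNorm_add_le (a b : PowerSeries ℝ) : psNorm r (a + b) ≤ psNorm r a + psNorm r b := by
  rw [psNorm, psNorm, psNorm, ← ENNReal.tsum_add]
  refine ENNReal.tsum_le_tsum fun n => ?_
  rw [← add_mul, map_add]
  gcongr
  exact enorm_add_le _ _

theorem psNorm_mul_le (a b : PowerSeries ℝ) : psNorm r (a * b) ≤ psNorm r a * psNorm r b := by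
  rw [psNorm, psNorm, psNorm, ← ENNReal.tsum_antidiagonal_mul _ _ _ (fun x y => pow_add r x y)]
  refine ENNReal.tsum_le_tsum fun n => ?_
  gcongr
  rw [coeff_mul]
  refine (enorm_sum_le _ _).trans (Finset.sum_le_sum fun p _ => ?_)
  rw [enorm_mul]

theorem psNorm_monomial (n : ℕ) (c : ℝ) : psNorm r (monomial n c) = ‖c‖ₑ * r ^ n := by
  rw [psNorm, tsum_eq_single n]
  · rw [coeff_monomial_same]
  · intro m hm
    rw [coeff_monomial, if_neg hm, enorm_zero, zero_mul]

theorem psNorm_pow_le (b : PowerSeries ℝ) (n : ℕ) : psNorm r (b ^ n) ≤ psNorm r b ^ n := by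
  induction n with
  | zero =>
    have h1 : (1 : PowerSeries ℝ) = monomial 0 1 := by simp
    rw [pow_zero, pow_zero, h1, psNorm_monomial]
    simp
  | succ n ih =>
    rw [pow_succ, pow_succ]
    exact (psNorm_mul_le _ _).trans (mul_le_mul' ih le_rfl)

theorem psNorm_sum_le {ι : Type*} (s : Finset ι) (b : ι → PowerSeries ℝ) :
    psNorm r (∑ i ∈ s, b i) ≤ ∑ i ∈ s, psNorm r (b i) := by
  classical
  induction s using Finset.induction_on with
  | empty => simp [psNorm]
  | insert i s hi ih =>
    rw [Finset.sum_insert hi, Finset.sum_insert hi]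
    exact (psNorm_add_le _ _).trans (add_le_add le_rfl ih)

theorem psNorm_mono {r' : ℝ≥0∞} (h : r ≤ r') (b : PowerSeries ℝ) : psNorm r b ≤ psNorm r' b :=
  ENNReal.tsum_le_tsum fun n => by gcongr

theorem ENNReal.tsum_ite_le_sub (w : ℕ → ℝ≥0∞) (c : ℕ) :
    ∑' m, (if c ≤ m then w (m - c) else 0) = ∑' n, w n := by
  have hinj : Function.Injective (fun n : ℕ => n + c) := add_left_injective c
  rw [← hinj.tsum_eq (f := fun m => if c ≤ m then w (m - c) else 0)]
  · exact tsum_congr fun n => by simp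
  · intro m hm
    have : c ≤ m := by
      by_contra h
      exact hm (by simp [h])
    exact ⟨m - c, by simp; omega⟩

theorem PowerSeries.coeff_pow_eq_zero_of_lt {b : PowerSeries ℝ} (hb : coeff 0 b = 0) {n j : ℕ}
    (h : n < j) : coeff n (b ^ j) = 0 := by
  have h1 : (X : PowerSeries ℝ) ∣ b := by rw [X_dvd_iff]; simpa using hb
  exact X_pow_dvd_iff.1 (pow_dvd_pow_of_dvd h1 j) n h

/-- Since `|σ| = 1`, the majorant is the absolute double series of `f` at `(r ^ P, psNorm r b)`; the
conditional shift by `P * k` is a mere reindexing. -/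
theorem tsum_enorm_substPuiseux_le (σ : ℝ) (hσ : |σ| = 1) (P : ℕ) (f : ℕ → ℕ → ℝ)
    (b : PowerSeries ℝ) :
    psNorm r (substPuiseux σ P f b) ≤
      ∑' x : ℕ × ℕ, ‖f x.1 x.2‖ₑ * ((r ^ P) ^ x.1 * psNorm r b ^ x.2) := by
  have hσ' : ‖σ‖ₑ = 1 := by rw [← ofReal_norm, Real.norm_eq_abs, hσ, ENNReal.ofReal_one]
  have h1 : ∀ m, ‖coeff m (substPuiseux σ P f b)‖ₑ * r ^ m ≤ ∑' x : ℕ × ℕ,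
      (if P * x.1 ≤ m then ‖f x.1 x.2‖ₑ * (r ^ P) ^ x.1 *
        (‖coeff (m - P * x.1) (b ^ x.2)‖ₑ * r ^ (m - P * x.1)) else 0) := by
    intro m
    rw [substPuiseux, coeff_mk, ← Finset.sum_product']
    refine le_trans (mul_le_mul' (enorm_sum_le _ _) le_rfl) ?_
    rw [Finset.sum_mul]
    refine le_trans (Finset.sum_le_sum fun x _ => ?_)
      (ENNReal.sum_le_tsum (Finset.range (m + 1) ×ˢ Finset.range (m + 1)))
    split_ifs with h
    · rw [enorm_mul, enorm_mul, enorm_pow, hσ', one_pow, one_mul]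
      have : r ^ m = (r ^ P) ^ x.1 * r ^ (m - P * x.1) := by
        rw [← pow_mul, ← pow_add]; congr 1; omega
      rw [this]
      exact le_of_eq (by ring)
    · simp
  refine (ENNReal.tsum_le_tsum h1).trans ?_
  rw [ENNReal.tsum_comm]
  refine ENNReal.tsum_le_tsum fun x => ?_
  rw [ENNReal.tsum_ite_le_sub (fun n => ‖f x.1 x.2‖ₑ * (r ^ P) ^ x.1 *
    (‖coeff n (b ^ x.2)‖ₑ * r ^ n)), ENNReal.tsum_mul_left, mul_assoc]
  gcongr
  exact psNorm_pow_le _ _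

end PowerSeriesNorm

/-! ### The implicit series at a simple root. -/

section Implicit

open PowerSeries
open scoped ENNReal NNReal

variable {C : ℝ} {g : ℕ → ℕ → ℝ}

/-- The series whose truncations are `implicitTrunc`. -/
noncomputable def implicitSeries (C : ℝ) (g : ℕ → ℕ → ℝ) : PowerSeries ℝ :=
  PowerSeries.mk fun n => coeff n (implicitTrunc C g n)

theorem coeff_implicitTrunc_of_lt {n m : ℕ} (h : n < m) : coeff m (implicitTrunc C g n) = 0 := by
  induction n with
  | zero => simp [implicitTrunc]
  | succ n ih =>
    rw [implicitTrunc, map_add, ih (by omega), coeff_monomial, if_neg (by omega), add_zero]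

theorem coeff_implicitTrunc_of_le {n m : ℕ} (h : m ≤ n) :
    coeff m (implicitTrunc C g n) = coeff m (implicitSeries C g) := by
  induction n, h using Nat.le_induction with
  | base => rw [implicitSeries, coeff_mk]
  | succ n hn ih =>
    rw [implicitTrunc, map_add, ih, coeff_monomial, if_neg (by omega), add_zero]

theorem coeff_implicitSeries_succ (n : ℕ) : coeff (n + 1) (implicitSeries C g) =
    -(1 / C) * coeff (n + 1) (substPuiseux 1 1 g (implicitTrunc C g n)) := by
  rw [implicitSeries, coeff_mk, implicitTrunc, map_add, coeff_implicitTrunc_of_lt (by omega),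
    coeff_monomial_same, zero_add]

theorem coeff_zero_implicitTrunc (n : ℕ) : coeff 0 (implicitTrunc C g n) = 0 := by
  induction n with
  | zero => simp [implicitTrunc]
  | succ n ih => rw [implicitTrunc, map_add, ih, coeff_monomial, if_neg (by omega), add_zero]

theorem coeff_zero_implicitSeries : coeff 0 (implicitSeries C g) = 0 := by
  rw [← coeff_implicitTrunc_of_le (le_refl 0), coeff_zero_implicitTrunc]

theorem X_pow_dvd_implicitSeries_sub (n : ℕ) :
    (X : PowerSeries ℝ) ^ (n + 1) ∣ implicitSeries C g - implicitTrunc C g n := by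
  rw [X_pow_dvd_iff]
  intro m hm
  rw [map_sub, coeff_implicitTrunc_of_le (by omega), sub_self]

theorem X_pow_dvd_implicitTrunc_sub {m n : ℕ} (h : m ≤ n) :
    (X : PowerSeries ℝ) ^ (m + 1) ∣ implicitTrunc C g n - implicitTrunc C g m := by
  rw [X_pow_dvd_iff]
  intro i hi
  rw [map_sub, coeff_implicitTrunc_of_le (by omega), coeff_implicitTrunc_of_le (by omega), sub_self]

/-- All terms except the linear one gain an order. -/
theorem coeff_pow_congr {b b' : PowerSeries ℝ} (hb : coeff 0 b = 0) (hb' : coeff 0 b' = 0)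
    {m : ℕ} (h : (X : PowerSeries ℝ) ^ (m + 1) ∣ b - b') {k j : ℕ} (hkj : ¬ (k = 0 ∧ j = 1))
    (hk : k ≤ m + 1) : coeff (m + 1 - k) (b ^ j) = coeff (m + 1 - k) (b' ^ j) := by
  rw [← sub_eq_zero, ← map_sub]
  rcases Nat.eq_zero_or_pos k with rfl | hk0
  · rcases Nat.lt_or_ge j 2 with hj | hj
    · have : j = 0 := by omega
      subst this
      simp
    · obtain ⟨j, rfl⟩ : ∃ i, j = i + 2 := ⟨j - 2, by omega⟩
      have hX : (X : PowerSeries ℝ) ∣ b := by rw [X_dvd_iff]; simpa using hb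
      have hX' : (X : PowerSeries ℝ) ∣ b' := by rw [X_dvd_iff]; simpa using hb'
      have e : b ^ (j + 2) - b' ^ (j + 2) =
        (b - b') * b ^ (j + 1) + (b ^ (j + 1) - b' ^ (j + 1)) * b' := by ring
      have hd : (X : PowerSeries ℝ) ^ (m + 1 + 1) ∣ b ^ (j + 2) - b' ^ (j + 2) := by
        rw [e, pow_succ]
        exact dvd_add (mul_dvd_mul h (dvd_pow hX (by omega)))
          (mul_dvd_mul (h.trans (sub_dvd_pow_sub_pow _ _ _)) hX')
      exact X_pow_dvd_iff.1 hd _ (by omega)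
  · exact X_pow_dvd_iff.1 (h.trans (sub_dvd_pow_sub_pow b b' j)) _ (by omega)

theorem coeff_substPuiseux_one (f : ℕ → ℕ → ℝ) (b : PowerSeries ℝ) (m : ℕ) :
    coeff m (substPuiseux 1 1 f b) = ∑ k ∈ Finset.range (m + 1), ∑ j ∈ Finset.range (m + 1),
      f k j * coeff (m - k) (b ^ j) := by
  rw [substPuiseux, coeff_mk]
  refine Finset.sum_congr rfl fun k hk => Finset.sum_congr rfl fun j _ => ?_
  rw [if_pos (by rw [Finset.mem_range] at hk; omega), one_pow, one_mul, one_mul]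

/-- The implicit series solves its equation. -/
theorem substPuiseux_implicitSeries (hC : C ≠ 0) (h00 : g 0 0 = 0) (h01 : g 0 1 = C) :
    substPuiseux 1 1 g (implicitSeries C g) = 0 := by
  ext m
  rw [map_zero]
  rcases m with _ | m
  · simp [coeff_substPuiseux_one, h00]
  -- Passing from the truncation to the full series alters the coefficient of order `m + 1` only
  -- through the linear term `C y`. The recursion chooses `y_{m+1}` so as to cancel the rest.
  · have h1 : coeff (m + 1) (substPuiseux 1 1 g (implicitSeries C g)) =
        coeff (m + 1) (substPuiseux 1 1 g (implicitTrunc C g m)) +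
          C * coeff (m + 1) (implicitSeries C g) := by
      rw [coeff_substPuiseux_one, coeff_substPuiseux_one, ← sub_eq_iff_eq_add',
        ← Finset.sum_sub_distrib, Finset.sum_eq_single 0, ← Finset.sum_sub_distrib,
        Finset.sum_eq_single 1]
      · rw [pow_one, pow_one, Nat.sub_zero, coeff_implicitTrunc_of_lt (Nat.lt_succ_self m), h01]
        ring
      · intro j _ hj
        rw [coeff_pow_congr coeff_zero_implicitSeries (coeff_zero_implicitTrunc m)
          (X_pow_dvd_implicitSeries_sub m) (by omega) (by omega), sub_self]
      · intro h; simp at h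
      · intro k hk hk0
        rw [Finset.mem_range] at hk
        rw [← Finset.sum_sub_distrib]
        refine Finset.sum_eq_zero fun j _ => ?_
        rw [coeff_pow_congr coeff_zero_implicitSeries (coeff_zero_implicitTrunc m)
          (X_pow_dvd_implicitSeries_sub m) (by omega) (by omega), sub_self]
      · intro h; simp at h
    rw [h1, coeff_implicitSeries_succ]
    field_simp
    ring

/-- The series without its terms of degree at most one in `y` at order zero. -/
noncomputable def dropLinear (g : ℕ → ℕ → ℝ) (k j : ℕ) : ℝ := if k = 0 ∧ j ≤ 1 then 0 else g k j

/-- Recasts the coefficientwise recursion as the fixed-point iteration `y ↦ -C⁻¹ (g(η, y) - C y)` up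
to order `n + 1`, whose right-hand side has no linear term in `y` at `η = 0` and so can be estimated
in norm. -/
theorem coeff_implicitTrunc_succ (h00 : g 0 0 = 0) {m n : ℕ} (hmn : m ≤ n) :
    coeff (m + 1) (implicitTrunc C g (n + 1)) =
      -(1 / C) * coeff (m + 1) (substPuiseux 1 1 (dropLinear g) (implicitTrunc C g n)) := by
  rw [coeff_implicitTrunc_of_le (by omega), coeff_implicitSeries_succ]
  congr 1
  rw [coeff_substPuiseux_one, coeff_substPuiseux_one]
  refine Finset.sum_congr rfl fun k hk => Finset.sum_congr rfl fun j _ => ?_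
  rw [Finset.mem_range] at hk
  by_cases h : k = 0 ∧ j = 1
  · obtain ⟨rfl, rfl⟩ := h
    rw [dropLinear, if_pos (by omega), pow_one, Nat.sub_zero,
      coeff_implicitTrunc_of_lt (Nat.lt_succ_self m)]
    ring
  · rw [coeff_pow_congr (coeff_zero_implicitTrunc m) (coeff_zero_implicitTrunc n)
      (by rw [dvd_sub_comm]; exact X_pow_dvd_implicitTrunc_sub hmn) h (by omega)]
    rw [dropLinear]
    split_ifs with h'
    · have hj : j = 0 := by omega
      rw [h'.1, hj, h00]
    · rfl

theorem psNorm_implicitTrunc_succ_le (r : ℝ≥0∞) (h00 : g 0 0 = 0) (n : ℕ) :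
    psNorm r (implicitTrunc C g (n + 1)) ≤
      ‖C⁻¹‖ₑ * psNorm r (substPuiseux 1 1 (dropLinear g) (implicitTrunc C g n)) := by
  rw [psNorm, psNorm, ← ENNReal.tsum_mul_left]
  refine ENNReal.tsum_le_tsum fun m => ?_
  rcases m with _ | m
  · rw [coeff_zero_implicitTrunc]; simp
  · rcases Nat.lt_or_ge n m with h | h
    · rw [coeff_implicitTrunc_of_lt (by omega)]; simp
    · rw [coeff_implicitTrunc_succ h00 h, enorm_mul, enorm_neg, one_div, mul_assoc]

/-- The bound of the norm of the implicit series. -/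
noncomputable def implicitBound (N K : ℕ) : ℝ≥0 := (32 * N * (K : ℝ≥0) ^ 3)⁻¹

/-- The radius of convergence of the implicit series. -/
noncomputable def implicitRadius (N K : ℕ) : ℝ≥0 := (512 * (N : ℝ≥0) ^ 2 * (K : ℝ≥0) ^ 5)⁻¹

theorem ENNReal.natCast_mul_coe_le_two_inv {K : ℕ} {x : ℝ≥0} (h : (K : ℝ≥0) * x ≤ 2⁻¹) :
    (K : ℝ≥0∞) * x ≤ 2⁻¹ := by
  calc (K : ℝ≥0∞) * x = (((K : ℝ≥0) * x : ℝ≥0) : ℝ≥0∞) := by push_cast; rfl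
    _ ≤ ((2⁻¹ : ℝ≥0) : ℝ≥0∞) := ENNReal.coe_le_coe.2 h
    _ = 2⁻¹ := by rw [ENNReal.coe_inv (by norm_num)]; norm_num

theorem natCast_mul_implicitRadius_le {N K : ℕ} (hN : 1 ≤ N) (hK : 1 ≤ K) :
    (K : ℝ≥0) * implicitRadius N K ≤ 2⁻¹ := by
  have hn1 : (1 : ℝ≥0) ≤ N := by exact_mod_cast hN
  have hk1 : (1 : ℝ≥0) ≤ K := by exact_mod_cast hK
  have hn0 : (N : ℝ≥0) ≠ 0 := by positivity
  have hk0 : (K : ℝ≥0) ≠ 0 := by positivity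
  have e : (K : ℝ≥0) * implicitRadius N K = (512 * (N : ℝ≥0) ^ 2 * (K : ℝ≥0) ^ 4)⁻¹ := by
    rw [implicitRadius]; field_simp
  rw [e]
  refine inv_anti₀ (by norm_num) ?_
  calc (2 : ℝ≥0) ≤ 512 * 1 * 1 := by norm_num
    _ ≤ _ := by gcongr <;> exact one_le_pow₀ (by assumption)

theorem natCast_mul_implicitBound_le {N K : ℕ} (hN : 1 ≤ N) (hK : 1 ≤ K) :
    (K : ℝ≥0) * implicitBound N K ≤ 2⁻¹ := by
  have hn1 : (1 : ℝ≥0) ≤ N := by exact_mod_cast hN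
  have hk1 : (1 : ℝ≥0) ≤ K := by exact_mod_cast hK
  have hn0 : (N : ℝ≥0) ≠ 0 := by positivity
  have hk0 : (K : ℝ≥0) ≠ 0 := by positivity
  have e : (K : ℝ≥0) * implicitBound N K = (32 * (N : ℝ≥0) * (K : ℝ≥0) ^ 2)⁻¹ := by
    rw [implicitBound]; field_simp
  rw [e]
  refine inv_anti₀ (by norm_num) ?_
  calc (2 : ℝ≥0) ≤ 32 * 1 * 1 := by norm_num
    _ ≤ _ := by gcongr; exact one_le_pow₀ (by assumption)

/-- Every remaining term contains either a factor `η`, of size `r`, or the square of `y`, of size `τ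
^ 2`; what is left over is a double geometric series of ratio `1/2`. -/
theorem tsum_dropLinear_le {K : ℕ} {r τ : ℝ≥0∞} (hg : GeomBound K g) (hr : K * r ≤ 2⁻¹)
    (hτ : K * τ ≤ 2⁻¹) :
    ∑' x : ℕ × ℕ, ‖dropLinear g x.1 x.2‖ₑ * ((r ^ 1) ^ x.1 * τ ^ x.2) ≤
      8 * K ^ 2 * r + 16 * K ^ 3 * τ ^ 2 := by
  have e : (8 : ℝ≥0∞) * K ^ 2 * r + 16 * K ^ 3 * τ ^ 2 =
      4 * (K * (2 * (K * r) + 4 * (K * τ) ^ 2)) := by ring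
  have h2 : (2 : ℝ≥0∞) * 2⁻¹ = 1 := ENNReal.mul_inv_cancel (by norm_num) (by norm_num)
  rw [e, ← PerturbedSystem.tsum_two_inv_pow_prod]
  refine ENNReal.tsum_le_tsum fun ⟨k, j⟩ => ?_
  simp only [pow_one]
  have hgk : ‖g k j‖ₑ * (r ^ k * τ ^ j) ≤ K * ((K * r) ^ k * (K * τ) ^ j) := by
    calc ‖g k j‖ₑ * (r ^ k * τ ^ j) ≤ (K : ℝ≥0∞) ^ (k + j + 1) * (r ^ k * τ ^ j) :=
          mul_le_mul' (PerturbedSystem.enorm_le_natCast_pow (hg k j)) le_rfl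
      _ = _ := by rw [mul_pow, mul_pow]; ring
  rw [dropLinear]
  split_ifs with h
  · simp
  · refine hgk.trans ?_
    rw [mul_assoc]
    refine mul_le_mul' le_rfl ?_
    rcases k with _ | k
    · obtain ⟨j, rfl⟩ : ∃ i, j = i + 2 := ⟨j - 2, by omega⟩
      calc ((K : ℝ≥0∞) * r) ^ 0 * (K * τ) ^ (j + 2)
          = (K * τ) ^ 2 * (K * τ) ^ j := by ring
        _ ≤ (K * τ) ^ 2 * 2⁻¹ ^ j := by gcongr
        _ = (2 * 2⁻¹) ^ 2 * ((K * τ) ^ 2 * 2⁻¹ ^ j) := by rw [h2]; ring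
        _ = (4 * (K * τ) ^ 2) * (2⁻¹ ^ 0 * 2⁻¹ ^ (j + 2)) := by ring
        _ ≤ _ := by gcongr; exact le_add_self
    · calc ((K : ℝ≥0∞) * r) ^ (k + 1) * (K * τ) ^ j
          = (K * r) * (K * r) ^ k * (K * τ) ^ j := by ring
        _ ≤ (K * r) * 2⁻¹ ^ k * 2⁻¹ ^ j := by gcongr
        _ = (2 * 2⁻¹) * ((K * r) * 2⁻¹ ^ k * 2⁻¹ ^ j) := by rw [h2, one_mul]
        _ = (2 * (K * r)) * (2⁻¹ ^ (k + 1) * 2⁻¹ ^ j) := by ring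
        _ ≤ _ := by gcongr; exact le_self_add

/-- The values `τ = 1/(32 N K³)` and `r = 1/(512 N² K⁵)` are chosen so that `N * 8K²r` and `N *
16K³τ²` both equal `τ / 2`; hence the iteration keeps the ball of radius `τ` invariant. -/
theorem psNorm_implicitTrunc_le {N K : ℕ} (hN : 1 ≤ N) (hK : 1 ≤ K) (hg : GeomBound K g)
    (h00 : g 0 0 = 0) (hC : 1 ≤ N * |C|) (n : ℕ) :
    psNorm (implicitRadius N K) (implicitTrunc C g n) ≤ implicitBound N K := by
  have hn0 : (N : ℝ≥0) ≠ 0 := by exact_mod_cast (by omega : N ≠ 0)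
  have hk0 : (K : ℝ≥0) ≠ 0 := by exact_mod_cast (by omega : K ≠ 0)
  have hr := ENNReal.natCast_mul_coe_le_two_inv (natCast_mul_implicitRadius_le hN hK)
  have hτ := ENNReal.natCast_mul_coe_le_two_inv (natCast_mul_implicitBound_le hN hK)
  have hC' : ‖C⁻¹‖ₑ ≤ (N : ℝ≥0∞) := by
    have hC0 : C ≠ 0 := by rintro rfl; norm_num at hC
    rw [← ofReal_norm, norm_inv, Real.norm_eq_abs, ← ENNReal.ofReal_natCast]
    refine ENNReal.ofReal_le_ofReal ?_
    rw [inv_le_iff_one_le_mul₀ (abs_pos.2 hC0)]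
    exact hC
  induction n with
  | zero => simp [implicitTrunc, psNorm]
  | succ n ih =>
    refine (psNorm_implicitTrunc_succ_le _ h00 n).trans ?_
    calc _ ≤ (N : ℝ≥0∞) * (∑' x : ℕ × ℕ, ‖dropLinear g x.1 x.2‖ₑ *
          (((implicitRadius N K : ℝ≥0∞) ^ 1) ^ x.1 * (implicitBound N K : ℝ≥0∞) ^ x.2)) := by
          refine mul_le_mul' hC' ((tsum_enorm_substPuiseux_le 1 (by simp) 1 _ _).trans ?_)
          gcongr
      _ ≤ N * (8 * K ^ 2 * implicitRadius N K + 16 * K ^ 3 * (implicitBound N K : ℝ≥0∞) ^ 2) := by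
          gcongr
          exact tsum_dropLinear_le hg hr hτ
      _ ≤ implicitBound N K := by
          have : (N : ℝ≥0) * (8 * K ^ 2 * implicitRadius N K + 16 * K ^ 3 *
              implicitBound N K ^ 2) = implicitBound N K := by
            rw [implicitRadius, implicitBound]
            field_simp
            norm_num
          exact_mod_cast this.le

theorem psNorm_implicitSeries_le {N K : ℕ} (hN : 1 ≤ N) (hK : 1 ≤ K) (hg : GeomBound K g)
    (h00 : g 0 0 = 0) (hC : 1 ≤ N * |C|) :
    psNorm (implicitRadius N K) (implicitSeries C g) ≤ implicitBound N K := by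
  refine ENNReal.tsum_le_of_sum_range_le fun n => ?_
  refine le_trans ?_ (psNorm_implicitTrunc_le hN hK hg h00 hC n)
  refine le_trans (Finset.sum_le_sum fun m hm => ?_) (ENNReal.sum_le_tsum (Finset.range n))
  rw [coeff_implicitTrunc_of_le (Finset.mem_range.1 hm).le]

end Implicit

/-! ### Evaluation of convergent series. -/

section Evaluation

open PowerSeries
open scoped ENNReal NNReal

/-- The sum of a power series in one variable. -/
noncomputable def psEval (b : PowerSeries ℝ) (η : ℝ) : ℝ := ∑' n, coeff n b * η ^ n

variable {r : ℝ≥0∞} {η : ℝ}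

theorem summable_norm_of_psNorm {b : PowerSeries ℝ} (hb : psNorm r b ≠ ⊤) (hη : ‖η‖ₑ ≤ r) :
    Summable fun n => ‖coeff n b * η ^ n‖ := by
  rw [← tsum_enorm_ne_top_iff_summable_norm]
  refine ne_top_of_le_ne_top hb (ENNReal.tsum_le_tsum fun n => ?_)
  rw [enorm_mul, enorm_pow]
  gcongr

theorem psNorm_pow_ne_top {b : PowerSeries ℝ} (hb : psNorm r b ≠ ⊤) (n : ℕ) :
    psNorm r (b ^ n) ≠ ⊤ :=
  ne_top_of_le_ne_top (ENNReal.pow_ne_top hb) (psNorm_pow_le b n)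

theorem psEval_mul {a b : PowerSeries ℝ} (ha : psNorm r a ≠ ⊤) (hb : psNorm r b ≠ ⊤)
    (hη : ‖η‖ₑ ≤ r) : psEval (a * b) η = psEval a η * psEval b η := by
  rw [psEval, psEval, psEval, ← Real.tsum_antidiagonal_mul _ _ _ (fun x y => pow_add η x y)
    (summable_norm_of_psNorm ha hη) (summable_norm_of_psNorm hb hη)]
  simp_rw [coeff_mul]

theorem psEval_monomial (n : ℕ) (c : ℝ) : psEval (monomial n c) η = c * η ^ n := by
  rw [psEval, tsum_eq_single n]
  · rw [coeff_monomial_same]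
  · intro m hm
    rw [coeff_monomial, if_neg hm, zero_mul]

theorem psEval_pow {b : PowerSeries ℝ} (hb : psNorm r b ≠ ⊤) (hη : ‖η‖ₑ ≤ r) (n : ℕ) :
    psEval (b ^ n) η = psEval b η ^ n := by
  induction n with
  | zero =>
    have h1 : (1 : PowerSeries ℝ) = monomial 0 1 := by simp
    rw [pow_zero, pow_zero, h1, psEval_monomial]
    simp
  | succ n ih => rw [pow_succ, pow_succ, psEval_mul (psNorm_pow_ne_top hb n) hb hη, ih]

theorem psEval_add {a b : PowerSeries ℝ} (ha : psNorm r a ≠ ⊤) (hb : psNorm r b ≠ ⊤)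
    (hη : ‖η‖ₑ ≤ r) : psEval (a + b) η = psEval a η + psEval b η := by
  rw [psEval, psEval, psEval, ← (summable_norm_of_psNorm ha hη).of_norm.tsum_add
    (summable_norm_of_psNorm hb hη).of_norm]
  simp_rw [map_add, add_mul]

theorem psNorm_monomial_ne_top (hr : r ≠ ⊤) (n : ℕ) (c : ℝ) : psNorm r (monomial n c) ≠ ⊤ := by
  rw [psNorm_monomial]
  exact ENNReal.mul_ne_top enorm_ne_top (ENNReal.pow_ne_top hr)

theorem psEval_sum_monomial (hr : r ≠ ⊤) (hη : ‖η‖ₑ ≤ r) {ι : Type*} (s : Finset ι) (e : ι → ℕ)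
    (c : ι → ℝ) : psNorm r (∑ i ∈ s, monomial (e i) (c i)) ≠ ⊤ ∧
      psEval (∑ i ∈ s, monomial (e i) (c i)) η = ∑ i ∈ s, c i * η ^ e i := by
  classical
  induction s using Finset.induction_on with
  | empty => simp [psNorm, psEval]
  | insert i s hi ih =>
    rw [Finset.sum_insert hi, Finset.sum_insert hi]
    refine ⟨ne_top_of_le_ne_top (ENNReal.add_ne_top.2 ⟨psNorm_monomial_ne_top hr _ _, ih.1⟩)
      (psNorm_add_le _ _), ?_⟩
    rw [psEval_add (psNorm_monomial_ne_top hr _ _) ih.1 hη, psEval_monomial, ih.2]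

theorem abs_psEval_le {b : PowerSeries ℝ} {C r : ℝ≥0} (hb : psNorm r b ≤ C) (hη : ‖η‖ₑ ≤ r) :
    |psEval b η| ≤ C := by
  have h1 : ‖psEval b η‖ₑ ≤ C := by
    refine le_trans (enorm_tsum_le_tsum_enorm ) (le_trans (ENNReal.tsum_le_tsum fun n => ?_) hb)
    rw [enorm_mul, enorm_pow]
    gcongr
  rw [enorm_eq_nnnorm, ENNReal.coe_le_coe] at h1
  exact_mod_cast h1

/-- The sum of a power series in two variables. -/
noncomputable def eval2 (f : ℕ → ℕ → ℝ) (x y : ℝ) : ℝ :=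
  ∑' z : ℕ × ℕ, f z.1 z.2 * (x ^ z.1 * y ^ z.2)

/-- Substitution of a Puiseux series commutes with evaluation. -/
theorem hasSum_substPuiseux {σ : ℝ} (hσ : |σ| = 1) {P : ℕ} (hP : 0 < P) {f : ℕ → ℕ → ℝ}
    {b : PowerSeries ℝ} (hb0 : coeff 0 b = 0) (hb : psNorm r b ≠ ⊤)
    (hf : ∑' x : ℕ × ℕ, ‖f x.1 x.2‖ₑ * ((r ^ P) ^ x.1 * psNorm r b ^ x.2) ≠ ⊤)
    (hη : ‖η‖ₑ ≤ r) :
    HasSum (fun m => coeff m (substPuiseux σ P f b) * η ^ m)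
      (eval2 f (σ * η ^ P) (psEval b η)) := by
  have hσ' : ‖σ‖ₑ = 1 := by rw [← ofReal_norm, Real.norm_eq_abs, hσ, ENNReal.ofReal_one]
  -- An absolutely summable array indexed by `((k, j), m)`: summing over `m` first gives the value
  -- of `f` at the substituted point, summing over `(k, j)` first gives the coefficient of `η ^ m`.
  obtain ⟨A, hA⟩ : ∃ A : (ℕ × ℕ) × ℕ → ℝ, A = fun z => if P * z.1.1 ≤ z.2 then
    (f z.1.1 z.1.2 * (σ * η ^ P) ^ z.1.1) *
      (coeff (z.2 - P * z.1.1) (b ^ z.1.2) * η ^ (z.2 - P * z.1.1)) else 0 := ⟨_, rfl⟩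
  have hAs : Summable A := by
    refine Summable.of_enorm (ne_top_of_le_ne_top hf ?_)
    rw [ENNReal.tsum_prod']
    refine ENNReal.tsum_le_tsum fun x => ?_
    have h1 : ∀ m, ‖A (x, m)‖ₑ ≤ if P * x.1 ≤ m then ‖f x.1 x.2‖ₑ * (r ^ P) ^ x.1 *
        (‖coeff (m - P * x.1) (b ^ x.2)‖ₑ * r ^ (m - P * x.1)) else 0 := by
      intro m
      simp only [hA]
      split_ifs
      · rw [enorm_mul, enorm_mul, enorm_mul, enorm_pow, enorm_pow, enorm_mul, enorm_pow, hσ',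
          one_mul]
        gcongr
      · simp
    refine (ENNReal.tsum_le_tsum h1).trans ?_
    rw [ENNReal.tsum_ite_le_sub (fun n => ‖f x.1 x.2‖ₑ * (r ^ P) ^ x.1 *
      (‖coeff n (b ^ x.2)‖ₑ * r ^ n)), ENNReal.tsum_mul_left, mul_assoc]
    gcongr
    exact psNorm_pow_le _ _
  have h1 : ∀ x : ℕ × ℕ, HasSum (fun m => A (x, m))
      (f x.1 x.2 * ((σ * η ^ P) ^ x.1 * psEval b η ^ x.2)) := by
    intro x
    have hinj : Function.Injective (fun n : ℕ => n + P * x.1) := add_left_injective _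
    rw [← hinj.hasSum_iff]
    · have h2 := (summable_norm_of_psNorm (psNorm_pow_ne_top hb x.2) hη).of_norm.hasSum
      have h3 := h2.mul_left (f x.1 x.2 * (σ * η ^ P) ^ x.1)
      have h4 : ∑' n, coeff n (b ^ x.2) * η ^ n = psEval b η ^ x.2 := by
        rw [← psEval_pow hb hη]; rfl
      rw [h4, mul_assoc] at h3
      refine h3.congr_fun fun n => ?_
      simp [hA]
    · intro m hm
      simp only [hA]
      rw [if_neg]
      intro hle
      exact hm ⟨m - P * x.1, by simp; omega⟩
  have h2 : ∀ m, HasSum (fun x => A (x, m)) (coeff m (substPuiseux σ P f b) * η ^ m) := by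
    intro m
    have hfin : coeff m (substPuiseux σ P f b) * η ^ m =
        ∑ x ∈ Finset.range (m + 1) ×ˢ Finset.range (m + 1), A (x, m) := by
      rw [substPuiseux, coeff_mk, ← Finset.sum_product', Finset.sum_mul]
      refine Finset.sum_congr rfl fun x _ => ?_
      simp only [hA]
      split_ifs with h
      · have : η ^ m = (η ^ P) ^ x.1 * η ^ (m - P * x.1) := by
          rw [← pow_mul, ← pow_add]; congr 1; omega
        rw [this, mul_pow]; ring
      · simp
    rw [hfin]
    refine hasSum_sum_of_ne_finset_zero fun x hx => ?_
    simp only [hA]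
    split_ifs with h
    -- As `b` has no constant term, terms with `j > m` vanish, while `k > m` contradicts `P * k ≤
    -- m`; the finite sum in `substPuiseux` is thus complete.
    · rw [coeff_pow_eq_zero_of_lt hb0, zero_mul, mul_zero]
      simp only [Finset.mem_product, Finset.mem_range, not_and_or] at hx
      have := Nat.le_mul_of_pos_left x.1 hP
      omega
    · rfl
  have h3 := hAs.hasSum
  have h4 : ∑' z, A z = eval2 f (σ * η ^ P) (psEval b η) :=
    (h3.prod_fiberwise h1).tsum_eq.symm
  have h5 : HasSum (fun z : ℕ × (ℕ × ℕ) => A (z.2, z.1)) (∑' z, A z) :=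
    (Equiv.prodComm ℕ (ℕ × ℕ)).hasSum_iff.2 h3
  rw [← h4]
  exact h5.prod_fiberwise h2

/-- One step of the Newton-Puiseux process, evaluated. -/
theorem NPChoice.pow_mul_eval2_next {d : NPChoice} {f : ℕ → ℕ → ℝ} {σ K N ξ z : ℝ}
    (hf : GeomBound K f) (hK : 0 ≤ K) (hN : 1 ≤ N) (hσ : |σ| = 1) (hp : 0 < d.p) (hh : 0 < d.h)
    (hs : ∀ k j, f k j ≠ 0 → d.s ≤ d.p * k + d.h * j) (hc : |d.c| ≤ N) (hξ : 0 ≤ ξ)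
    (hξ1 : ξ ≤ 1) (hKξ : K * (ξ * (N + 1)) ≤ 1 / 2) (hz : |z| ≤ 1) :
    ξ ^ d.s * eval2 (d.next σ f) ξ z = eval2 f (σ * ξ ^ d.p) (ξ ^ d.h * (d.c + z)) := by
  set a : (ℕ × ℕ) × ℕ → ℝ := fun u => σ ^ u.1.1 * f u.1.1 u.1.2 * (u.1.2.choose u.2 : ℝ) *
    d.c ^ (u.1.2 - u.2) * ξ ^ (d.p * u.1.1 + d.h * u.1.2) * z ^ u.2 with ha
  have hsupp : ∀ (x : ℕ × ℕ) (l : ℕ), l ∉ Finset.range (x.2 + 1) → a (x, l) = 0 := by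
    intro x l hl
    simp only [ha]
    rw [Nat.choose_eq_zero_of_lt (by simpa using hl)]
    simp
  have hinner : ∀ x : ℕ × ℕ, HasSum (fun l => a (x, l))
      (f x.1 x.2 * ((σ * ξ ^ d.p) ^ x.1 * (ξ ^ d.h * (d.c + z)) ^ x.2)) := by
    intro x
    have h1 := hasSum_sum_of_ne_finset_zero (f := fun l => a (x, l))
      (L := SummationFilter.unconditional ℕ) (hsupp x)
    convert h1 using 1
    rw [mul_pow _ (d.c + z), add_comm d.c z, add_pow, mul_pow, Finset.mul_sum, Finset.mul_sum,
      Finset.mul_sum]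
    refine Finset.sum_congr rfl fun l _ => ?_
    simp only [ha]
    rw [pow_add, pow_mul, pow_mul]
    ring
  -- The binomial sum over `l` is at most `(1 + N) ^ j`, and smallness of `K ξ (N + 1)` turns the
  -- rest into a geometric series of ratio `1/2`.
  have habs : ∀ x : ℕ × ℕ, ∑' l, |a (x, l)| ≤ K * ((1 / 2) ^ x.1 * (1 / 2) ^ x.2) := by
    intro x
    have hfin : ∑' l, |a (x, l)| = ∑ l ∈ Finset.range (x.2 + 1), |a (x, l)| :=
      tsum_eq_sum fun l hl => by rw [hsupp x l hl, abs_zero]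
    rw [hfin]
    have hterm : ∀ l ∈ Finset.range (x.2 + 1), |a (x, l)| ≤
        K ^ (x.1 + x.2 + 1) * ξ ^ (x.1 + x.2) *
          ((1 : ℝ) ^ l * N ^ (x.2 - l) * (x.2.choose l : ℝ)) := by
      intro l _
      simp only [ha]
      rw [abs_mul, abs_mul, abs_mul, abs_mul, abs_mul, abs_pow, abs_pow, abs_pow, abs_pow, hσ,
        one_pow, one_mul, Nat.abs_cast, abs_of_nonneg hξ]
      have h1 : ξ ^ (d.p * x.1 + d.h * x.2) ≤ ξ ^ (x.1 + x.2) :=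
        pow_le_pow_of_le_one hξ hξ1 (add_le_add (Nat.le_mul_of_pos_left _ hp)
          (Nat.le_mul_of_pos_left _ hh))
      have h2 : |z| ^ l ≤ 1 ^ l := by gcongr
      calc |f x.1 x.2| * (x.2.choose l : ℝ) * |d.c| ^ (x.2 - l) *
            ξ ^ (d.p * x.1 + d.h * x.2) * |z| ^ l
          ≤ K ^ (x.1 + x.2 + 1) * (x.2.choose l : ℝ) * N ^ (x.2 - l) *
            ξ ^ (x.1 + x.2) * 1 ^ l := by
            gcongr
            exact hf _ _
        _ = _ := by ring
    refine (Finset.sum_le_sum hterm).trans ?_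
    rw [← Finset.mul_sum, ← add_pow]
    have hKξ' : K * ξ ≤ 1 / 2 := by
      refine le_trans ?_ hKξ
      gcongr
      nlinarith
    calc K ^ (x.1 + x.2 + 1) * ξ ^ (x.1 + x.2) * (1 + N) ^ x.2
        = K * ((K * ξ) ^ x.1 * (K * (ξ * (N + 1))) ^ x.2) := by
          rw [mul_pow, mul_pow, mul_pow]; ring
      _ ≤ _ := by gcongr
  have hsum : Summable a := by
    rw [← summable_abs_iff]
    rw [summable_prod_of_nonneg (fun _ => abs_nonneg _)]
    refine ⟨fun x => (hasSum_sum_of_ne_finset_zero (f := fun l => |a (x, l)|)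
      (s := Finset.range (x.2 + 1)) fun l hl => by rw [hsupp x l hl, abs_zero]).summable, ?_⟩
    have hg : Summable fun x : ℕ × ℕ => K * ((1 / 2 : ℝ) ^ x.1 * (1 / 2) ^ x.2) := by
      have h2 := summable_geometric_of_lt_one (r := (1 / 2 : ℝ)) (by norm_num) (by norm_num)
      exact (h2.mul_of_nonneg h2 (fun _ => by positivity) (fun _ => by positivity)).mul_left K
    exact Summable.of_nonneg_of_le (fun x => tsum_nonneg fun _ => abs_nonneg _) habs hg
  have hleft : HasSum a (eval2 f (σ * ξ ^ d.p) (ξ ^ d.h * (d.c + z))) := by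
    have := hsum.hasSum.prod_fiberwise hinner
    rw [eval2, this.tsum_eq]
    exact hsum.hasSum
  -- The added index records the power `p k + h j - s` of `η`, so that the array can be regrouped by
  -- powers of `η` and `y`. Wherever `f k j ≠ 0` the natural subtraction is exact, because the term
  -- lies on or above the line.
  set B : ((ℕ × ℕ) × ℕ) × ℕ → ℝ := fun w =>
    if d.p * w.1.1.1 + d.h * w.1.1.2 = d.s + w.2 then a w.1 else 0 with hB
  have hinj : Function.Injective (fun u : (ℕ × ℕ) × ℕ =>
      (u, d.p * u.1.1 + d.h * u.1.2 - d.s)) := fun u v h => (Prod.ext_iff.1 h).1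
  have hBsum : HasSum B (eval2 f (σ * ξ ^ d.p) (ξ ^ d.h * (d.c + z))) := by
    rw [← hinj.hasSum_iff]
    · refine hleft.congr_fun fun u => ?_
      simp only [hB, Function.comp_apply]
      by_cases h0 : f u.1.1 u.1.2 = 0
      · simp [ha, h0]
      · rw [if_pos]
        have := hs _ _ h0
        omega
    · rintro ⟨u, m⟩ hm
      simp only [hB]
      rw [if_neg]
      intro heq
      exact hm ⟨u, by simp only [heq]; congr 1; omega⟩
  let e : ((ℕ × ℕ) × (ℕ × ℕ)) ≃ ((ℕ × ℕ) × ℕ) × ℕ :=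
    { toFun := fun w => ((w.2, w.1.2), w.1.1)
      invFun := fun w => ((w.2, w.1.2), w.1.1)
      left_inv := fun _ => rfl
      right_inv := fun _ => rfl }
  have hB2 : HasSum (B ∘ e) (eval2 f (σ * ξ ^ d.p) (ξ ^ d.h * (d.c + z))) :=
    e.hasSum_iff.2 hBsum
  have hfib : ∀ y : ℕ × ℕ, HasSum (fun x : ℕ × ℕ => (B ∘ e) (y, x))
      (ξ ^ d.s * (d.next σ f y.1 y.2 * (ξ ^ y.1 * z ^ y.2))) := by
    rintro ⟨m, l⟩
    have h1 := hasSum_sum_of_ne_finset_zero (f := fun x : ℕ × ℕ => (B ∘ e) ((m, l), x))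
      (L := SummationFilter.unconditional (ℕ × ℕ))
      (s := (Finset.range (d.s + m + 1) ×ˢ Finset.range (d.s + m + 1)).filter
        (fun x => d.p * x.1 + d.h * x.2 = d.s + m)) (by
        rintro ⟨k, j⟩ hx
        simp only [hB, e, Function.comp_apply, Equiv.coe_fn_mk]
        rw [if_neg]
        intro heq
        apply hx
        simp only [Finset.mem_filter, Finset.mem_product, Finset.mem_range]
        have h1 := Nat.le_mul_of_pos_left k hp
        have h2 := Nat.le_mul_of_pos_left j hh
        exact ⟨⟨by omega, by omega⟩, heq⟩)
    convert h1 using 1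
    simp only [NPChoice.next]
    rw [Finset.sum_mul, Finset.mul_sum]
    refine Finset.sum_congr rfl fun x hx => ?_
    have hx' := (Finset.mem_filter.1 hx).2
    simp only [hB, e, Function.comp_apply, Equiv.coe_fn_mk]
    rw [if_pos hx']
    simp only [ha]
    rw [hx', pow_add]
    ring
  have := hB2.prod_fiberwise hfib
  rw [eval2, ← tsum_mul_left]
  exact this.tsum_eq

end Evaluation

/-! ### The Puiseux series as a zero of the bifurcation series. -/

section PuiseuxZero

open PowerSeries
open scoped ENNReal NNReal

variable {σ : ℝ} {f : ℕ → ℕ → ℝ} {d : ℕ → NPChoice} {i₀ : ℕ}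

/-- One more step substitutes `η ^ p` for the previous variable and so multiplies all earlier
exponents by `p`. -/
theorem npExponent_succ {i l : ℕ} (h : l ≤ i) :
    npExponent d (i + 1) l = npExponent d i l * (d (i + 1)).p := by
  rw [npExponent, npExponent, Finset.sum_mul]
  refine Finset.sum_congr rfl fun m hm => ?_
  rw [Finset.mem_range] at hm
  rw [Finset.prod_Ioc_succ_top (by omega), mul_assoc]

theorem npExponent_succ_self (i : ℕ) :
    npExponent d (i + 1) (i + 1) = npExponent d i i * (d (i + 1)).p + (d (i + 1)).h := by
  conv_lhs => rw [npExponent, Finset.sum_range_succ]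
  rw [Finset.Ioc_self, Finset.prod_empty, mul_one, ← npExponent_succ le_rfl]
  rfl

theorem npRamification_succ (i : ℕ) :
    npRamification d (i + 1) = npRamification d i * (d (i + 1)).p := Finset.prod_range_succ _ _

/-- A zero of the last series of the process is transformed into a zero of the first one. -/
theorem IsSimpleNPRun.eval2_eq_zero {K N : ℝ} (hr : IsSimpleNPRun σ f d i₀) (hσ : |σ| = 1)
    (hK : 0 ≤ K) (hN : 1 ≤ N) (hf : ∀ i ≤ i₀, GeomBound K (npSeries σ f d i))
    (hc : ∀ i ≤ i₀, |(d i).c| ≤ N) :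
    ∀ i ≤ i₀, ∀ ξ z : ℝ, 0 < ξ → K * (ξ * (N + 1)) ≤ 1 / 2 → ξ * (N + 1) ≤ 1 → |z| ≤ 1 →
      eval2 (npSeries σ f d (i + 1)) ξ z = 0 →
      eval2 f (σ * ξ ^ npRamification d i)
        (∑ l ∈ Finset.range (i + 1), (d l).c * ξ ^ npExponent d i l +
          ξ ^ npExponent d i i * z) = 0 := by
  have step : ∀ i ≤ i₀, ∀ ξ z : ℝ, 0 < ξ → K * (ξ * (N + 1)) ≤ 1 / 2 → ξ * (N + 1) ≤ 1 →
      |z| ≤ 1 → eval2 (npSeries σ f d (i + 1)) ξ z = 0 →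
      eval2 (npSeries σ f d i) (npSign σ i * ξ ^ (d i).p) (ξ ^ (d i).h * ((d i).c + z)) = 0 := by
    intro i hi ξ z hξ hKξ hξN hz h0
    have hseg := (hr.1 i hi).1
    have hξ1 : ξ ≤ 1 := by nlinarith
    rw [← NPChoice.pow_mul_eval2_next (hf i hi) hK hN (abs_npSign hσ i) hseg.1 hseg.2.1
      (fun k j h => hseg.le_of_ne_zero h) (hc i hi) hξ.le hξ1 hKξ hz]
    change _ * eval2 (npSeries σ f d (i + 1)) ξ z = 0
    rw [h0, mul_zero]
  intro i
  induction i with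
  | zero =>
    intro hi ξ z hξ hKξ hξN hz h0
    have := step 0 hi ξ z hξ hKξ hξN hz h0
    simp only [npSign, if_true, npSeries] at this
    simp only [npRamification, npExponent, Finset.sum_range_one, Finset.prod_range_one, zero_add,
      Finset.Ioc_self, Finset.prod_empty, mul_one]
    rw [mul_add] at this
    rw [mul_comm (d 0).c]
    exact this
  | succ i ih =>
    intro hi ξ z hξ hKξ hξN hz h0
    have h1 := step (i + 1) hi ξ z hξ hKξ hξN hz h0
    have hseg := (hr.1 (i + 1) hi).1
    have hξ1 : ξ ≤ 1 := by nlinarith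
    have hle : ξ ^ (d (i + 1)).p ≤ ξ := pow_le_of_le_one hξ.le hξ1 hseg.1.ne'
    have hle' : ξ ^ (d (i + 1)).h ≤ ξ := pow_le_of_le_one hξ.le hξ1 hseg.2.1.ne'
    rw [npSign, if_neg (by omega), one_mul] at h1
    -- The earlier steps are evaluated at `ξ ^ p` and `ξ ^ h (c + z)`; the assumption `ξ (N + 1) ≤
    -- 1` keeps the second argument in the unit interval, as the induction requires.
    have h2 := ih (by omega) (ξ ^ (d (i + 1)).p) (ξ ^ (d (i + 1)).h * ((d (i + 1)).c + z))
      (pow_pos hξ _) (le_trans (by gcongr) hKξ) (le_trans (by gcongr) hξN) (by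
        rw [abs_mul, abs_of_nonneg (pow_nonneg hξ.le _)]
        have h3 : |(d (i + 1)).c + z| ≤ N + 1 :=
          (abs_add_le _ _).trans (add_le_add (hc _ hi) hz)
        calc _ ≤ ξ * (N + 1) := by gcongr
          _ ≤ 1 := hξN) h1
    rw [← pow_mul, mul_comm (d (i + 1)).p, ← npRamification_succ] at h2
    rw [← h2]
    congr 1
    rw [Finset.sum_range_succ, npExponent_succ_self, pow_add, mul_comm _ (d (i + 1)).p, pow_mul]
    have : ∀ l ∈ Finset.range (i + 1), (d l).c * ξ ^ npExponent d (i + 1) l =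
        (d l).c * (ξ ^ (d (i + 1)).p) ^ npExponent d i l := by
      intro l hl
      rw [npExponent_succ (by rw [Finset.mem_range] at hl; omega), mul_comm _ (d (i + 1)).p, pow_mul]
    rw [Finset.sum_congr rfl this]
    ring

theorem puiseuxBeta0_eq (σ : ℝ) (f : ℕ → ℕ → ℝ) (d : ℕ → NPChoice) (i₀ : ℕ) :
    puiseuxBeta0 σ f d i₀ =
      ∑ i ∈ Finset.range (i₀ + 1), PowerSeries.monomial (npExponent d i₀ i) (d i).c +
        PowerSeries.X ^ npExponent d i₀ i₀ *
          implicitSeries (npSlope σ f d i₀) (npSeries σ f d (i₀ + 1)) := rfl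

theorem IsSimpleNPRun.npExponent_pos (hr : IsSimpleNPRun σ f d i₀) {i : ℕ} (hi : i ≤ i₀) :
    0 < npExponent d i₀ i := by
  refine Finset.sum_pos (fun l hl => ?_) ⟨0, by simp⟩
  rw [Finset.mem_range] at hl
  refine Nat.mul_pos (hr.1 l (by omega)).1.2.1 (Finset.prod_pos fun m hm => ?_)
  rw [Finset.mem_Ioc] at hm
  exact (hr.1 m hm.2).1.1

theorem IsSimpleNPRun.npRamification_pos (hr : IsSimpleNPRun σ f d i₀) :
    0 < npRamification d i₀ :=
  Finset.prod_pos fun i hi => hr.p_pos (by rw [Finset.mem_range] at hi; omega)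

theorem IsSimpleNPRun.coeff_zero_puiseuxBeta0 (hr : IsSimpleNPRun σ f d i₀) :
    coeff 0 (puiseuxBeta0 σ f d i₀) = 0 := by
  rw [puiseuxBeta0_eq, map_add, map_sum, coeff_X_pow_mul',
    if_neg (by have := hr.npExponent_pos (le_refl i₀); omega), add_zero]
  refine Finset.sum_eq_zero fun i hi => ?_
  rw [Finset.mem_range] at hi
  have := hr.npExponent_pos (i := i) (by omega)
  rw [coeff_monomial, if_neg (by omega)]

theorem psNorm_X_pow_le (r : ℝ≥0∞) (n : ℕ) : psNorm r ((X : PowerSeries ℝ) ^ n) ≤ r ^ n := by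
  rw [X_pow_eq, psNorm_monomial]
  simp

/-- All exponents are positive, so for `r ≤ 1` each of the at most `N + 1` explicit terms
contributes at most `N r`, and the tail at most `r`. -/
theorem IsSimpleNPRun.psNorm_puiseuxBeta0_le (hr : IsSimpleNPRun σ f d i₀) {N : ℕ} {r : ℝ≥0}
    (hr1 : r ≤ 1) (hi₀ : i₀ ≤ N) (hc : ∀ i ≤ i₀, |(d i).c| ≤ N)
    (hy : psNorm r (implicitSeries (npSlope σ f d i₀) (npSeries σ f d (i₀ + 1))) ≤ 1) :
    psNorm r (puiseuxBeta0 σ f d i₀) ≤ r * ((N + 1) * N + 1) := by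
  have hr1' : (r : ℝ≥0∞) ≤ 1 := by exact_mod_cast hr1
  have hpow : ∀ {m : ℕ}, 0 < m → (r : ℝ≥0∞) ^ m ≤ r := fun {m} hm =>
    pow_le_of_le_one zero_le hr1' hm.ne'
  rw [puiseuxBeta0_eq]
  refine (psNorm_add_le _ _).trans ?_
  rw [mul_add, mul_one]
  refine add_le_add ((psNorm_sum_le _ _).trans ?_) ((psNorm_mul_le _ _).trans ?_)
  · calc ∑ i ∈ Finset.range (i₀ + 1), psNorm r (monomial (npExponent d i₀ i) (d i).c)
        ≤ ∑ i ∈ Finset.range (i₀ + 1), (N : ℝ≥0∞) * r := by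
          refine Finset.sum_le_sum fun i hi => ?_
          rw [Finset.mem_range] at hi
          rw [psNorm_monomial]
          refine mul_le_mul' ?_ (hpow (hr.npExponent_pos (by omega)))
          have := PerturbedSystem.enorm_le_natCast_pow (N := N) (m := 1) (x := (d i).c)
            (by rw [pow_one]; exact hc i (by omega))
          rwa [pow_one] at this
      _ = ((i₀ + 1 : ℕ) : ℝ≥0∞) * (N * r) := by simp
      _ ≤ ((N + 1 : ℕ) : ℝ≥0∞) * (N * r) := by gcongr
      _ = r * ((N + 1) * N) := by push_cast; ring
  · calc _ ≤ (r : ℝ≥0∞) * 1 := mul_le_mul' ((psNorm_X_pow_le _ _).trans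
          (hpow (hr.npExponent_pos le_rfl))) hy
      _ = r := mul_one _

theorem psEval_puiseuxBeta0 {r : ℝ≥0∞} {η : ℝ} (hr : r ≠ ⊤) (hη : ‖η‖ₑ ≤ r)
    (hy : psNorm r (implicitSeries (npSlope σ f d i₀) (npSeries σ f d (i₀ + 1))) ≠ ⊤) :
    psEval (puiseuxBeta0 σ f d i₀) η =
      ∑ i ∈ Finset.range (i₀ + 1), (d i).c * η ^ npExponent d i₀ i + η ^ npExponent d i₀ i₀ *
        psEval (implicitSeries (npSlope σ f d i₀) (npSeries σ f d (i₀ + 1))) η := by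
  have h1 := psEval_sum_monomial hr hη (Finset.range (i₀ + 1)) (npExponent d i₀)
    (fun i => (d i).c)
  have hX : psNorm r ((X : PowerSeries ℝ) ^ npExponent d i₀ i₀) ≠ ⊤ :=
    ne_top_of_le_ne_top (ENNReal.pow_ne_top hr) (psNorm_X_pow_le _ _)
  rw [puiseuxBeta0_eq, psEval_add h1.1 (ne_top_of_le_ne_top (ENNReal.mul_ne_top hX hy)
    (psNorm_mul_le _ _)) hη, h1.2, psEval_mul hX hy hη, X_pow_eq, psEval_monomial, one_mul]

/-- The Puiseux series is a zero of the series from which the process started. -/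
theorem IsSimpleNPRun.eval2_puiseuxBeta0 {N K : ℕ} (hr : IsSimpleNPRun σ f d i₀) (hσ : |σ| = 1)
    (hK : 1 ≤ K) (hN : 1 ≤ N) (hf : ∀ i ≤ i₀ + 1, GeomBound K (npSeries σ f d i))
    (hc : ∀ i ≤ i₀, |(d i).c| ≤ N) (hslope : 1 ≤ N * |npSlope σ f d i₀|) {η : ℝ} (hη : 0 < η)
    (hηr : η ≤ implicitRadius N K) :
    eval2 f (σ * η ^ npRamification d i₀) (psEval (puiseuxBeta0 σ f d i₀) η) = 0 := by
  have hn1 : (1 : ℝ) ≤ N := by exact_mod_cast hN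
  have hk1 : (1 : ℝ) ≤ K := by exact_mod_cast hK
  have hηe : ‖η‖ₑ ≤ implicitRadius N K := by
    rw [← ofReal_norm, Real.norm_of_nonneg hη.le]
    exact (ENNReal.ofReal_le_ofReal hηr).trans (by simp)
  set y := implicitSeries (npSlope σ f d i₀) (npSeries σ f d (i₀ + 1))
  have hyn : psNorm (implicitRadius N K) y ≤ implicitBound N K :=
    psNorm_implicitSeries_le hN hK (hf _ le_rfl) hr.npSeries_zero_zero hslope
  have hyt : psNorm (implicitRadius N K) y ≠ ⊤ := ne_top_of_le_ne_top ENNReal.coe_ne_top hyn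
  rw [psEval_puiseuxBeta0 ENNReal.coe_ne_top hηe hyt]
  have hKr := natCast_mul_implicitRadius_le hN hK
  have hKτ := natCast_mul_implicitBound_le hN hK
  have hKη : (K : ℝ) * (η * (N + 1)) ≤ 1 / 2 := by
    have hrr : (implicitRadius N K : ℝ) ≤ (512 * ((N : ℝ) * K))⁻¹ := by
      simp only [implicitRadius]; push_cast
      refine inv_anti₀ (by positivity) ?_
      have h1 : (N : ℝ) ≤ N ^ 2 := le_self_pow₀ hn1 (by norm_num)
      have h2 : (K : ℝ) ≤ K ^ 5 := le_self_pow₀ hk1 (by norm_num)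
      calc (512 : ℝ) * (N * K) ≤ 512 * (N ^ 2 * K ^ 5) := by gcongr
        _ = _ := by ring
    calc (K : ℝ) * (η * (N + 1)) ≤ K * ((512 * ((N : ℝ) * K))⁻¹ * (N + N)) := by
          gcongr; exact hηr.trans hrr
      _ = 2 / 512 := by field_simp; ring
      _ ≤ 1 / 2 := by norm_num
  have hη1 : η * (N + 1) ≤ 1 := by
    have h0 : 0 ≤ η * (N + 1) := by positivity
    nlinarith
  have hyb := abs_psEval_le hyn hηe
  have hτ1 : (implicitBound N K : ℝ) ≤ 1 := by
    have h1 : (implicitBound N K : ℝ) ≤ K * implicitBound N K :=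
      le_mul_of_one_le_left (by positivity) hk1
    have h2 : (K : ℝ) * implicitBound N K ≤ 2⁻¹ := by exact_mod_cast hKτ
    have h3 : (2⁻¹ : ℝ) ≤ 1 := by norm_num
    linarith
  refine hr.eval2_eq_zero (K := K) (N := N) hσ (by positivity) hn1 (fun i hi => hf i (by omega)) hc
    i₀ le_rfl η _ hη hKη hη1 (hyb.trans hτ1) ?_
  have htsum : ∑' x : ℕ × ℕ, ‖npSeries σ f d (i₀ + 1) x.1 x.2‖ₑ *
      (((implicitRadius N K : ℝ≥0∞) ^ 1) ^ x.1 * psNorm (implicitRadius N K) y ^ x.2) ≠ ⊤ := by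
    have hbd : ∑' x : ℕ × ℕ, (K : ℝ≥0∞) * (2⁻¹ ^ x.1 * 2⁻¹ ^ x.2) ≠ ⊤ := by
      rw [PerturbedSystem.tsum_two_inv_pow_prod]
      exact ENNReal.mul_ne_top (by norm_num) (by simp)
    refine ne_top_of_le_ne_top hbd (ENNReal.tsum_le_tsum fun x => ?_)
    have hKr' := ENNReal.natCast_mul_coe_le_two_inv hKr
    have hKτ' := ENNReal.natCast_mul_coe_le_two_inv hKτ
    calc _ ≤ (K : ℝ≥0∞) ^ (x.1 + x.2 + 1) * ((implicitRadius N K : ℝ≥0∞) ^ x.1 *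
          (implicitBound N K : ℝ≥0∞) ^ x.2) := by
          rw [pow_one]
          gcongr
          exact PerturbedSystem.enorm_le_natCast_pow (hf _ le_rfl _ _)
      _ = K * ((K * implicitRadius N K) ^ x.1 * (K * implicitBound N K) ^ x.2) := by
          rw [mul_pow, mul_pow]; ring
      _ ≤ _ := by gcongr
  have hs := hasSum_substPuiseux (σ := 1) (by simp) one_pos
    (f := npSeries σ f d (i₀ + 1)) coeff_zero_implicitSeries hyt htsum hηe
  rw [substPuiseux_implicitSeries hr.npSlope_ne_zero hr.npSeries_zero_zero
    (npSeries_zero_one σ f d i₀)] at hs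
  simp only [map_zero, zero_mul, one_mul, pow_one] at hs
  exact hs.unique hasSum_zero

end PuiseuxZero

/-! ### Sums of formal series as functions of time. -/

namespace Series2

open scoped ENNReal NNReal

/-- The sum of a formal series. -/
noncomputable def eval (u : Series2) (x y : ℝ) : ℝ := eval2 (fun k j => co k j u) x y

theorem eval_eps_mul (u : Series2) (x y : ℝ) : eval (eps * u) x y = x * eval u x y := by
  rw [eval, eval, eval2, eval2, ← tsum_mul_left]
  have hinj : Function.Injective (fun z : ℕ × ℕ => (z.1 + 1, z.2)) := by
    rintro ⟨a, b⟩ ⟨c, d⟩ h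
    simpa using h
  rw [← hinj.tsum_eq]
  · refine tsum_congr fun z => ?_
    simp only [co_eps_mul_succ]
    ring
  · rintro ⟨k, j⟩ hz
    rcases k with _ | k
    · simp at hz
    · exact ⟨(k, j), rfl⟩

variable {ρ δ : ℝ≥0∞} {x y : ℝ} {u v : ℝ → Series2}

theorem enorm_eval_term_le (hx : ‖x‖ₑ ≤ ρ) (hy : ‖y‖ₑ ≤ δ) (t : ℝ) (z : ℕ × ℕ) :
    ‖co z.1 z.2 (u t) * (x ^ z.1 * y ^ z.2)‖ₑ ≤ supCo u z * weight ρ δ z := by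
  rw [enorm_mul, enorm_mul, enorm_pow, enorm_pow, weight]
  gcongr
  exact enorm_co_le_supCo u _ _ t

theorem summable_eval (hx : ‖x‖ₑ ≤ ρ) (hy : ‖y‖ₑ ≤ δ) (hu : wnorm ρ δ u ≠ ⊤) (t : ℝ) :
    Summable fun z : ℕ × ℕ => ‖co z.1 z.2 (u t) * (x ^ z.1 * y ^ z.2)‖ := by
  rw [← tsum_enorm_ne_top_iff_summable_norm]
  exact ne_top_of_le_ne_top hu (ENNReal.tsum_le_tsum fun z => enorm_eval_term_le hx hy t z)

theorem abs_eval_le {ρ δ C : ℝ≥0} (hx : ‖x‖ₑ ≤ ρ) (hy : ‖y‖ₑ ≤ δ) (hu : wnorm ρ δ u ≤ C)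
    (t : ℝ) : |eval (u t) x y| ≤ C := by
  have h1 : ‖eval (u t) x y‖ₑ ≤ C :=
    enorm_tsum_le_tsum_enorm.trans ((ENNReal.tsum_le_tsum fun z =>
      enorm_eval_term_le hx hy t z).trans hu)
  rw [enorm_eq_nnnorm, ENNReal.coe_le_coe] at h1
  exact_mod_cast h1

theorem eval_add (hx : ‖x‖ₑ ≤ ρ) (hy : ‖y‖ₑ ≤ δ) (hu : wnorm ρ δ u ≠ ⊤) (hv : wnorm ρ δ v ≠ ⊤)
    (t : ℝ) : eval (u t + v t) x y = eval (u t) x y + eval (v t) x y := by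
  rw [eval, eval, eval, eval2, eval2, eval2, ← (summable_eval hx hy hu t).of_norm.tsum_add
    (summable_eval hx hy hv t).of_norm]
  simp_rw [co_add, add_mul]

theorem eval_sub (hx : ‖x‖ₑ ≤ ρ) (hy : ‖y‖ₑ ≤ δ) (hu : wnorm ρ δ u ≠ ⊤) (hv : wnorm ρ δ v ≠ ⊤)
    (t : ℝ) : eval (u t - v t) x y = eval (u t) x y - eval (v t) x y := by
  rw [eval, eval, eval, eval2, eval2, eval2, ← (summable_eval hx hy hu t).of_norm.tsum_sub
    (summable_eval hx hy hv t).of_norm]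
  simp_rw [co_sub, sub_mul]

theorem eval_scale (a : ℝ) (w : Series2) : eval (scale a w) x y = a * eval w x y := by
  rw [eval, eval, eval2, eval2, ← tsum_mul_left]
  simp_rw [co_scale, mul_assoc]

theorem eval_mul (hx : ‖x‖ₑ ≤ ρ) (hy : ‖y‖ₑ ≤ δ) (hu : wnorm ρ δ u ≠ ⊤) (hv : wnorm ρ δ v ≠ ⊤)
    (t : ℝ) : eval (u t * v t) x y = eval (u t) x y * eval (v t) x y := by
  have := Real.tsum_antidiagonal_mul (fun z : ℕ × ℕ => co z.1 z.2 (u t))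
    (fun z => co z.1 z.2 (v t)) (fun z => x ^ z.1 * y ^ z.2)
    (fun z w => by simp only [Prod.fst_add, Prod.snd_add, pow_add]; ring)
    (summable_eval hx hy hu t) (summable_eval hx hy hv t)
  rw [eval, eval, eval, eval2, eval2, eval2, ← this]
  simp_rw [co_mul]

theorem wnorm_pow_ne_top (hu : wnorm ρ δ u ≠ ⊤) (n : ℕ) : wnorm ρ δ (fun t => u t ^ n) ≠ ⊤ :=
  ne_top_of_le_ne_top (ENNReal.pow_ne_top hu) (wnorm_pow_le u n)

theorem eval_one : eval 1 x y = 1 := by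
  rw [eval, eval2, tsum_eq_single (0, 0)]
  · simp [co_one]
  · rintro ⟨k, j⟩ hz
    rw [co_one, if_neg, zero_mul]
    rintro ⟨rfl, rfl⟩
    exact hz rfl

theorem eval_pow (hx : ‖x‖ₑ ≤ ρ) (hy : ‖y‖ₑ ≤ δ) (hu : wnorm ρ δ u ≠ ⊤) (t : ℝ) (n : ℕ) :
    eval (u t ^ n) x y = eval (u t) x y ^ n := by
  induction n with
  | zero => rw [pow_zero, pow_zero, eval_one]
  | succ n ih =>
    rw [pow_succ, pow_succ, ← ih]
    exact eval_mul hx hy (wnorm_pow_ne_top hu n) hu t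

/-- Composition of formal series commutes with evaluation. -/
theorem hasSum_eval_compTaylor (hx : ‖x‖ₑ ≤ ρ) (hy : ‖y‖ₑ ≤ δ) (hu : wnorm ρ δ u ≠ ⊤)
    (hv : wnorm ρ δ v ≠ ⊤) {t : ℝ} (hu0 : co 0 0 (u t) = 0) (hv0 : co 0 0 (v t) = 0)
    {g : ℕ → ℕ → ℝ}
    (hg : ∑' z : ℕ × ℕ, ‖g z.1 z.2‖ₑ * (wnorm ρ δ u ^ z.1 * wnorm ρ δ v ^ z.2) ≠ ⊤) :
    HasSum (fun z : ℕ × ℕ => g z.1 z.2 * eval (u t) x y ^ z.1 * eval (v t) x y ^ z.2)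
      (eval (compTaylor g (u t) (v t)) x y) := by
  obtain ⟨A, hA⟩ : ∃ A : (ℕ × ℕ) × (ℕ × ℕ) → ℝ, A = fun z => g z.1.1 z.1.2 *
    (co z.2.1 z.2.2 (u t ^ z.1.1 * v t ^ z.1.2) * (x ^ z.2.1 * y ^ z.2.2)) := ⟨_, rfl⟩
  have hAs : Summable A := by
    refine Summable.of_enorm (ne_top_of_le_ne_top hg ?_)
    rw [ENNReal.tsum_prod']
    refine ENNReal.tsum_le_tsum fun z => ?_
    simp only [hA, enorm_mul (g _ _)]
    rw [ENNReal.tsum_mul_left]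
    gcongr
    refine le_trans (ENNReal.tsum_le_tsum fun w => ?_) (wnorm_pow_mul_pow_le u v z.1 z.2)
    exact enorm_eval_term_le (u := fun t => u t ^ z.1 * v t ^ z.2) hx hy t w
  have h1 : ∀ z : ℕ × ℕ, HasSum (fun w => A (z, w))
      (g z.1 z.2 * eval (u t) x y ^ z.1 * eval (v t) x y ^ z.2) := by
    intro z
    have hp := wnorm_pow_ne_top hu z.1
    have hq := wnorm_pow_ne_top hv z.2
    have hpq : wnorm ρ δ (fun t => u t ^ z.1 * v t ^ z.2) ≠ ⊤ :=
      ne_top_of_le_ne_top (ENNReal.mul_ne_top hp hq) (wnorm_mul_le _ _)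
    rw [← eval_pow hx hy hu, ← eval_pow hx hy hv, mul_assoc, ← eval_mul hx hy hp hq t]
    simp only [hA]
    exact (summable_eval hx hy hpq t).of_norm.hasSum.mul_left _
  have h2 : ∀ w : ℕ × ℕ, HasSum (fun z => A (z, w))
      (co w.1 w.2 (compTaylor g (u t) (v t)) * (x ^ w.1 * y ^ w.2)) := by
    intro w
    have hfin : co w.1 w.2 (compTaylor g (u t) (v t)) * (x ^ w.1 * y ^ w.2) =
        ∑ z ∈ Finset.range (w.1 + w.2 + 1) ×ˢ Finset.range (w.1 + w.2 + 1), A (z, w) := by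
      rw [co_compTaylor, ← Finset.sum_product', Finset.sum_mul]
      simp only [hA, mul_assoc]
    rw [hfin]
    refine hasSum_sum_of_ne_finset_zero fun z hz => ?_
    simp only [hA]
    rw [co_pow_mul_pow_eq_zero hu0 hv0, zero_mul, mul_zero]
    simp only [Finset.mem_product, Finset.mem_range, not_and_or] at hz
    omega
  have h3 : HasSum (fun z : (ℕ × ℕ) × (ℕ × ℕ) => A (z.2, z.1)) (∑' z, A z) :=
    (Equiv.prodComm (ℕ × ℕ) (ℕ × ℕ)).hasSum_iff.2 hAs.hasSum
  have h4 : eval (compTaylor g (u t) (v t)) x y = ∑' z, A z := (h3.prod_fiberwise h2).tsum_eq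
  rw [h4]
  exact hAs.hasSum.prod_fiberwise h1

/-- Termwise differentiation: the suprema over time in `wnorm` form a summable majorant of the
derivatives that is uniform in `t`. -/
theorem hasDerivAt_eval (hx : ‖x‖ₑ ≤ ρ) (hy : ‖y‖ₑ ≤ δ) (hu : wnorm ρ δ u ≠ ⊤)
    (hv : wnorm ρ δ v ≠ ⊤)
    (hd : ∀ k j t, HasDerivAt (fun t => co k j (u t)) (co k j (v t)) t) (t : ℝ) :
    HasDerivAt (fun t => eval (u t) x y) (eval (v t) x y) t := by
  refine hasDerivAt_tsum (u := fun z => (supCo v z * weight ρ δ z).toReal)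
    (g' := fun (z : ℕ × ℕ) t => co z.1 z.2 (v t) * (x ^ z.1 * y ^ z.2)) (y₀ := 0)
    (ENNReal.summable_toReal hv) (fun z t => (hd z.1 z.2 t).mul_const _) (fun z t => ?_)
    (summable_eval hx hy hu 0).of_norm t
  rw [← toReal_enorm]
  exact ENNReal.toReal_mono (ENNReal.ne_top_of_tsum_ne_top hv z) (enorm_eval_term_le hx hy t z)

end Series2

/-! ### From a zero of the bifurcation series to a subharmonic solution. -/

namespace PerturbedSystem

open Series2
open scoped ENNReal NNReal

theorem tsum_enorm_mul_pow_ne_top {N : ℕ} {g : ℕ → ℕ → ℝ} {a b : ℝ≥0∞}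
    (hg : ∀ r s, |g r s| ≤ (N : ℝ) ^ (r + s + 1)) (ha : N * a ≤ 2⁻¹) (hb : N * b ≤ 2⁻¹) :
    ∑' z : ℕ × ℕ, ‖g z.1 z.2‖ₑ * (a ^ z.1 * b ^ z.2) ≠ ⊤ := by
  have hfin : ∑' z : ℕ × ℕ, (N : ℝ≥0∞) * (2⁻¹ ^ z.1 * 2⁻¹ ^ z.2) ≠ ⊤ := by
    rw [tsum_two_inv_pow_prod]
    exact ENNReal.mul_ne_top (by norm_num) (by simp)
  refine ne_top_of_le_ne_top hfin (ENNReal.tsum_le_tsum fun z => ?_)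
  calc ‖g z.1 z.2‖ₑ * (a ^ z.1 * b ^ z.2)
      ≤ (N : ℝ≥0∞) ^ (z.1 + z.2 + 1) * (a ^ z.1 * b ^ z.2) := by
        gcongr
        exact enorm_le_natCast_pow (hg _ _)
    _ = N * ((N * a) ^ z.1 * (N * b) ^ z.2) := by rw [mul_pow, mul_pow]; ring
    _ ≤ _ := by gcongr

theorem meanOver_meanZeroPrimitive {T : ℝ} (hT : 0 < T) {f : ℝ → ℝ} (hf : Continuous f) :
    meanOver T (meanZeroPrimitive T f) = 0 := by
  have hc : Continuous fun t' => ∫ τ in (0 : ℝ)..t', (f τ - meanOver T f) :=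
    intervalIntegral.continuous_primitive
      (fun _ _ => (hf.sub continuous_const).intervalIntegrable _ _) 0
  have h1 := meanOver_const hT (meanOver T fun t' => ∫ τ in (0 : ℝ)..t', (f τ - meanOver T f))
  rw [meanOver] at h1 ⊢
  simp only [meanZeroPrimitive]
  rw [intervalIntegral.integral_sub (hc.intervalIntegrable _ _) (by simp), mul_sub, h1]
  exact sub_self _

namespace TorusBound

variable {S : PerturbedSystem} {A₀ t₀ : ℝ} {p : ℤ} {q N : ℕ}

theorem wnorm_auxB_le_angleBound (h : S.TorusBound A₀ p q N) :
    wnorm (epsRadius N) (betaRadius N) (S.auxB A₀ t₀ q) ≤ angleBound N :=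
  (h.wnorm_auxB_le t₀).trans (ENNReal.coe_le_coe.2 (actionBound_le_angleBound h.one_le))

theorem wnorm_phi_aux_ne_top (h : S.TorusBound A₀ p q N) :
    wnorm (epsRadius N) (betaRadius N)
      (S.formalPhi A₀ t₀ (S.auxBeta A₀ t₀ q) (S.auxB A₀ t₀ q)) ≠ ⊤ := by
  refine ne_top_of_le_ne_top ?_ (h.wnorm_formalPhi_le t₀
    (natCast_mul_le_two_inv h.one_le (h.wnorm_auxBeta_le t₀))
    (natCast_mul_le_two_inv h.one_le h.wnorm_auxB_le_angleBound))
  have hB : wnorm (epsRadius N) (betaRadius N) (S.auxB A₀ t₀ q) ≠ ⊤ :=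
    ne_top_of_le_ne_top ENNReal.coe_ne_top (h.wnorm_auxB_le t₀)
  finiteness

/-- Differentiating the fixed-point equation gives `Φ - ⟨Φ⟩` plus `ω'` times the mean zero primitive
of `Γ`. The mean prescribed for `B` is the one for which `-⟨Φ⟩` and this primitive combine to `ω'
B`. -/
theorem hasDerivAt_co_auxBeta (h : S.TorusBound A₀ p q N) (k j : ℕ) (t : ℝ) :
    HasDerivAt (fun t => co k j (S.auxBeta A₀ t₀ q t))
      (co k j (S.formalPhi A₀ t₀ (S.auxBeta A₀ t₀ q) (S.auxB A₀ t₀ q) t +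
        scale (deriv S.ω A₀) (S.auxB A₀ t₀ q t))) t := by
  have hΦ := h.regular_formalPhi t₀ (h.regular_auxBeta t₀) (h.regular_auxB t₀)
  have hΓ := h.regular_formalGamma t₀ (h.regular_auxBeta t₀) (h.regular_auxB t₀)
  have hfix := S.auxStep_aux A₀ t₀ q
  have hβ := congrArg (fun u => fun t => co k j (u.1 t)) hfix
  have hB := congrArg (fun u => co k j (u.2 t)) hfix
  simp only [auxStep, co_add, co_sub, co_scale, co_prim, co_mean] at hβ hB
  rw [← hβ]
  have h1 := ((hasDerivAt_meanZeroPrimitive (T := 2 * Real.pi * q) (hΦ.continuous k j) t).const_add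
    (co k j beta0)).add ((hasDerivAt_meanZeroPrimitive (T := 2 * Real.pi * q)
      (continuous_meanZeroPrimitive (T := 2 * Real.pi * q) (hΓ.continuous k j)) t).const_mul
        (deriv S.ω A₀))
  rw [meanOver_meanZeroPrimitive h.period_pos (hΓ.continuous k j), sub_zero] at h1
  refine h1.congr_deriv ?_
  rw [co_add, co_scale, ← hB, mul_sub, mul_inv_cancel_left₀ h.deriv_ne_zero]
  ring

theorem hasDerivAt_co_auxB (h : S.TorusBound A₀ p q N) (k j : ℕ) (t : ℝ) :
    HasDerivAt (fun t => co k j (S.auxB A₀ t₀ q t))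
      (co k j (S.formalGamma A₀ t₀ (S.auxBeta A₀ t₀ q) (S.auxB A₀ t₀ q) t -
        mean (2 * Real.pi * q)
          (S.formalGamma A₀ t₀ (S.auxBeta A₀ t₀ q) (S.auxB A₀ t₀ q)))) t := by
  have hΓ := h.regular_formalGamma t₀ (h.regular_auxBeta t₀) (h.regular_auxB t₀)
  have hB := congrArg (fun u => fun t => co k j (u.2 t)) (S.auxStep_aux A₀ t₀ q)
  simp only [auxStep, co_sub, co_scale, co_prim, co_mean] at hB
  rw [← hB, co_sub, co_mean]
  exact (hasDerivAt_meanZeroPrimitive (hΓ.continuous k j) t).sub_const _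

/-- The formal identity `⟨Γ⟩ = ε𝓕`, valid because `Γ` has no term of order zero in `ε`. -/
theorem mean_gamma_aux (S : PerturbedSystem) (A₀ t₀ : ℝ) (q : ℕ) :
    mean (2 * Real.pi * q) (S.formalGamma A₀ t₀ (S.auxBeta A₀ t₀ q) (S.auxB A₀ t₀ q)) =
      eps * ofCoeffs (S.bifCoeff A₀ t₀ q) := by
  ext k j
  rcases k with _ | k
  · simp [co_formalGamma_zero, meanOver]
  · rw [co_eps_mul_succ, co_ofCoeffs]
    rfl

section Evaluation

variable {ε β₀ : ℝ}

theorem abs_eval_auxBeta_lt (h : S.TorusBound A₀ p q N) (hε : ‖ε‖ₑ ≤ epsRadius N)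
    (hβ : ‖β₀‖ₑ ≤ betaRadius N) (t : ℝ) :
    |eval (S.auxBeta A₀ t₀ q t) ε β₀| < 1 / (N : ℝ) := by
  refine (abs_eval_le hε hβ (h.wnorm_auxBeta_le t₀) t).trans_lt ?_
  have := h.cast_pos
  rw [angleBound]
  push_cast
  rw [← one_div]
  exact one_div_lt_one_div_of_lt this (by linarith)

theorem abs_eval_auxB_lt (h : S.TorusBound A₀ p q N) (hε : ‖ε‖ₑ ≤ epsRadius N)
    (hβ : ‖β₀‖ₑ ≤ betaRadius N) (t : ℝ) :
    |eval (S.auxB A₀ t₀ q t) ε β₀| < 1 / (N : ℝ) := by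
  refine (abs_eval_le hε hβ h.wnorm_auxB_le_angleBound t).trans_lt ?_
  have := h.cast_pos
  rw [angleBound]
  push_cast
  rw [← one_div]
  exact one_div_lt_one_div_of_lt this (by linarith)

theorem hasSum_eval_compTaylor_aux (h : S.TorusBound A₀ p q N) (hε : ‖ε‖ₑ ≤ epsRadius N)
    (hβ : ‖β₀‖ₑ ≤ betaRadius N) {g : ℕ → ℕ → ℝ}
    (hg : ∀ r s, |g r s| ≤ (N : ℝ) ^ (r + s + 1)) (t : ℝ) :
    HasSum (fun z : ℕ × ℕ => g z.1 z.2 * eval (S.auxBeta A₀ t₀ q t) ε β₀ ^ z.1 *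
        eval (S.auxB A₀ t₀ q t) ε β₀ ^ z.2)
      (eval (compTaylor g (S.auxBeta A₀ t₀ q t) (S.auxB A₀ t₀ q t)) ε β₀) :=
  hasSum_eval_compTaylor hε hβ
    (ne_top_of_le_ne_top ENNReal.coe_ne_top (h.wnorm_auxBeta_le t₀))
    (ne_top_of_le_ne_top ENNReal.coe_ne_top (h.wnorm_auxB_le t₀))
    (S.co_auxBeta_zero_zero A₀ t₀ q t) (S.co_auxB_zero_left A₀ t₀ q 0 t)
    (tsum_enorm_mul_pow_ne_top hg (natCast_mul_le_two_inv h.one_le (h.wnorm_auxBeta_le t₀))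
      (natCast_mul_le_two_inv h.one_le h.wnorm_auxB_le_angleBound))

theorem eval_formalGamma (h : S.TorusBound A₀ p q N) (hε : ‖ε‖ₑ ≤ epsRadius N)
    (hβ : ‖β₀‖ₑ ≤ betaRadius N) (t : ℝ) :
    eval (S.formalGamma A₀ t₀ (S.auxBeta A₀ t₀ q) (S.auxB A₀ t₀ q) t) ε β₀ =
      ε * S.G (S.ω A₀ * t + eval (S.auxBeta A₀ t₀ q t) ε β₀)
        (A₀ + eval (S.auxB A₀ t₀ q t) ε β₀) (t + t₀) := by
  rw [formalGamma, eval_eps_mul]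
  congr 1
  exact (h.hasSum_eval_compTaylor_aux hε hβ (fun _ _ => h.taylor_G _ _ _ _) t).unique
    (hasSum_taylorCoeff h.cast_pos S.isOpen_W S.analytic_G h.ball_subset
      (fun α t r s => h.taylor_G α t r s) _ _ (h.abs_eval_auxBeta_lt hε hβ t)
      (h.abs_eval_auxB_lt hε hβ t))

theorem eval_compTaylor_frequency (h : S.TorusBound A₀ p q N) (hε : ‖ε‖ₑ ≤ epsRadius N)
    (hβ : ‖β₀‖ₑ ≤ betaRadius N) (t : ℝ) :
    eval (compTaylor
      (fun r s => if r = 0 ∧ 2 ≤ s then iteratedDeriv s S.ω A₀ / (s.factorial : ℝ) else 0)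
      (S.auxBeta A₀ t₀ q t) (S.auxB A₀ t₀ q t)) ε β₀ =
      S.ω (A₀ + eval (S.auxB A₀ t₀ q t) ε β₀) - S.ω A₀ -
        deriv S.ω A₀ * eval (S.auxB A₀ t₀ q t) ε β₀ := by
  set b := eval (S.auxB A₀ t₀ q t) ε β₀ with hb
  have h1 := h.hasSum_eval_compTaylor_aux hε hβ (t₀ := t₀) (g := fun r s =>
    if r = 0 ∧ 2 ≤ s then iteratedDeriv s S.ω A₀ / (s.factorial : ℝ) else 0) (fun r s => by
      split_ifs with hrs
      · rw [hrs.1, zero_add]; exact h.taylor_ω s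
      · rw [abs_zero]; positivity) t
  have hinj : Function.Injective (fun s : ℕ => ((0, s) : ℕ × ℕ)) := fun a b hab => by
    simpa using hab
  rw [← hb, ← hinj.hasSum_iff] at h1
  swap
  · rintro ⟨r, s⟩ hz
    have hr : ¬ (r = 0 ∧ 2 ≤ s) := fun hr => hz ⟨s, by rw [hr.1]⟩
    simp [hr]
  have h2 := hasSum_taylor_of_bound h.cast_pos (S.analytic_ω.mono h.ball_subset)
    (K := N) (fun s => by rw [← pow_succ']; exact h.taylor_ω s) (x := b) (h.abs_eval_auxB_lt hε hβ t)
  -- The two Taylor terms of `ω` that the composition omits; subtracting them from the full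
  -- expansion leaves the frequency remainder.
  have h3 : HasSum (fun s => if s < 2 then iteratedDeriv s S.ω A₀ / (s.factorial : ℝ) * b ^ s
      else 0) (S.ω A₀ + deriv S.ω A₀ * b) := by
    have := hasSum_sum_of_ne_finset_zero (f := fun s => if s < 2 then
      iteratedDeriv s S.ω A₀ / (s.factorial : ℝ) * b ^ s else 0) (s := Finset.range 2)
      (L := SummationFilter.unconditional ℕ) (fun s hs => if_neg (by simpa using hs))
    simpa [Finset.sum_range_succ, iteratedDeriv_one] using this
  have h4 := (h2.sub h3).unique (h1.congr_fun fun s => by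
    simp only [Function.comp_apply, true_and, pow_zero, mul_one]
    split_ifs <;> first | omega | ring)
  rw [← h4]
  ring

theorem eval_formalPhi (h : S.TorusBound A₀ p q N) (hε : ‖ε‖ₑ ≤ epsRadius N)
    (hβ : ‖β₀‖ₑ ≤ betaRadius N) (t : ℝ) :
    eval (S.formalPhi A₀ t₀ (S.auxBeta A₀ t₀ q) (S.auxB A₀ t₀ q) t) ε β₀ =
      ε * S.F (S.ω A₀ * t + eval (S.auxBeta A₀ t₀ q t) ε β₀)
        (A₀ + eval (S.auxB A₀ t₀ q t) ε β₀) (t + t₀) +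
      (S.ω (A₀ + eval (S.auxB A₀ t₀ q t) ε β₀) - S.ω A₀ -
        deriv S.ω A₀ * eval (S.auxB A₀ t₀ q t) ε β₀) := by
  have hu := natCast_mul_le_two_inv h.one_le (h.wnorm_auxBeta_le t₀)
  have hv := natCast_mul_le_two_inv h.one_le (h.wnorm_auxB_le_angleBound (t₀ := t₀))
  have hN : (4 * N : ℝ≥0∞) ≠ ⊤ := by finiteness
  have h1 := ne_top_of_le_ne_top hN (wnorm_compTaylor_le_four_mul
    (fun t => taylorCoeff S.F (S.ω A₀ * t) A₀ (t + t₀)) (fun _ _ _ => h.taylor_F _ _ _ _) hu hv)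
  have h2 := ne_top_of_le_ne_top hN (wnorm_compTaylor_le_four_mul (fun _ r s =>
    if r = 0 ∧ 2 ≤ s then iteratedDeriv s S.ω A₀ / (s.factorial : ℝ) else 0) (fun _ r s => by
      split_ifs with hrs
      · rw [hrs.1, zero_add]; exact h.taylor_ω s
      · rw [abs_zero]; positivity) hu hv)
  have h1' : wnorm (epsRadius N) (betaRadius N) (fun t => eps * compTaylor
      (taylorCoeff S.F (S.ω A₀ * t) A₀ (t + t₀)) (S.auxBeta A₀ t₀ q t) (S.auxB A₀ t₀ q t)) ≠ ⊤ :=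
    ne_top_of_le_ne_top (ENNReal.mul_ne_top ENNReal.coe_ne_top h1) (wnorm_eps_mul_le _)
  rw [← h.eval_compTaylor_frequency hε hβ t, formalPhi]
  refine (eval_add hε hβ h1' h2 t).trans ?_
  rw [eval_eps_mul]
  congr 2
  exact (h.hasSum_eval_compTaylor_aux hε hβ (fun _ _ => h.taylor_F _ _ _ _) t).unique
    (hasSum_taylorCoeff h.cast_pos S.isOpen_W S.analytic_F h.ball_subset
      (fun α t r s => h.taylor_F α t r s) _ _ (h.abs_eval_auxBeta_lt hε hβ t)
      (h.abs_eval_auxB_lt hε hβ t))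

/-- The formal solution of the auxiliary system, evaluated at a zero of the bifurcation series,
is a subharmonic solution. -/
theorem isSubharmonicSolution (h : S.TorusBound A₀ p q N) (hε : ‖ε‖ₑ ≤ epsRadius N)
    (hβ : ‖β₀‖ₑ ≤ betaRadius N) (h0 : ε * eval2 (S.bifCoeff A₀ t₀ q) ε β₀ = 0) :
    S.IsSubharmonicSolution p q ε
      (fun t => S.ω A₀ * (t - t₀) + eval (S.auxBeta A₀ t₀ q (t - t₀)) ε β₀)
      (fun t => A₀ + eval (S.auxB A₀ t₀ q (t - t₀)) ε β₀) := by
  have hBf : wnorm (epsRadius N) (betaRadius N) (S.auxB A₀ t₀ q) ≠ ⊤ :=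
    ne_top_of_le_ne_top ENNReal.coe_ne_top (h.wnorm_auxB_le t₀)
  have hβf : wnorm (epsRadius N) (betaRadius N) (S.auxBeta A₀ t₀ q) ≠ ⊤ :=
    ne_top_of_le_ne_top ENNReal.coe_ne_top (h.wnorm_auxBeta_le t₀)
  have hΓf : wnorm (epsRadius N) (betaRadius N)
      (S.formalGamma A₀ t₀ (S.auxBeta A₀ t₀ q) (S.auxB A₀ t₀ q)) ≠ ⊤ :=
    ne_top_of_le_ne_top (by finiteness) (h.wnorm_gamma_aux_le t₀)
  have hMf := ne_top_of_le_ne_top hΓf (wnorm_mean_le h.period_pos)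
  have hSf : wnorm (epsRadius N) (betaRadius N)
      (fun t => scale (deriv S.ω A₀) (S.auxB A₀ t₀ q t)) ≠ ⊤ :=
    ne_top_of_le_ne_top (ENNReal.mul_ne_top enorm_ne_top hBf) (wnorm_scale_le _)
  refine ⟨fun t => h.ball_subset ?_, fun t => ?_, fun t => ?_, fun t => ?_, fun t => ?_⟩
  · rw [Metric.mem_ball, Real.dist_eq, add_sub_cancel_left]
    exact h.abs_eval_auxB_lt hε hβ _
  · have h1 := (hasDerivAt_eval hε hβ hβf
      (ne_top_of_le_ne_top (ENNReal.add_ne_top.2 ⟨h.wnorm_phi_aux_ne_top, hSf⟩)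
        (wnorm_add_le _ _)) h.hasDerivAt_co_auxBeta (t - t₀)).comp_sub_const t t₀
    have h2 := (((hasDerivAt_id t).sub_const t₀).const_mul (S.ω A₀)).add h1
    refine h2.congr_deriv ?_
    rw [eval_add hε hβ h.wnorm_phi_aux_ne_top hSf, eval_scale, h.eval_formalPhi hε hβ,
      sub_add_cancel]
    ring
  · have h1 := (hasDerivAt_eval hε hβ hBf
      (ne_top_of_le_ne_top (ENNReal.add_ne_top.2 ⟨hΓf, hMf⟩) (wnorm_sub_le _ _))
      h.hasDerivAt_co_auxB (t - t₀)).comp_sub_const t t₀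
    refine (h1.const_add A₀).congr_deriv ?_
    -- The subtracted mean evaluates to `ε𝓕(ε, β₀)`, which vanishes by hypothesis, so the full
    -- action equation holds.
    rw [eval_sub hε hβ hΓf hMf, mean_gamma_aux, eval_eps_mul, h.eval_formalGamma hε hβ,
      sub_add_cancel]
    have h2 : eval (ofCoeffs (S.bifCoeff A₀ t₀ q)) ε β₀ = eval2 (S.bifCoeff A₀ t₀ q) ε β₀ := by
      simp [eval]
    rw [h2, h0, sub_zero]
  · have h1 : t + 2 * Real.pi * q - t₀ = t - t₀ + 2 * Real.pi * q := by ring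
    simp only [h1, eval, (h.regular_auxBeta t₀).co_add_period]
    rw [mul_add, h.freq_mul_period]
    ring
  · have h1 : t + 2 * Real.pi * q - t₀ = t - t₀ + 2 * Real.pi * q := by ring
    simp only [h1, eval, (h.regular_auxB t₀).co_add_period]

end Evaluation

end TorusBound

end PerturbedSystem

/-! ### The explicit radius and its computability. -/

section Radius

theorem Primrec.natPow : Primrec₂ ((· ^ ·) : ℕ → ℕ → ℕ) :=
  Primrec₂.unpaired'.1 Nat.Primrec.pow

/-- A common bound of the coefficients of all series of the Newton-Puiseux process. -/
def puiseuxCoeffBound (N : ℕ) : ℕ := npBound N (10 ^ 6 * N ^ 7) (N + 1)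

/-- The inverse of the radius of convergence of the solution in `η`. -/
def invRadius (N : ℕ) : ℕ :=
  512 * N ^ 2 * puiseuxCoeffBound N ^ 5 + 10 ^ 6 * N ^ 7 + 4 * N * ((N + 1) * N + 1) + 1

/-- The inverse of the radius of convergence of the solution in `ε`. -/
def invEpsRadius (N : ℕ) : ℕ := invRadius N ^ N ^ (N + 1)

theorem primrec_puiseuxCoeffBound : Primrec puiseuxCoeffBound := by
  have hg : Primrec fun N : ℕ => 10 ^ 6 * N ^ 7 :=
    Primrec.nat_mul.comp (Primrec.const _) (Primrec.natPow.comp Primrec.id (Primrec.const 7))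
  have hs : Primrec₂ fun (N : ℕ) (u : ℕ × ℕ) => (8 * N * u.2) ^ (N + 1) :=
    Primrec.natPow.comp (Primrec.nat_mul.comp (Primrec.nat_mul.comp (Primrec.const 8) Primrec.fst)
      (Primrec.snd.comp Primrec.snd)) (Primrec.succ.comp Primrec.fst)
  refine (Primrec.nat_rec' Primrec.succ hg hs).of_eq fun N => ?_
  have : ∀ i, Nat.rec (motive := fun _ => ℕ) (10 ^ 6 * N ^ 7)
      (fun _ x => (8 * N * x) ^ (N + 1)) i = npBound N (10 ^ 6 * N ^ 7) i := by
    intro i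
    induction i with
    | zero => rfl
    | succ i ih => rw [npBound, ← ih]
  exact this (N + 1)

theorem primrec_invRadius : Primrec invRadius := by
  have hid : Primrec fun N : ℕ => N := Primrec.id
  have h1 : Primrec fun N : ℕ => 512 * N ^ 2 * puiseuxCoeffBound N ^ 5 :=
    Primrec.nat_mul.comp (Primrec.nat_mul.comp (Primrec.const 512)
      (Primrec.natPow.comp hid (Primrec.const 2)))
      (Primrec.natPow.comp primrec_puiseuxCoeffBound (Primrec.const 5))
  have h2 : Primrec fun N : ℕ => 10 ^ 6 * N ^ 7 :=
    Primrec.nat_mul.comp (Primrec.const _) (Primrec.natPow.comp hid (Primrec.const 7))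
  have h3 : Primrec fun N : ℕ => 4 * N * ((N + 1) * N + 1) :=
    Primrec.nat_mul.comp (Primrec.nat_mul.comp (Primrec.const 4) hid)
      (Primrec.succ.comp (Primrec.nat_mul.comp Primrec.succ hid))
  exact Primrec.succ.comp (Primrec.nat_add.comp (Primrec.nat_add.comp h1 h2) h3)

theorem computable_invEpsRadius : Computable invEpsRadius :=
  (Primrec.natPow.comp primrec_invRadius
    (Primrec.natPow.comp Primrec.id Primrec.succ)).to_comp

theorem invRadius_pos (N : ℕ) : 0 < invRadius N := Nat.succ_pos _

theorem invEpsRadius_pos (N : ℕ) : 0 < invEpsRadius N := Nat.pow_pos (invRadius_pos N)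

theorem Real.rpow_one_div_pow_mul {x : ℝ} (hx : 0 ≤ x) {P M : ℕ} (hM : M ≠ 0) (h : P ∣ M)
    (m : ℕ) : (x ^ (1 / (M : ℝ))) ^ (M / P * m) = (x ^ (1 / (P : ℝ))) ^ m := by
  obtain ⟨c, rfl⟩ := h
  have hP : P ≠ 0 := by rintro rfl; simp at hM
  have hc : c ≠ 0 := by rintro rfl; simp at hM
  rw [Nat.mul_div_cancel_left _ (Nat.pos_of_ne_zero hP), pow_mul, ← Real.rpow_natCast _ c,
    ← Real.rpow_mul hx]
  congr 2
  push_cast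
  field_simp

end Radius

namespace PerturbedSystem

open Series2 PowerSeries
open scoped ENNReal NNReal

section

variable {S : PerturbedSystem} {A₀ t₀ σ : ℝ} {p : ℤ} {q i₀ N : ℕ} {d : ℕ → NPChoice}

theorem DataBound.torusBound (h : S.DataBound A₀ t₀ q σ d i₀ N) (hq : 0 < q)
    (hω : S.ω A₀ = (p : ℝ) / (q : ℝ)) : S.TorusBound A₀ p q N :=
  ⟨hq, hω, h.q_le, h.ball_subset, h.twist, h.taylor_ω, h.taylor_F, h.taylor_G⟩

theorem exists_frequency_bound (hA : A₀ ∈ S.W) :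
    ∃ C : ℝ, 1 ≤ C ∧ ∀ s, |iteratedDeriv s S.ω A₀ / (s.factorial : ℝ)| ≤ C ^ (s + 1) := by
  obtain ⟨C, hC, hb⟩ := (S.analytic_ω A₀ hA).exists_norm_iteratedFDeriv_le
  refine ⟨C, hC, fun s => ?_⟩
  have hs : (0 : ℝ) < s.factorial := by exact_mod_cast s.factorial_pos
  rw [abs_div, abs_of_pos hs, div_le_iff₀ hs, iteratedDeriv_eq_iteratedFDeriv]
  exact hb.self_of_nhds s (fun _ => 1) (fun _ => by simp)

theorem exists_dataBound (hA : A₀ ∈ S.W) (hω : deriv S.ω A₀ ≠ 0)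
    (hr : IsSimpleNPRun σ (S.bifCoeff A₀ t₀ q) d i₀) :
    ∃ N : ℕ, S.DataBound A₀ t₀ q σ d i₀ N := by
  obtain ⟨C₁, hC₁, h₁⟩ := S.exists_frequency_bound hA
  obtain ⟨C₂, hC₂, h₂⟩ := exists_taylorCoeff_bound S.isOpen_W S.analytic_F S.periodic_F_α
    S.periodic_F_t hA
  obtain ⟨C₃, hC₃, h₃⟩ := exists_taylorCoeff_bound S.isOpen_W S.analytic_G S.periodic_G_α
    S.periodic_G_t hA
  obtain ⟨δ, hδ, hball⟩ := Metric.isOpen_iff.1 S.isOpen_W A₀ hA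
  have hω' := abs_pos.2 hω
  have hs' := abs_pos.2 hr.npSlope_ne_zero
  set D : ℕ → ℝ := fun i => (d i).p + (d i).h + (d i).s + |(d i).c| with hD
  have hD0 : ∀ i, 0 ≤ D i := fun i => by positivity
  have hsum0 : 0 ≤ ∑ i ∈ Finset.range (i₀ + 1), D i := Finset.sum_nonneg fun i _ => hD0 i
  obtain ⟨N, hN⟩ := exists_nat_ge (C₁ + C₂ + C₃ + δ⁻¹ + |deriv S.ω A₀|⁻¹ +
    |npSlope σ (S.bifCoeff A₀ t₀ q) d i₀|⁻¹ + q + i₀ + ∑ i ∈ Finset.range (i₀ + 1), D i)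
  have e1 : 0 < δ⁻¹ := inv_pos.2 hδ
  have e2 : 0 < |deriv S.ω A₀|⁻¹ := inv_pos.2 hω'
  have e3 : 0 < |npSlope σ (S.bifCoeff A₀ t₀ q) d i₀|⁻¹ := inv_pos.2 hs'
  have e4 : (0 : ℝ) ≤ q := Nat.cast_nonneg _
  have e5 : (0 : ℝ) ≤ i₀ := Nat.cast_nonneg _
  have hpow : ∀ {C x : ℝ} {m : ℕ}, 1 ≤ C → C ≤ N → x ≤ C ^ m → x ≤ (N : ℝ) ^ m :=
    fun hC hCN hx => hx.trans (by gcongr)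
  refine ⟨N, ?_, ?_, ?_, fun s => hpow hC₁ (by linarith) (h₁ s),
    fun α t r s => hpow hC₂ (by linarith) (h₂ α t r s),
    fun α t r s => hpow hC₃ (by linarith) (h₃ α t r s), ?_, fun i hi => ?_, ?_⟩
  · exact_mod_cast (by linarith : (q : ℝ) ≤ N)
  · refine (Metric.ball_subset_ball ?_).trans hball
    rw [one_div]
    exact inv_le_of_inv_le₀ hδ (by linarith)
  · rw [← inv_le_iff_one_le_mul₀ hω']
    linarith
  · exact_mod_cast (by linarith : (i₀ : ℝ) ≤ N)
  · have h1 : D i ≤ ∑ i ∈ Finset.range (i₀ + 1), D i :=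
      Finset.single_le_sum (fun i _ => hD0 i) (by simpa using Nat.lt_succ_of_le hi)
    have h2 : D i ≤ N := by linarith
    simp only [hD] at h2
    have f1 : (0 : ℝ) ≤ (d i).p := Nat.cast_nonneg _
    have f2 : (0 : ℝ) ≤ (d i).h := Nat.cast_nonneg _
    have f3 : (0 : ℝ) ≤ (d i).s := Nat.cast_nonneg _
    have f4 := abs_nonneg (d i).c
    refine ⟨?_, ?_, ?_, by linarith⟩
    · exact_mod_cast (by linarith : ((d i).p : ℝ) ≤ N)
    · exact_mod_cast (by linarith : ((d i).h : ℝ) ≤ N)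
    · exact_mod_cast (by linarith : ((d i).s : ℝ) ≤ N)
  · rw [← inv_le_iff_one_le_mul₀ hs']
    linarith

/-- The radius of convergence of the solution in `η`. -/
noncomputable def etaRadius (N : ℕ) : ℝ≥0 := (invRadius N : ℝ≥0)⁻¹

theorem etaRadius_le_inv {N M : ℕ} (hM : 0 < M) (h : M ≤ invRadius N) :
    etaRadius N ≤ (M : ℝ≥0)⁻¹ := by
  rw [etaRadius]
  gcongr

theorem etaRadius_le_one (N : ℕ) : etaRadius N ≤ 1 := by
  have := etaRadius_le_inv one_pos (invRadius_pos N)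
  simpa using this

theorem etaRadius_le_epsRadius (hN : 1 ≤ N) : etaRadius N ≤ epsRadius N := by
  have := etaRadius_le_inv (N := N) (M := 10 ^ 6 * N ^ 7) (by positivity)
    (by rw [invRadius]; omega)
  rw [epsRadius]
  exact_mod_cast this

theorem puiseuxCoeffBound_pos (hN : 1 ≤ N) : 1 ≤ puiseuxCoeffBound N :=
  npBound_pos hN (Nat.succ_le_of_lt (by positivity)) _

theorem etaRadius_le_implicitRadius (hN : 1 ≤ N) :
    etaRadius N ≤ implicitRadius N (puiseuxCoeffBound N) := by
  have hK := puiseuxCoeffBound_pos hN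
  have := etaRadius_le_inv (N := N) (M := 512 * N ^ 2 * puiseuxCoeffBound N ^ 5) (by positivity)
    (by rw [invRadius]; omega)
  rw [implicitRadius]
  exact_mod_cast this

theorem etaRadius_mul_le_betaRadius (hN : 1 ≤ N) :
    (etaRadius N : ℝ≥0∞) * ((N + 1) * N + 1) ≤ betaRadius N := by
  have h1 := etaRadius_le_inv (N := N) (M := 4 * N * ((N + 1) * N + 1)) (by positivity)
    (by rw [invRadius]; omega)
  have h2 : etaRadius N * ((N + 1) * N + 1) ≤ betaRadius N := by
    have hn : (N : ℝ≥0) ≠ 0 := by exact_mod_cast (by omega : N ≠ 0)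
    calc etaRadius N * ((N + 1) * N + 1)
        ≤ ((4 * N * ((N + 1) * N + 1) : ℕ) : ℝ≥0)⁻¹ * ((N + 1) * N + 1) := by gcongr
      _ = betaRadius N := by
        rw [betaRadius]
        push_cast
        have : ((N : ℝ≥0) + 1) * N + 1 ≠ 0 := by positivity
        rw [mul_inv (4 * (N : ℝ≥0)), inv_mul_cancel_right₀ this]
  exact_mod_cast h2

theorem DataBound.geomBound_npSeries (h : S.DataBound A₀ t₀ q σ d i₀ N)
    (hT : S.TorusBound A₀ p q N) (hr : IsSimpleNPRun σ (S.bifCoeff A₀ t₀ q) d i₀) (hσ : |σ| = 1) :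
    ∀ i ≤ i₀ + 1, GeomBound (puiseuxCoeffBound N) (npSeries σ (S.bifCoeff A₀ t₀ q) d i) := by
  intro i hi
  have hK : 1 ≤ 10 ^ 6 * N ^ 7 := by
    have := hT.one_le
    exact Nat.succ_le_of_lt (by positivity)
  have h1 := hr.geomBound hσ hT.one_le hK (hT.geomBound_bifCoeff t₀)
    (fun i hi => (h.choices_le i hi).2.2) i hi
  refine h1.mono (by positivity) ?_
  have hs := h.steps_le
  exact_mod_cast npBound_mono hT.one_le hK (by omega : i ≤ N + 1)

theorem DataBound.npRamification_le (h : S.DataBound A₀ t₀ q σ d i₀ N) (hN : 1 ≤ N) :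
    npRamification d i₀ ≤ N ^ (N + 1) := by
  calc npRamification d i₀ ≤ ∏ _i ∈ Finset.range (i₀ + 1), N :=
        Finset.prod_le_prod' fun i hi =>
          (h.choices_le i (Nat.lt_succ_iff.1 (Finset.mem_range.1 hi))).1
    _ = N ^ (i₀ + 1) := by rw [Finset.prod_const, Finset.card_range]
    _ ≤ N ^ (N + 1) := Nat.pow_le_pow_right hN (Nat.succ_le_succ h.steps_le)

theorem DataBound.psNorm_puiseuxBeta0_le_betaRadius (h : S.DataBound A₀ t₀ q σ d i₀ N)
    (hT : S.TorusBound A₀ p q N) (hr : IsSimpleNPRun σ (S.bifCoeff A₀ t₀ q) d i₀) (hσ : |σ| = 1) :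
    psNorm (etaRadius N) (puiseuxBeta0 σ (S.bifCoeff A₀ t₀ q) d i₀) ≤ betaRadius N := by
  refine (hr.psNorm_puiseuxBeta0_le (etaRadius_le_one N) h.steps_le
    (fun i hi => (h.choices_le i hi).2.2.2) ?_).trans (etaRadius_mul_le_betaRadius hT.one_le)
  have hK := puiseuxCoeffBound_pos hT.one_le
  refine (psNorm_mono (ENNReal.coe_le_coe.2 (etaRadius_le_implicitRadius hT.one_le)) _).trans
    ((psNorm_implicitSeries_le hT.one_le hK (h.geomBound_npSeries hT hr hσ _ le_rfl)
      hr.npSeries_zero_zero h.slope).trans ?_)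
  have h1 := natCast_mul_implicitBound_le hT.one_le hK
  have h2 : implicitBound N (puiseuxCoeffBound N) ≤ 1 :=
    calc implicitBound N (puiseuxCoeffBound N)
        ≤ puiseuxCoeffBound N * implicitBound N (puiseuxCoeffBound N) :=
          le_mul_of_one_le_left zero_le (by exact_mod_cast hK)
      _ ≤ 2⁻¹ := h1
      _ ≤ 1 := inv_le_one_of_one_le₀ one_le_two
  exact_mod_cast h2

theorem DataBound.eval2_bifCoeff_eq_zero (h : S.DataBound A₀ t₀ q σ d i₀ N)
    (hT : S.TorusBound A₀ p q N) (hr : IsSimpleNPRun σ (S.bifCoeff A₀ t₀ q) d i₀) (hσ : |σ| = 1)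
    {η : ℝ} (hη : 0 < η) (hηr : η ≤ etaRadius N) :
    eval2 (S.bifCoeff A₀ t₀ q) (σ * η ^ npRamification d i₀)
      (psEval (puiseuxBeta0 σ (S.bifCoeff A₀ t₀ q) d i₀) η) = 0 :=
  hr.eval2_puiseuxBeta0 hσ (puiseuxCoeffBound_pos hT.one_le) hT.one_le
    (h.geomBound_npSeries hT hr hσ) (fun i hi => (h.choices_le i hi).2.2.2) h.slope hη
    (hηr.trans (by exact_mod_cast etaRadius_le_implicitRadius hT.one_le))

theorem DataBound.tsum_enorm_co_le (h : S.DataBound A₀ t₀ q σ d i₀ N)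
    (hT : S.TorusBound A₀ p q N) (hr : IsSimpleNPRun σ (S.bifCoeff A₀ t₀ q) d i₀) (hσ : |σ| = 1)
    (u : ℝ → Series2) (t : ℝ) :
    ∑' x : ℕ × ℕ, ‖co x.1 x.2 (u t)‖ₑ * (((etaRadius N : ℝ≥0∞) ^ npRamification d i₀) ^ x.1 *
      psNorm (etaRadius N) (puiseuxBeta0 σ (S.bifCoeff A₀ t₀ q) d i₀) ^ x.2) ≤
      wnorm (epsRadius N) (betaRadius N) u := by
  have h1 : (etaRadius N : ℝ≥0∞) ^ npRamification d i₀ ≤ epsRadius N :=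
    (pow_le_of_le_one zero_le (by exact_mod_cast etaRadius_le_one N)
      hr.npRamification_pos.ne').trans (by exact_mod_cast etaRadius_le_epsRadius hT.one_le)
  refine ENNReal.tsum_le_tsum fun x => ?_
  rw [weight]
  gcongr
  · exact enorm_co_le_supCo u x.1 x.2 t
  · exact h.psNorm_puiseuxBeta0_le_betaRadius hT hr hσ

theorem DataBound.abs_coeff_substPuiseux_mul_pow_le (h : S.DataBound A₀ t₀ q σ d i₀ N)
    (hT : S.TorusBound A₀ p q N) (hr : IsSimpleNPRun σ (S.bifCoeff A₀ t₀ q) d i₀) (hσ : |σ| = 1)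
    {u : ℝ → Series2} (hu : wnorm (epsRadius N) (betaRadius N) u ≤ angleBound N) (m : ℕ) (t : ℝ) :
    |coeff m (substPuiseux σ (npRamification d i₀) (fun k j => co k j (u t))
      (puiseuxBeta0 σ (S.bifCoeff A₀ t₀ q) d i₀))| * (etaRadius N : ℝ) ^ m ≤ 1 := by
  have h1 := (ENNReal.le_tsum m).trans ((tsum_enorm_substPuiseux_le (r := etaRadius N) σ hσ
    (npRamification d i₀) (fun k j => co k j (u t))
    (puiseuxBeta0 σ (S.bifCoeff A₀ t₀ q) d i₀)).trans ((h.tsum_enorm_co_le hT hr hσ u t).trans hu))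
  rw [enorm_eq_nnnorm] at h1
  have h2 : angleBound N ≤ 1 := by
    have : (1 : ℝ≥0) ≤ N := by exact_mod_cast hT.one_le
    rw [angleBound]
    exact inv_le_one_of_one_le₀ (one_le_mul one_le_two this)
  have h3 : (‖coeff m (substPuiseux σ (npRamification d i₀) (fun k j => co k j (u t))
      (puiseuxBeta0 σ (S.bifCoeff A₀ t₀ q) d i₀))‖₊ : ℝ≥0) * etaRadius N ^ m ≤ 1 :=
    le_trans (by exact_mod_cast h1) h2
  exact_mod_cast h3

theorem DataBound.hasSum_substPuiseux_aux (h : S.DataBound A₀ t₀ q σ d i₀ N)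
    (hT : S.TorusBound A₀ p q N) (hr : IsSimpleNPRun σ (S.bifCoeff A₀ t₀ q) d i₀) (hσ : |σ| = 1)
    {u : ℝ → Series2} (hu : wnorm (epsRadius N) (betaRadius N) u ≤ angleBound N) {η : ℝ}
    (hη : ‖η‖ₑ ≤ etaRadius N) (t : ℝ) :
    HasSum (fun m => coeff m (substPuiseux σ (npRamification d i₀) (fun k j => co k j (u t))
        (puiseuxBeta0 σ (S.bifCoeff A₀ t₀ q) d i₀)) * η ^ m)
      (eval (u t) (σ * η ^ npRamification d i₀)
        (psEval (puiseuxBeta0 σ (S.bifCoeff A₀ t₀ q) d i₀) η)) :=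
  hasSum_substPuiseux hσ hr.npRamification_pos hr.coeff_zero_puiseuxBeta0
    (ne_top_of_le_ne_top ENNReal.coe_ne_top (h.psNorm_puiseuxBeta0_le_betaRadius hT hr hσ))
    (ne_top_of_le_ne_top ENNReal.coe_ne_top ((h.tsum_enorm_co_le hT hr hσ u t).trans hu)) hη

theorem DataBound.one_div_invEpsRadius_le (h : S.DataBound A₀ t₀ q σ d i₀ N) (hN : 1 ≤ N) :
    1 / (invEpsRadius N : ℝ) ≤ (etaRadius N : ℝ) ^ npRamification d i₀ := by
  rw [etaRadius, NNReal.coe_inv, NNReal.coe_natCast, inv_pow, one_div]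
  refine inv_anti₀ (pow_pos (by exact_mod_cast invRadius_pos N) _) ?_
  exact_mod_cast Nat.pow_le_pow_right (invRadius_pos N) (h.npRamification_le hN)

end

end PerturbedSystem

theorem coeff_zero_substPuiseux (σ : ℝ) (P : ℕ) (f : ℕ → ℕ → ℝ) (b : PowerSeries ℝ) :
    PowerSeries.coeff 0 (substPuiseux σ P f b) = f 0 0 := by
  simp [substPuiseux]

theorem theorem2 :
    ∃ E : ℕ → ℕ, Computable E ∧ (∀ N, 0 < E N) ∧
      ∀ (S : PerturbedSystem) (A₀ : ℝ) (p : ℤ) (q : ℕ) (t₀ : ℝ) (n : ℕ) (σ : ℝ)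
        (d : ℕ → NPChoice) (i₀ : ℕ),
        A₀ ∈ S.W → 0 < q → IsCoprime p (q : ℤ) → S.ω A₀ = (p : ℝ) / (q : ℝ) →
        deriv S.ω A₀ ≠ 0 →
        IsZeroOfOrder (S.melnikov A₀ q) t₀ n →
        (σ = 1 ∨ σ = -1) →
        IsSimpleNPRun σ (S.bifCoeff A₀ t₀ q) d i₀ →
        (∃ N : ℕ, S.DataBound A₀ t₀ q σ d i₀ N) ∧
        ∀ N : ℕ, S.DataBound A₀ t₀ q σ d i₀ N →
          npRamification d i₀ ∣ n.factorial ∧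
          (∀ t : ℝ, S.solBeta A₀ t₀ q σ d i₀ 0 t = 0 ∧ S.solB A₀ t₀ q σ d i₀ 0 t = 0) ∧
          (∀ (m : ℕ) (t : ℝ),
            |S.solBeta A₀ t₀ q σ d i₀ m t| *
                ((1 / (E N : ℝ)) ^ (1 / (n.factorial : ℝ))) ^
                  (n.factorial / npRamification d i₀ * m) ≤ 1 ∧
            |S.solB A₀ t₀ q σ d i₀ m t| *
                ((1 / (E N : ℝ)) ^ (1 / (n.factorial : ℝ))) ^
                  (n.factorial / npRamification d i₀ * m) ≤ 1) ∧
          ∀ ε : ℝ, |ε| < 1 / (E N : ℝ) → ε = σ * |ε| →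
            ∃ x y : ℝ → ℝ, S.IsSubharmonicSolution p q ε x y ∧
              ∀ t : ℝ,
                HasSum (fun m : ℕ => S.solBeta A₀ t₀ q σ d i₀ m t *
                    (|ε| ^ (1 / (n.factorial : ℝ))) ^
                      (n.factorial / npRamification d i₀ * m))
                  (x (t + t₀) - S.ω A₀ * t) ∧
                HasSum (fun m : ℕ => S.solB A₀ t₀ q σ d i₀ m t *
                    (|ε| ^ (1 / (n.factorial : ℝ))) ^
                      (n.factorial / npRamification d i₀ * m))
                  (y (t + t₀) - A₀) := by
  refine ⟨invEpsRadius, computable_invEpsRadius, invEpsRadius_pos, ?_⟩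
  intro S A₀ p q t₀ n σ d i₀ hA hq _ hω hω' hn hσ hr
  refine ⟨PerturbedSystem.exists_dataBound hA hω' hr, fun N hN => ?_⟩
  have hT : S.TorusBound A₀ p q N := hN.torusBound hq hω
  have hσ1 : |σ| = 1 := by rcases hσ with rfl | rfl <;> simp
  have hσ0 : σ ≠ 0 := by rcases hσ with rfl | rfl <;> norm_num
  have hdvd := hr.npRamification_dvd hσ0 (hT.hasOrder_bifCoeff t₀ hn)
  have hP := hr.npRamification_pos
  have hn0 := n.factorial_ne_zero
  have hE := hN.one_div_invEpsRadius_le hT.one_le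
  have hβ := hT.wnorm_auxBeta_le t₀
  have hB := hT.wnorm_auxB_le_angleBound (t₀ := t₀)
  have hroot : ∀ x : ℝ, 0 ≤ x → (x ^ (1 / (npRamification d i₀ : ℝ))) ^ npRamification d i₀ = x :=
    fun x hx => by rw [one_div]; exact Real.rpow_inv_natCast_pow hx hP.ne'
  have hroot_le : ∀ x : ℝ, 0 ≤ x → x ≤ 1 / (invEpsRadius N : ℝ) →
      x ^ (1 / (npRamification d i₀ : ℝ)) ≤ PerturbedSystem.etaRadius N := fun x hx hxE =>
    le_of_pow_le_pow_left₀ hP.ne' (PerturbedSystem.etaRadius N).2 ((hroot x hx).le.trans (hxE.trans hE))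
  refine ⟨hdvd, fun t => ⟨?_, ?_⟩, fun m t => ?_, fun ε hε hεσ => ?_⟩
  · exact (coeff_zero_substPuiseux _ _ _ _).trans (S.co_auxBeta_zero_zero A₀ t₀ q t)
  · exact (coeff_zero_substPuiseux _ _ _ _).trans (S.co_auxB_zero_left A₀ t₀ q 0 t)
  · have hE0 : (0 : ℝ) ≤ 1 / (invEpsRadius N : ℝ) := by positivity
    rw [Real.rpow_one_div_pow_mul hE0 hn0 hdvd]
    have hle := pow_le_pow_left₀ (Real.rpow_nonneg hE0 _) (hroot_le _ hE0 le_rfl) m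
    exact ⟨(mul_le_mul_of_nonneg_left hle (abs_nonneg _)).trans
        (hN.abs_coeff_substPuiseux_mul_pow_le hT hr hσ1 hβ m t),
      (mul_le_mul_of_nonneg_left hle (abs_nonneg _)).trans
        (hN.abs_coeff_substPuiseux_mul_pow_le hT hr hσ1 hB m t)⟩
  · simp only [Real.rpow_one_div_pow_mul (abs_nonneg ε) hn0 hdvd]
    set η : ℝ := |ε| ^ (1 / (npRamification d i₀ : ℝ)) with hηdef
    have hη0 : 0 ≤ η := Real.rpow_nonneg (abs_nonneg _) _
    have hηr : η ≤ PerturbedSystem.etaRadius N := hroot_le _ (abs_nonneg _) hε.le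
    have hηe : ‖η‖ₑ ≤ PerturbedSystem.etaRadius N := by
      rw [← ofReal_norm, Real.norm_of_nonneg hη0]
      exact (ENNReal.ofReal_le_ofReal hηr).trans (by simp)
    have hεη : ε = σ * η ^ npRamification d i₀ := by rw [hroot _ (abs_nonneg _)]; exact hεσ
    set β₀ := psEval (puiseuxBeta0 σ (S.bifCoeff A₀ t₀ q) d i₀) η with hβ₀
    have hβ₀r : ‖β₀‖ₑ ≤ PerturbedSystem.betaRadius N := by
      have := abs_psEval_le (hN.psNorm_puiseuxBeta0_le_betaRadius hT hr hσ1) hηe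
      rw [← ofReal_norm]
      exact (ENNReal.ofReal_le_ofReal this).trans (by simp)
    have hεr : ‖ε‖ₑ ≤ PerturbedSystem.epsRadius N := by
      have h1 : |ε| ≤ PerturbedSystem.epsRadius N := by
        calc |ε| = η ^ npRamification d i₀ := (hroot _ (abs_nonneg _)).symm
          _ ≤ η := pow_le_of_le_one hη0
            (hηr.trans (by exact_mod_cast PerturbedSystem.etaRadius_le_one N)) hP.ne'
          _ ≤ PerturbedSystem.epsRadius N := hηr.trans (by exact_mod_cast PerturbedSystem.etaRadius_le_epsRadius hT.one_le)
      rw [← ofReal_norm]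
      exact (ENNReal.ofReal_le_ofReal h1).trans (by simp)
    have hzero : ε * eval2 (S.bifCoeff A₀ t₀ q) ε β₀ = 0 := by
      rcases hη0.eq_or_lt with h0 | h0
      · rw [hεη, ← h0, zero_pow hP.ne', mul_zero, zero_mul]
      · rw [hεη, hN.eval2_bifCoeff_eq_zero hT hr hσ1 h0 hηr, mul_zero]
    refine ⟨_, _, hT.isSubharmonicSolution hεr hβ₀r hzero, fun t => ?_⟩
    have h1 := hN.hasSum_substPuiseux_aux hT hr hσ1 hβ hηe t
    have h2 := hN.hasSum_substPuiseux_aux hT hr hσ1 hB hηe t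
    rw [← hεη] at h1 h2
    simp only [add_sub_cancel_right, add_sub_cancel_left]
    exact ⟨h1, h2⟩
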